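/- A $k$-rooted point set is a finite set $P$ of points of the Euclidean plane, $k$ of which are distinguished as roots. A geometric graph on $P$ is a graph with vertex set $P$ whose edges are straight segments; its cost is the sum of the Euclidean lengths of its edges. A path is $y$-monotone if the sequence of the $y$ coordinates of its vertices is increasing or decreasing. A geometric graph on $P$ is a $k$-rooted $y$-monotone spanning graph of $P$ if each root $r$ is connected to each point of $P\setminus\{r\}$ by a $y$-monotone path in the graph, and it is a $k$-rooted $y$-monotone minimum spanning graph of $P$ if it has minimum cost among all such graphs. Theorem. There is an algorithm (for the real RAM, with unit-cost arithmetic operations and comparisons on real numbers) that, given any $k$-rooted point set $P$ with $1<k<|P|$, no two points of which have the same $y$ coordinate, computes in $O(|P|\log^2|P|)$ time a $k$-rooted $y$-monotone spanning graph of $P$ whose cost is at most twice the cost of the $k$-rooted $y$-monotone minimum spanning graph of $P$. The constant in the $O$-notation depends neither on $P$ nor on $k$. -/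

import Mathlib

/-! ## Rooted point sets and geometric graphs in the Euclidean plane -/

/-- The Euclidean plane. -/
abbrev Plane : Type := EuclideanSpace ℝ (Fin 2)

/-- The `x` coordinate of a point. -/
def xCoord (p : Plane) : ℝ := p 0

/-- The `y` coordinate of a point. -/
def yCoord (p : Plane) : ℝ := p 1

/-- A `k`-rooted point set: a finite set of points of the plane, `k` of which are distinguished
as roots. -/
structure RootedPointSet (k : ℕ) where
  points : Finset Plane
  roots : Finset Plane
  roots_subset : roots ⊆ points
  card_roots : roots.card = k

/-- The number of points of `P`. -/
def RootedPointSet.size {k : ℕ} (P : RootedPointSet k) : ℕ := P.points.card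

/-- A geometric graph with vertex set `P`, i.e. a spanning geometric graph of `P`: an edge joining
two points is the straight segment between them. -/
abbrev GeomGraph {k : ℕ} (P : RootedPointSet k) : Type := SimpleGraph {p : Plane // p ∈ P.points}

/-- A sequence of points is `y`-monotone if its sequence of `y` coordinates is increasing or
decreasing. -/
def YMonotoneSeq (l : List Plane) : Prop :=
  (l.map yCoord).Pairwise (· < ·) ∨ (l.map yCoord).Pairwise (· > ·)

/-- `u` and `v` are connected in `G` by a `y`-monotone path. -/
def YMonotoneConnected {k : ℕ} {P : RootedPointSet k} (G : GeomGraph P)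
    (u v : {p : Plane // p ∈ P.points}) : Prop :=
  ∃ w : G.Walk u v, w.IsPath ∧ YMonotoneSeq (w.support.map Subtype.val)

/-- `G` is `k`-rooted `y`-monotone: each root is connected to every other point by a `y`-monotone
path. -/
def IsRootedYMonotone {k : ℕ} {P : RootedPointSet k} (G : GeomGraph P) : Prop :=
  ∀ r p : {p : Plane // p ∈ P.points}, (r : Plane) ∈ P.roots → p ≠ r → YMonotoneConnected G r p

/-- The Euclidean length of the segment between two points of `P`. -/
noncomputable def segmentLength {k : ℕ} {P : RootedPointSet k} :
    Sym2 {p : Plane // p ∈ P.points} → ℝ :=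
  Sym2.lift ⟨fun u v => dist (u : Plane) (v : Plane), fun u v => dist_comm (u : Plane) (v : Plane)⟩

/-- The cost of a geometric graph: the sum of the Euclidean lengths of its edges. -/
noncomputable def cost {k : ℕ} {P : RootedPointSet k} (G : GeomGraph P) : ℝ :=
  ∑ e ∈ (Set.toFinite G.edgeSet).toFinset, segmentLength e

/-- `G` is a `k`-rooted `y`-monotone minimum spanning graph of `P`. -/
def IsRootedYMonotoneMinimum {k : ℕ} {P : RootedPointSet k} (G : GeomGraph P) : Prop :=
  IsRootedYMonotone G ∧ ∀ H : GeomGraph P, IsRootedYMonotone H → cost G ≤ cost H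

/-! ## The real RAM

A random access machine with unit-cost arithmetic on real numbers and with natural numbers as
addresses. It has natural and real registers, and a memory of natural and of real arrays with
indirect addressing. A program is a finite text, so that it names finitely many registers and
arrays. There is no rounding and no other conversion from real to natural numbers. -/

namespace RealRAM

/-- The contents of the registers and of the memory: `nmem A i` and `rmem A i` are the `i`-th cells
of the `A`-th natural and real array. -/
structure State where
  nreg : ℕ → ℕ
  rreg : ℕ → ℝ
  nmem : ℕ → ℕ → ℕ
  rmem : ℕ → ℕ → ℝ

/-- The elementary instructions; `d`, `a`, `b`, `i` are numbers of registers and `A` is the number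
of an array. -/
inductive Instr where
  | nconst (d : ℕ) (c : ℕ)
  | nmove (d a : ℕ)
  | nadd (d a b : ℕ)
  | nsub (d a b : ℕ)
  | nload (d A i : ℕ)
  | nstore (A i a : ℕ)
  | rconst (d : ℕ) (c : ℤ)
  | rmove (d a : ℕ)
  | radd (d a b : ℕ)
  | rsub (d a b : ℕ)
  | rmul (d a b : ℕ)
  | rdiv (d a b : ℕ)
  | rload (d A i : ℕ)
  | rstore (A i a : ℕ)

/-- Write the value `v` to the natural register `d`. -/
def State.setN (s : State) (d v : ℕ) : State := { s with nreg := Function.update s.nreg d v }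

/-- Write the value `v` to the real register `d`. -/
noncomputable def State.setR (s : State) (d : ℕ) (v : ℝ) : State :=
  { s with rreg := Function.update s.rreg d v }

/-- Write the value `v` to cell `i` of the natural array `A`. -/
def State.putN (s : State) (A i v : ℕ) : State :=
  { s with nmem := Function.update s.nmem A (Function.update (s.nmem A) i v) }

/-- Write the value `v` to cell `i` of the real array `A`. -/
noncomputable def State.putR (s : State) (A i : ℕ) (v : ℝ) : State :=
  { s with rmem := Function.update s.rmem A (Function.update (s.rmem A) i v) }

/-- The effect of an elementary instruction. Subtraction of natural numbers is truncated at zero,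
and a division of real numbers by zero gives zero. -/
noncomputable def Instr.effect : Instr → State → State
  | nconst d c, s => s.setN d c
  | nmove d a, s => s.setN d (s.nreg a)
  | nadd d a b, s => s.setN d (s.nreg a + s.nreg b)
  | nsub d a b, s => s.setN d (s.nreg a - s.nreg b)
  | nload d A i, s => s.setN d (s.nmem A (s.nreg i))
  | nstore A i a, s => s.putN A (s.nreg i) (s.nreg a)
  | rconst d c, s => s.setR d (c : ℝ)
  | rmove d a, s => s.setR d (s.rreg a)
  | radd d a b, s => s.setR d (s.rreg a + s.rreg b)
  | rsub d a b, s => s.setR d (s.rreg a - s.rreg b)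
  | rmul d a b, s => s.setR d (s.rreg a * s.rreg b)
  | rdiv d a b, s => s.setR d (s.rreg a / s.rreg b)
  | rload d A i, s => s.setR d (s.rmem A (s.nreg i))
  | rstore A i a, s => s.putR A (s.nreg i) (s.rreg a)

/-- The elementary tests: comparisons of two registers. -/
inductive Test where
  | nlt (a b : ℕ)
  | nle (a b : ℕ)
  | neq (a b : ℕ)
  | rlt (a b : ℕ)
  | rle (a b : ℕ)
  | req (a b : ℕ)

/-- The outcome of a test. -/
def Test.Holds : Test → State → Prop
  | nlt a b, s => s.nreg a < s.nreg b
  | nle a b, s => s.nreg a ≤ s.nreg b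
  | neq a b, s => s.nreg a = s.nreg b
  | rlt a b, s => s.rreg a < s.rreg b
  | rle a b, s => s.rreg a ≤ s.rreg b
  | req a b, s => s.rreg a = s.rreg b

/-- Statements: elementary instructions under structured control flow, and calls of (possibly
recursive) subroutines, which have no parameters and act on the common registers and memory. -/
inductive Stmt where
  | skip
  | instr (I : Instr)
  | seq (S T : Stmt)
  | ite (b : Test) (S T : Stmt)
  | loop (b : Test) (S : Stmt)
  | call (f : ℕ)

/-- A program: a finite list of subroutines and a main statement. -/
structure Program where
  subroutines : List Stmt
  main : Stmt

/-- `Exec procs S s t s'`: with the subroutines `procs`, the statement `S` started in the state `s`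
terminates in the state `s'` after exactly `t` steps. Each elementary instruction, each evaluation
of a test and each call is one step. The statement `loop b S` repeats `S` while `b` holds. -/
inductive Exec (procs : List Stmt) : Stmt → State → ℕ → State → Prop where
  | skip (s : State) : Exec procs Stmt.skip s 1 s
  | instr (I : Instr) (s : State) : Exec procs (Stmt.instr I) s 1 (I.effect s)
  | seq {S T : Stmt} {s₁ s₂ s₃ : State} {t₁ t₂ : ℕ} (h₁ : Exec procs S s₁ t₁ s₂)
      (h₂ : Exec procs T s₂ t₂ s₃) : Exec procs (Stmt.seq S T) s₁ (t₁ + t₂) s₃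
  | ite_true {b : Test} {S T : Stmt} {s s' : State} {t : ℕ} (hb : b.Holds s)
      (h : Exec procs S s t s') : Exec procs (Stmt.ite b S T) s (t + 1) s'
  | ite_false {b : Test} {S T : Stmt} {s s' : State} {t : ℕ} (hb : ¬ b.Holds s)
      (h : Exec procs T s t s') : Exec procs (Stmt.ite b S T) s (t + 1) s'
  | loop_true {b : Test} {S : Stmt} {s₁ s₂ s₃ : State} {t₁ t₂ : ℕ} (hb : b.Holds s₁)
      (h₁ : Exec procs S s₁ t₁ s₂) (h₂ : Exec procs (Stmt.loop b S) s₂ t₂ s₃) :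
      Exec procs (Stmt.loop b S) s₁ (t₁ + t₂ + 1) s₃
  | loop_false {b : Test} {S : Stmt} {s : State} (hb : ¬ b.Holds s) :
      Exec procs (Stmt.loop b S) s 1 s
  | call {f : ℕ} {S : Stmt} {s s' : State} {t : ℕ} (hf : procs[f]? = some S)
      (h : Exec procs S s t s') : Exec procs (Stmt.call f) s (t + 1) s'

/-- The program `A`, started in the state `s`, halts in the state `s'` after exactly `t` steps. -/
def Program.HaltsIn (A : Program) (s : State) (t : ℕ) (s' : State) : Prop :=
  Exec A.subroutines A.main s t s'

end RealRAM

/-! ## Input and output -/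

open Classical in
/-- The initial state for the `k`-rooted point set `P`, whose points are listed in the order `p`:
the natural register `0` holds the number of points, the real arrays `0` and `1` hold the `x` and
`y` coordinates, and the natural array `0` marks the roots by `1`; all else is zero. -/
noncomputable def inputState {k : ℕ} (P : RootedPointSet k)
    (p : Fin P.size ≃ {p : Plane // p ∈ P.points}) : RealRAM.State where
  nreg := fun a => if a = 0 then P.size else 0
  rreg := fun _ => 0
  nmem := fun A i =>
    if h : i < P.size then
      if A = 0 ∧ ((p ⟨i, h⟩ : {p : Plane // p ∈ P.points}) : Plane) ∈ P.roots then 1 else 0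
    else 0
  rmem := fun A i =>
    if h : i < P.size then
      if A = 0 then xCoord (p ⟨i, h⟩) else if A = 1 then yCoord (p ⟨i, h⟩) else 0
    else 0

/-- In the state `s`, the `j`-th entry of the output is the edge `e`: the natural arrays `1` and `2`
hold in cell `j` the indices of the endpoints of `e`. -/
def OutputEntry {k : ℕ} {P : RootedPointSet k} (p : Fin P.size ≃ {p : Plane // p ∈ P.points})
    (s : RealRAM.State) (j : ℕ) (e : Sym2 {p : Plane // p ∈ P.points}) : Prop :=
  ∃ u v : Fin P.size, s.nmem 1 j = u ∧ s.nmem 2 j = v ∧ e = s(p u, p v)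

/-- The output of the state `s`, a list whose length is in the natural register `0`, contains each
edge of `G` exactly once, and nothing else. -/
def OutputsGraph {k : ℕ} {P : RootedPointSet k} (p : Fin P.size ≃ {p : Plane // p ∈ P.points})
    (s : RealRAM.State) (G : GeomGraph P) : Prop :=
  (∀ j < s.nreg 0, ∃ e ∈ G.edgeSet, OutputEntry p s j e) ∧
    ∀ e ∈ G.edgeSet, ∃! j : ℕ, j < s.nreg 0 ∧ OutputEntry p s j e

/-! Approximation. Call `v` eligible for `u` if it lies below `u`, but not below the highest root
under `u`. In every rooted y-monotone graph, the monotone path from that highest root arrives at `u`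
from an eligible point. Since `u` is the upper end of this last edge, different points `u` receive
different edges. So the distances from the points above some root to their nearest eligible points
sum to at most the cost of any rooted y-monotone graph (`sum_dist_le_cost`). Conversely, if each
such point is joined to a nearest eligible point, one can descend from it to any root below it,
since no step passes a root (`exists_increasing_walk`). The same holds upside down. The union of
both systems of edges, `neighbourGraph`, is therefore rooted y-monotone and costs at most twice the
minimum (`exists_minimum_cost_le`).

Geometry of the search. In an upward sweep, the candidates for the next point are the last root and
all later points, so the set grows by insertions and is reset at roots. All candidates lie below the
query. For sites `a`, `b`, `c` consecutive in `x`, add the difference of the squared distances to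
`a` and `b` and that for `c` and `b`, each weighted with the horizontal gap on the other side of
`b`. The sum does not depend on the `x` coordinate of the query and is affine in its height. Hence
there is either no threshold for `b`, or one, the height of the circumcentre, above which `a` or `c`
is always at least as near as `b`, so that `b` can be deleted for good (`dominated_of_death`). As
long as no triple has passed its threshold, the distances from a point of the sweep line to the
sites, in lexicographic order, first fall and then rise (`unimodal_right`, `unimodal_left`), and a
nearest site is found by binary search (`descendProg_spec`).

Data structure and time. One tournament tree over the sites serves for neighbours, for the least
threshold, for the binary search and for sorting, each at logarithmic cost per operation. In each
pass a site is inserted at most once and deleted at most once; each active leaf carries the credits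
for its own deletion. This gives O(n log n) steps, which is within the claimed bound because log n ≥
1 for n ≥ 3 (`budget_le`).

Verification. `Run` is a total correctness judgement in which time is a resource that the
postcondition also sees, so amortized bounds are ordinary loop invariants. `Preserved` supplies the
frame conditions. -/

/-! ## A program logic with time credits -/

namespace RealRAM

/-- The statement `S`, started in the state `s` with `m` time credits, terminates without exceeding
them, in a state and with a remainder of credits that satisfy `Q`. -/
def Run (S : Stmt) (s : State) (m : ℕ) (Q : State → ℕ → Prop) : Prop :=
  ∃ t s' m', Exec [] S s t s' ∧ t + m' ≤ m ∧ Q s' m'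

theorem Run.instr {I : Instr} {s : State} {m : ℕ} {Q : State → ℕ → Prop} (hm : 1 ≤ m)
    (h : Q (I.effect s) (m - 1)) : Run (Stmt.instr I) s m Q :=
  ⟨1, _, m - 1, Exec.instr I s, by omega, h⟩

theorem Run.skip {s : State} {m : ℕ} {Q : State → ℕ → Prop} (hm : 1 ≤ m)
    (h : Q s (m - 1)) : Run Stmt.skip s m Q :=
  ⟨1, _, m - 1, Exec.skip s, by omega, h⟩

theorem Run.seq {S T : Stmt} {s : State} {m : ℕ} {Q : State → ℕ → Prop}
    (h : Run S s m fun s' m' => Run T s' m' Q) : Run (Stmt.seq S T) s m Q := by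
  obtain ⟨t₁, s₁, m₁, h₁, hm₁, t₂, s₂, m₂, h₂, hm₂, hQ⟩ := h
  exact ⟨t₁ + t₂, s₂, m₂, Exec.seq h₁ h₂, by omega, hQ⟩

theorem Run.ite {b : Test} {S T : Stmt} {s : State} {m : ℕ} {Q : State → ℕ → Prop} (hm : 1 ≤ m)
    (h₁ : b.Holds s → Run S s (m - 1) Q) (h₂ : ¬ b.Holds s → Run T s (m - 1) Q) :
    Run (Stmt.ite b S T) s m Q := by
  by_cases hb : b.Holds s
  · obtain ⟨t, s', m', h, hm', hQ⟩ := h₁ hb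
    exact ⟨t + 1, s', m', Exec.ite_true hb h, by omega, hQ⟩
  · obtain ⟨t, s', m', h, hm', hQ⟩ := h₂ hb
    exact ⟨t + 1, s', m', Exec.ite_false hb h, by omega, hQ⟩

theorem Run.mono {S : Stmt} {s : State} {m m₂ : ℕ} {Q Q₂ : State → ℕ → Prop} (h : Run S s m Q)
    (hm : m ≤ m₂) (hQ : ∀ s' m', Q s' m' → Q₂ s' m') : Run S s m₂ Q₂ := by
  obtain ⟨t, s', m', h, hm', hQ'⟩ := h
  exact ⟨t, s', m', h, by omega, hQ _ _ hQ'⟩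

/-- The rule for loops: termination follows since each iteration uses up a credit. -/
theorem Run.loop {b : Test} {S : Stmt} {Q : State → ℕ → Prop} (I : State → ℕ → Prop)
    (step : ∀ s m, I s m → b.Holds s → 1 ≤ m ∧ Run S s (m - 1) I)
    (exit : ∀ s m, I s m → ¬ b.Holds s → 1 ≤ m ∧ Q s (m - 1)) {s : State} {m : ℕ} (h : I s m) :
    Run (Stmt.loop b S) s m Q := by
  induction m using Nat.strong_induction_on generalizing s with
  | _ m ih =>
    by_cases hb : b.Holds s
    · obtain ⟨hm, t₁, s₁, m₁, h₁, hm₁, hI⟩ := step s m h hb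
      obtain ⟨t₂, s₂, m₂, h₂, hm₂, hQ⟩ := ih m₁ (by omega) hI
      exact ⟨t₁ + t₂ + 1, s₂, m₂, Exec.loop_true hb h₁ h₂, by omega, hQ⟩
    · obtain ⟨hm, hQ⟩ := exit s m h hb
      exact ⟨1, s, m - 1, Exec.loop_false hb, by omega, hQ⟩

/-- Statements without loops and calls. -/
def Stmt.LoopFree : Stmt → Prop
  | .skip => True
  | .instr _ => True
  | .seq S T => S.LoopFree ∧ T.LoopFree
  | .ite _ S T => S.LoopFree ∧ T.LoopFree
  | .loop _ _ => False
  | .call _ => False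

/-- An upper bound for the number of steps of a loop-free statement. -/
def Stmt.steps : Stmt → ℕ
  | .skip => 1
  | .instr _ => 1
  | .seq S T => S.steps + T.steps
  | .ite _ S T => max S.steps T.steps + 1
  | .loop _ _ => 0
  | .call _ => 0

open Classical in
/-- The effect of a loop-free statement. -/
noncomputable def Stmt.out : Stmt → State → State
  | .skip, s => s
  | .instr I, s => I.effect s
  | .seq S T, s => T.out (S.out s)
  | .ite b S T, s => if b.Holds s then S.out s else T.out s
  | .loop _ _, s => s
  | .call _, s => s

/-- Loop-free code is handled by evaluation: its effect is a function of the state that `simp` can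
compute, and its cost is bounded by a numeral. Only loops need invariants. -/
theorem Run.of_loopFree {S : Stmt} {s : State} {m : ℕ} {Q : State → ℕ → Prop} (hS : S.LoopFree)
    (hm : S.steps ≤ m) (h : Q (S.out s) (m - S.steps)) : Run S s m Q := by
  induction S generalizing s m Q with
  | skip => exact Run.skip hm h
  | instr I => exact Run.instr hm h
  | seq S T ihS ihT =>
    simp only [Stmt.steps] at hm h
    refine Run.seq (ihS hS.1 (by omega) (ihT hS.2 (by omega) ?_))
    rwa [Nat.sub_sub]
  | ite b S T ihS ihT =>
    simp only [Stmt.steps, Stmt.out] at hm h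
    refine Run.ite (by omega) (fun hb => ?_) fun hb => ?_
    · rw [if_pos hb] at h
      refine (ihS hS.1 le_rfl (Q := fun s' _ => s' = S.out s) rfl).elim ?_
      rintro t ⟨s', m', h1, h2, rfl⟩
      exact ⟨t, _, _, h1, by omega, h⟩
    · rw [if_neg hb] at h
      refine (ihT hS.2 le_rfl (Q := fun s' _ => s' = T.out s) rfl).elim ?_
      rintro t ⟨s', m', h1, h2, rfl⟩
      exact ⟨t, _, _, h1, by omega, h⟩
  | loop => exact hS.elim
  | call => exact hS.elim

/-- Straight-line code. -/
def block : List Instr → Stmt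
  | [] => Stmt.skip
  | [I] => Stmt.instr I
  | I :: J :: l => Stmt.seq (Stmt.instr I) (block (J :: l))

/-! ### Frame conditions read off from the program text -/

/-- The natural registers that an instruction writes. -/
def Instr.nregs : Instr → List ℕ
  | nconst d _ | nmove d _ | nadd d _ _ | nsub d _ _ | nload d _ _ => [d]
  | _ => []

/-- The real registers that an instruction writes. -/
def Instr.rregs : Instr → List ℕ
  | rconst d _ | rmove d _ | radd d _ _ | rsub d _ _ | rmul d _ _ | rdiv d _ _ | rload d _ _ => [d]
  | _ => []

/-- The natural arrays that an instruction writes. -/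
def Instr.narrays : Instr → List ℕ
  | nstore A _ _ => [A]
  | _ => []

/-- The real arrays that an instruction writes. -/
def Instr.rarrays : Instr → List ℕ
  | rstore A _ _ => [A]
  | _ => []

/-- Collects data of the instructions of a statement. -/
def Stmt.collect (f : Instr → List ℕ) : Stmt → List ℕ
  | .skip => []
  | .instr I => f I
  | .seq S T => S.collect f ++ T.collect f
  | .ite _ S T => S.collect f ++ T.collect f
  | .loop _ S => S.collect f
  | .call _ => []

/-- Everything that `S` does not write is unchanged. -/
structure Preserved (S : Stmt) (s s' : State) : Prop where
  nreg : ∀ r, r ∉ S.collect Instr.nregs → s'.nreg r = s.nreg r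
  rreg : ∀ r, r ∉ S.collect Instr.rregs → s'.rreg r = s.rreg r
  nmem : ∀ r, r ∉ S.collect Instr.narrays → s'.nmem r = s.nmem r
  rmem : ∀ r, r ∉ S.collect Instr.rarrays → s'.rmem r = s.rmem r

theorem Preserved.trans {S T U : Stmt} {s s' s'' : State} (h : Preserved S s s')
    (h' : Preserved T s' s'') (hS : ∀ f, S.collect f ⊆ U.collect f)
    (hT : ∀ f, T.collect f ⊆ U.collect f) : Preserved U s s'' :=
  ⟨fun r hr => (h'.nreg r fun h => hr (hT _ h)).trans (h.nreg r fun h => hr (hS _ h)),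
    fun r hr => (h'.rreg r fun h => hr (hT _ h)).trans (h.rreg r fun h => hr (hS _ h)),
    fun r hr => (h'.nmem r fun h => hr (hT _ h)).trans (h.nmem r fun h => hr (hS _ h)),
    fun r hr => (h'.rmem r fun h => hr (hT _ h)).trans (h.rmem r fun h => hr (hS _ h))⟩

theorem Preserved.mono {S U : Stmt} {s s' : State} (h : Preserved S s s')
    (hS : ∀ f, S.collect f ⊆ U.collect f) : Preserved U s s' :=
  ⟨fun r hr => h.nreg r fun h => hr (hS _ h), fun r hr => h.rreg r fun h => hr (hS _ h),
    fun r hr => h.nmem r fun h => hr (hS _ h), fun r hr => h.rmem r fun h => hr (hS _ h)⟩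

theorem Preserved.refl (S : Stmt) (s : State) : Preserved S s s :=
  ⟨fun _ _ => rfl, fun _ _ => rfl, fun _ _ => rfl, fun _ _ => rfl⟩

/-- What a statement may write is a list computed from its text, so frame conditions for concrete
programs become decidable membership statements. An array counts as one item; its individual cells
have to be followed by hand. -/
theorem Exec.preserved {S : Stmt} {s s' : State} {t : ℕ} (h : Exec [] S s t s') :
    Preserved S s s' := by
  induction h with
  | skip s => exact Preserved.refl _ _
  | instr I s =>
    cases I <;> constructor <;> intro r hr <;>
      simp [Stmt.collect, Instr.nregs, Instr.rregs, Instr.narrays, Instr.rarrays, Instr.effect,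
        State.setN, State.setR, State.putN, State.putR] at hr ⊢ <;> simp [hr]
  | seq _ _ ih₁ ih₂ =>
    exact ih₁.trans ih₂ (fun f => List.subset_append_left _ _)
      fun f => List.subset_append_right _ _
  | ite_true _ _ ih => exact ih.mono fun f => List.subset_append_left _ _
  | ite_false _ _ ih => exact ih.mono fun f => List.subset_append_right _ _
  | loop_true _ _ _ ih₁ ih₂ =>
    exact ih₁.trans ih₂ (fun f => List.Subset.refl _) fun f => List.Subset.refl _
  | loop_false _ => exact Preserved.refl _ _
  | call hf => simp at hf

/-- Offers the frame condition in the postcondition for free, so that loop invariants need not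
repeat what the body cannot change. -/
theorem Run.preserving {S : Stmt} {s : State} {m : ℕ} {Q : State → ℕ → Prop}
    (h : Run S s m fun s' m' => Preserved S s s' → Q s' m') : Run S s m Q := by
  obtain ⟨t, s', m', h1, h2, h3⟩ := h
  exact ⟨t, s', m', h1, h2, h3 h1.preserved⟩

theorem Preserved.of_loopFree {S : Stmt} (hS : S.LoopFree) (s : State) :
    Preserved S s (S.out s) := by
  obtain ⟨t, s', m', h1, -, rfl⟩ := Run.of_loopFree (m := S.steps)
    (Q := fun s' _ => s' = S.out s) hS le_rfl rfl
  exact h1.preserved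

/-- Counting loops: `S` is executed for the values `0, …, n - 1` of the register `i`, and its
execution increments `i`. -/
theorem Run.forLoop {S : Stmt} {Q : State → ℕ → Prop} {i b n c : ℕ} (I : ℕ → State → Prop)
    {s : State} {m : ℕ} (hb : s.nreg b = n) (hbS : b ∉ S.collect Instr.nregs)
    (hi : ∀ j s', I j s' → s'.nreg i = j) (h : I 0 s) (hm : n * (c + 1) + 1 ≤ m)
    (step : ∀ j s' m', j < n → I j s' → Preserved S s s' → c ≤ m' →
      Run S s' m' fun s'' m'' => I (j + 1) s'' ∧ m' - c ≤ m'')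
    (exit : ∀ s' m', I n s' → Preserved S s s' → m - (n * (c + 1) + 1) ≤ m' → Q s' m') :
    Run (Stmt.loop (Test.nlt i b) S) s m Q := by
  -- Each of the `j` completed rounds has cost at most `c` for the body and one for the test; the
  -- final failing test is the remaining `1` in the budget.
  refine Run.loop (fun s' m' => ∃ j ≤ n, I j s' ∧ Preserved S s s' ∧ m ≤ m' + j * (c + 1)) ?_ ?_
    ⟨0, Nat.zero_le _, h, Preserved.refl _ _, by omega⟩
  · rintro s' m' ⟨j, hj, hI, hP, hm'⟩ hlt
    simp only [Test.Holds, hi _ _ hI, (hP.nreg b hbS).trans hb] at hlt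
    have h1 : (j + 1) * (c + 1) ≤ n * (c + 1) := Nat.mul_le_mul_right _ hlt
    rw [Nat.add_mul] at h1
    refine ⟨by omega, Run.preserving ((step j s' (m' - 1) hlt hI hP (by omega)).mono le_rfl ?_)⟩
    rintro s₂ m₂ ⟨hI₂, hm₂⟩ hP₂
    refine ⟨j + 1, hlt, hI₂, hP.trans hP₂ (fun f => List.Subset.refl _)
      (fun f => List.Subset.refl _), ?_⟩
    rw [Nat.add_mul]
    omega
  · rintro s' m' ⟨j, hj, hI, hP, hm'⟩ hlt
    simp only [Test.Holds, hi _ _ hI, (hP.nreg b hbS).trans hb] at hlt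
    obtain rfl : j = n := by omega
    exact ⟨by omega, exit s' _ hI hP (by omega)⟩

end RealRAM

/-! ## Nearest eligible neighbours give a 2-approximation -/

section Heights

variable {V : Type*}

/-- `v` is below `u` and not below a root that is below `u`. -/
def Eligible (η : V → ℝ) (R : V → Prop) (u v : V) : Prop :=
  η v < η u ∧ ∀ r, R r → η r < η u → η r ≤ η v

/-- Some root is below `u`. -/
def HasLowerRoot (η : V → ℝ) (R : V → Prop) (u : V) : Prop :=
  ∃ r, R r ∧ η r < η u

/-- `f` maps each point above some root to a nearest eligible point. -/
def IsNearestEligible [Dist V] (η : V → ℝ) (R : V → Prop) (f : V → V) : Prop :=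
  ∀ u, HasLowerRoot η R u →
    Eligible η R u (f u) ∧ ∀ v, Eligible η R u v → dist u (f u) ≤ dist u v

/-- Induction on the height of `u`: eligibility keeps `f u` at or above the root `r`, so the descent
cannot miss `r`, and by injectivity it is at `r` once the heights agree. The bound on the heights
along the walk is what allows `u` to be appended. -/
theorem exists_increasing_walk [Finite V] {η : V → ℝ} (hη : Function.Injective η) {R : V → Prop}
    {G : SimpleGraph V} {f : V → V}
    (hf : ∀ u, HasLowerRoot η R u → Eligible η R u (f u) ∧ G.Adj (f u) u) {r : V}
    (hr : R r) (u : V) (hu : u = r ∨ η r < η u) :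
    ∃ w : G.Walk r u, (w.support.map η).Pairwise (· < ·) ∧ ∀ v ∈ w.support, η v ≤ η u := by
  have wf : WellFounded fun a b : V => η a < η b := by
    have : IsStrictOrder V fun a b : V => η a < η b :=
      { irrefl := fun a => lt_irrefl _, trans := fun a b c => lt_trans }
    exact Finite.wellFounded_of_trans_of_irrefl _
  induction u using wf.induction with
  | _ u ih =>
    rcases hu with rfl | hu
    · exact ⟨SimpleGraph.Walk.nil, by simp, by simp⟩
    · obtain ⟨⟨h1, h2⟩, h3⟩ := hf u ⟨r, hr, hu⟩
      obtain ⟨w, hw, hw'⟩ := ih (f u) h1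
        ((h2 r hr hu).eq_or_lt.imp (fun h => (hη h).symm) id)
      refine ⟨w.concat h3, ?_, ?_⟩
      · rw [SimpleGraph.Walk.support_concat]
        simp only [List.map_append, List.map_cons, List.map_nil,
          List.pairwise_append, List.pairwise_singleton, List.mem_map, List.mem_singleton]
        refine ⟨hw, trivial, ?_⟩
        rintro _ ⟨v, hv, rfl⟩ _ rfl
        exact (hw' v hv).trans_lt h1
      · intro v hv
        rw [SimpleGraph.Walk.support_concat] at hv
        simp only [List.mem_append, List.mem_singleton] at hv
        rcases hv with hv | rfl
        · exact (hw' v hv).trans h1.le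
        · exact le_rfl

/-- The wanted vertex is the one before `u` on the walk, found as the second vertex of the reversed
walk. Reversal exchanges increasing and decreasing, and the heights of the two ends decide which of
them occurs. -/
theorem exists_eligible_adj {η : V → ℝ} {G : SimpleGraph V} {r u : V} (w : G.Walk r u)
    (hw : (w.support.map η).Pairwise (· < ·) ∨ (w.support.map η).Pairwise (· > ·))
    (hu : η r < η u) : ∃ v, G.Adj v u ∧ η r ≤ η v ∧ η v < η u := by
  have key : ∀ w : G.Walk u r, ((w.support.map η).Pairwise (· < ·) ∨
      (w.support.map η).Pairwise (· > ·)) → ∃ v, G.Adj v u ∧ η r ≤ η v ∧ η v < η u := by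
    intro w hw
    cases w with
    | nil => exact absurd hu (lt_irrefl _)
    | @cons _ v _ h w =>
      have hr : r ∈ w.support := w.end_mem_support
      simp only [SimpleGraph.Walk.support_cons, List.map_cons, List.pairwise_cons, List.mem_map,
        forall_exists_index, and_imp, forall_apply_eq_imp_iff₂] at hw
      rcases hw with hw | hw
      · exact absurd (hw.1 r hr) hu.not_gt
      · refine ⟨v, h.symm, ?_, hw.1 v w.start_mem_support⟩
        have h2 := hw.2
        rw [← SimpleGraph.Walk.cons_tail_support] at h2 hr
        simp only [List.map_cons, List.pairwise_cons, List.mem_map, forall_exists_index, and_imp,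
          forall_apply_eq_imp_iff₂] at h2
        rcases List.mem_cons.1 hr with rfl | hr
        · exact le_rfl
        · exact (h2.1 r hr).le
  refine key w.reverse ?_
  rw [SimpleGraph.Walk.support_reverse, List.map_reverse, List.pairwise_reverse,
    List.pairwise_reverse]
  exact hw.symm

end Heights

section Approximation

variable {k : ℕ} {P : RootedPointSet k}

/-- The height function of a point, for `ε = 1`, and its negative, for `ε = -1`. -/
noncomputable def signedHeight (ε : ℝ) (u : {p : Plane // p ∈ P.points}) : ℝ := ε * yCoord u

/-- The roots, as a predicate on the vertices. -/
def IsRoot (u : {p : Plane // p ∈ P.points}) : Prop := (u : Plane) ∈ P.roots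

theorem signedHeight_injective (hP : Set.InjOn yCoord (P.points : Set Plane)) {ε : ℝ}
    (hε : ε ≠ 0) : Function.Injective (signedHeight (P := P) ε) := fun u v h =>
  Subtype.ext (hP u.2 v.2 (mul_left_cancel₀ hε h))

theorem segmentLength_nonneg (e : Sym2 {p : Plane // p ∈ P.points}) : 0 ≤ segmentLength e := by
  induction e with
  | _ u v => exact dist_nonneg (x := (u : Plane)) (y := v)

/-- Being monotone is invariant under a reflection of the plane. This lets one argument, with a sign
`ε`, serve for the edges below and above. -/
theorem yMonotoneSeq_iff {ε : ℝ} (hε : ε = 1 ∨ ε = -1) (l : List {p : Plane // p ∈ P.points}) :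
    YMonotoneSeq (l.map Subtype.val) ↔ (l.map (signedHeight ε)).Pairwise (· < ·) ∨
      (l.map (signedHeight ε)).Pairwise (· > ·) := by
  unfold YMonotoneSeq
  simp only [List.map_map, List.pairwise_map, Function.comp_def, signedHeight]
  rcases hε with rfl | rfl
  · simp
  · simp [or_comm]

-- The lower bound for every competitor: its edges `s(g u, u)`, with `g u` eligible for `u`, are
-- pairwise distinct, and each is at least as long as the segment to the nearest eligible point.
open Classical in
theorem sum_dist_le_cost {ε : ℝ}
    (hε : ε = 1 ∨ ε = -1) {f : {p : Plane // p ∈ P.points} → {p : Plane // p ∈ P.points}}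
    (hf : IsNearestEligible (signedHeight ε) IsRoot f) {H : GeomGraph P}
    (hH : IsRootedYMonotone H) :
    ∑ u with HasLowerRoot (signedHeight ε) IsRoot u, dist u (f u) ≤ cost H := by
  have h1 : ∀ u, HasLowerRoot (signedHeight ε) IsRoot u →
      ∃ v, H.Adj v u ∧ Eligible (signedHeight ε) IsRoot u v := by
    intro u ⟨r₀, hr₀, hu₀⟩
    -- The highest root below `u`. A vertex that is not below it is not below any other root under
    -- `u` either.
    obtain ⟨r, hr, hmax⟩ := Finset.exists_max_image
      (Finset.univ.filter fun r => IsRoot r ∧ signedHeight ε r < signedHeight ε u)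
      (signedHeight ε) ⟨r₀, by simp [hr₀, hu₀]⟩
    simp only [Finset.mem_filter, Finset.mem_univ, true_and] at hr hmax
    have hne : u ≠ r := by
      rintro rfl
      exact lt_irrefl _ hr.2
    obtain ⟨w, -, hw⟩ := hH r u hr.1 hne
    rw [yMonotoneSeq_iff hε] at hw
    obtain ⟨v, hv1, hv2, hv3⟩ := exists_eligible_adj w hw hr.2
    exact ⟨v, hv1, hv3, fun r' hr' hu' => (hmax r' ⟨hr', hu'⟩).trans hv2⟩
  choose! g hg1 hg2 using h1
  calc ∑ u with HasLowerRoot (signedHeight ε) IsRoot u, dist u (f u)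
      ≤ ∑ u with HasLowerRoot (signedHeight ε) IsRoot u, segmentLength s(g u, u) := by
        refine Finset.sum_le_sum fun u hu => ?_
        have hu' := (Finset.mem_filter.1 hu).2
        exact ((hf u hu').2 _ (hg2 u hu')).trans_eq (dist_comm _ _)
    _ = ∑ e ∈ (Finset.univ.filter (HasLowerRoot (signedHeight ε) IsRoot)).image
          fun u => s(g u, u), segmentLength e := by
        rw [Finset.sum_image]
        intro u hu v hv huv
        simp only [Finset.coe_filter, Finset.mem_univ, true_and, Set.mem_ofPred_eq] at hu hv
        -- If the edges agreed with their ends exchanged, each of `u` and `v` would be strictly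
        -- below the other.
        rcases Sym2.eq_iff.1 huv with h | h
        · exact h.2
        · have := (hg2 u hu).1
          have := (hg2 v hv).1
          rw [← h.2, h.1] at *
          linarith
    _ ≤ cost H := by
        refine Finset.sum_le_sum_of_subset_of_nonneg ?_ fun e _ _ => segmentLength_nonneg e
        intro e he
        obtain ⟨u, hu, rfl⟩ := Finset.mem_image.1 he
        simpa using hg1 u (Finset.mem_filter.1 hu).2

/-- The graph that joins `u` to `f u` if some root is below `u`, and to `g u` if some root is above
`u`. -/
noncomputable def neighbourGraph (P : RootedPointSet k)
    (f g : {p : Plane // p ∈ P.points} → {p : Plane // p ∈ P.points}) : GeomGraph P :=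
  SimpleGraph.fromRel fun u v => (HasLowerRoot (signedHeight 1) IsRoot u ∧ f u = v) ∨
    (HasLowerRoot (signedHeight (-1)) IsRoot u ∧ g u = v)

variable {f g : {p : Plane // p ∈ P.points} → {p : Plane // p ∈ P.points}}

theorem neighbourGraph_isRootedYMonotone (hP : Set.InjOn yCoord (P.points : Set Plane))
    (hf : IsNearestEligible (signedHeight 1) IsRoot f)
    (hg : IsNearestEligible (signedHeight (-1)) IsRoot g) :
    IsRootedYMonotone (neighbourGraph P f g) := by
  have key : ∀ (ε : ℝ), (ε = 1 ∨ ε = -1) →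
      ∀ f', IsNearestEligible (signedHeight ε) IsRoot f' →
      (∀ u, HasLowerRoot (signedHeight ε) IsRoot u → f' u ≠ u →
        (neighbourGraph P f g).Adj (f' u) u) →
      ∀ r u, IsRoot r → signedHeight ε r < signedHeight ε u →
        YMonotoneConnected (neighbourGraph P f g) r u := by
    intro ε hε f' hf' hadj r u hr hu
    obtain ⟨w, hw, -⟩ := exists_increasing_walk (G := neighbourGraph P f g)
      (signedHeight_injective hP (by rcases hε with rfl | rfl <;> norm_num)) (f := f')
      (fun v hv => ⟨(hf' v hv).1, hadj v hv fun h => by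
        have := (hf' v hv).1.1
        rw [h] at this
        exact lt_irrefl _ this⟩) hr u (Or.inr hu)
    refine ⟨w, ?_, (yMonotoneSeq_iff hε _).2 (Or.inl hw)⟩
    rw [SimpleGraph.Walk.isPath_def]
    exact List.Nodup.of_map _ (hw.imp ne_of_lt)
  intro r u hr hne
  rcases lt_trichotomy (yCoord r) (yCoord u) with h | h | h
  · refine key 1 (Or.inl rfl) f hf (fun v hv hv' => ?_) r u hr (by simpa [signedHeight] using h)
    exact ⟨hv', Or.inr (Or.inl ⟨hv, rfl⟩)⟩
  · exact absurd (Subtype.ext (hP r.2 u.2 h)).symm hne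
  · refine key (-1) (Or.inr rfl) g hg (fun v hv hv' => ?_) r u hr (by simpa [signedHeight] using h)
    exact ⟨hv', Or.inr (Or.inr ⟨hv, rfl⟩)⟩

-- Every edge arises from the rule for one of the two directions. An edge that arises from several
-- ends or directions is paid once in the cost and repeatedly on the right, which only helps.
open Classical in
theorem cost_neighbourGraph_le (P : RootedPointSet k)
    (f g : {p : Plane // p ∈ P.points} → {p : Plane // p ∈ P.points}) :
    cost (neighbourGraph P f g) ≤
      ∑ u with HasLowerRoot (signedHeight 1) IsRoot u, dist u (f u) +
        ∑ u with HasLowerRoot (signedHeight (-1)) IsRoot u, dist u (g u) := by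
  have himage : ∀ (s : Finset {p : Plane // p ∈ P.points})
      (f : {p : Plane // p ∈ P.points} → {p : Plane // p ∈ P.points}),
      ∑ e ∈ s.image fun u => s(u, f u), segmentLength e ≤ ∑ u ∈ s, dist u (f u) := fun s f =>
    Finset.sum_image_le_of_nonneg fun e _ => segmentLength_nonneg e
  refine le_trans ?_ (add_le_add (himage _ f) (himage _ g))
  rw [← Finset.sum_union_inter]
  refine le_trans ?_ (le_add_of_nonneg_right (Finset.sum_nonneg fun e _ => segmentLength_nonneg e))
  refine Finset.sum_le_sum_of_subset_of_nonneg ?_ fun e _ _ => segmentLength_nonneg e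
  intro e he
  simp only [Set.Finite.mem_toFinset] at he
  induction e with
  | _ u v =>
    rw [SimpleGraph.mem_edgeSet] at he
    simp only [Finset.mem_union, Finset.mem_image, Finset.mem_filter, Finset.mem_univ, true_and]
    rcases he.2 with (⟨h, rfl⟩ | ⟨h, rfl⟩) | (⟨h, rfl⟩ | ⟨h, rfl⟩)
    · exact Or.inl ⟨u, h, rfl⟩
    · exact Or.inr ⟨u, h, rfl⟩
    · exact Or.inl ⟨v, h, Sym2.eq_swap⟩
    · exact Or.inr ⟨v, h, Sym2.eq_swap⟩

theorem exists_minimum {G : GeomGraph P} (hG : IsRootedYMonotone G) :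
    ∃ Gopt : GeomGraph P, IsRootedYMonotoneMinimum Gopt := by
  obtain ⟨Gopt, h1, h2⟩ := Set.exists_min_image {H : GeomGraph P | IsRootedYMonotone H} cost
    (Set.toFinite _) ⟨G, hG⟩
  exact ⟨Gopt, h1, h2⟩

theorem exists_minimum_cost_le (hP : Set.InjOn yCoord (P.points : Set Plane))
    (hf : IsNearestEligible (signedHeight 1) IsRoot f)
    (hg : IsNearestEligible (signedHeight (-1)) IsRoot g) :
    ∃ Gopt : GeomGraph P, IsRootedYMonotoneMinimum Gopt ∧
      cost (neighbourGraph P f g) ≤ 2 * cost Gopt := by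
  obtain ⟨Gopt, h⟩ := exists_minimum (neighbourGraph_isRootedYMonotone hP hf hg)
  have h1 := sum_dist_le_cost (Or.inl rfl) hf h.1
  have h2 := sum_dist_le_cost (Or.inr rfl) hg h.1
  have h3 := cost_neighbourGraph_le P f g
  exact ⟨Gopt, h, by linarith⟩

end Approximation

/-! ## Nearest sites above the sites -/

/-- The square of the distance of the points `(x, y)` and `(x', y')`. -/
def sqDist (x y x' y' : ℝ) : ℝ := (x - x') ^ 2 + (y - y') ^ 2

/-- For consecutive sites `a`, `b`, `c`, ordered lexicographically, the site `b` is dominated by `a`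
and `c` at the height `h` if `deathNum a b c > (h - b.2) * deathDen a b c`. -/
def deathNum (ax ay bx bY cx cy : ℝ) : ℝ :=
  ((cx - bx) ^ 2 + (cy - bY) ^ 2) * (ax - bx) - ((ax - bx) ^ 2 + (ay - bY) ^ 2) * (cx - bx)

/-- See `deathNum`. -/
def deathDen (ax ay bx bY cx cy : ℝ) : ℝ :=
  2 * ((cy - bY) * (ax - bx) - (ay - bY) * (cx - bx))

/-- Consequently a nonnegative `deathDen` rules out domination at every height above `b`, and a
negative one puts the threshold at or above the height of `b`. -/
theorem deathNum_nonpos {ax ay bx bY cx cy : ℝ} (hab : ax ≤ bx) (hbc : bx ≤ cx) :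
    deathNum ax ay bx bY cx cy ≤ 0 := by
  unfold deathNum
  have h1 : 0 ≤ ((cx - bx) ^ 2 + (cy - bY) ^ 2) * (bx - ax) :=
    mul_nonneg (by positivity) (by linarith)
  have h2 : 0 ≤ ((ax - bx) ^ 2 + (ay - bY) ^ 2) * (cx - bx) :=
    mul_nonneg (by positivity) (by linarith)
  linarith

/-- If the query were strictly nearer to `b` than to both others, the combination in `e3` would be
nonnegative, its weights being the horizontal gaps. But `x` cancels from it, and what remains
decreases in `y` and is negative beyond the threshold. -/
theorem dominated_of_death {ax ay bx bY cx cy h x y : ℝ} (hab : ax ≤ bx) (hbc : bx ≤ cx)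
    (hy : h ≤ y) (hD : deathDen ax ay bx bY cx cy < 0)
    (hdeath : bY + deathNum ax ay bx bY cx cy / deathDen ax ay bx bY cx cy < h) :
    sqDist x y ax ay ≤ sqDist x y bx bY ∨ sqDist x y cx cy ≤ sqDist x y bx bY := by
  by_contra! hcon
  obtain ⟨h1, h2⟩ := hcon
  have h3 : (y - bY) * deathDen ax ay bx bY cx cy < deathNum ax ay bx bY cx cy := by
    rw [← div_lt_iff_of_neg hD]
    linarith
  have e1 := mul_nonneg (sub_nonneg.2 hbc) (sub_nonneg.2 h1.le)
  have e2 := mul_nonneg (sub_nonneg.2 hab) (sub_nonneg.2 h2.le)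
  have e3 : (cx - bx) * (sqDist x y ax ay - sqDist x y bx bY) +
      (bx - ax) * (sqDist x y cx cy - sqDist x y bx bY) =
      (y - bY) * deathDen ax ay bx bY cx cy - deathNum ax ay bx bY cx cy := by
    unfold sqDist deathDen deathNum
    ring
  linarith

/-- The sites `a` and `b` are in lexicographic order. -/
def LexLt (ax ay bx bY : ℝ) : Prop := ax < bx ∨ ax = bx ∧ ay < bY

theorem LexLt.le {ax ay bx bY : ℝ} (h : LexLt ax ay bx bY) : ax ≤ bx :=
  h.elim le_of_lt fun h => h.1.le

/-- The identity behind `dominated_of_death`, used below the threshold: `b` cannot be strictly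
farther than both neighbours when both gaps are positive. -/
theorem alive_ineq {ax ay bx bY cx cy y : ℝ} (hab : ax ≤ bx) (hbc : bx ≤ cx) (hy : bY ≤ y)
    (halive : deathDen ax ay bx bY cx cy < 0 →
      y ≤ bY + deathNum ax ay bx bY cx cy / deathDen ax ay bx bY cx cy) (x : ℝ) :
    0 ≤ (cx - bx) * (sqDist x y ax ay - sqDist x y bx bY) +
      (bx - ax) * (sqDist x y cx cy - sqDist x y bx bY) := by
  have e3 : (cx - bx) * (sqDist x y ax ay - sqDist x y bx bY) +
      (bx - ax) * (sqDist x y cx cy - sqDist x y bx bY) =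
      (y - bY) * deathDen ax ay bx bY cx cy - deathNum ax ay bx bY cx cy := by
    unfold sqDist deathDen deathNum
    ring
  rw [e3]
  rcases lt_or_ge (deathDen ax ay bx bY cx cy) 0 with hD | hD
  · have h1 : y - bY ≤ deathNum ax ay bx bY cx cy / deathDen ax ay bx bY cx cy := by
      linarith [halive hD]
    rw [le_div_iff_of_neg hD] at h1
    linarith
  · have h1 : deathNum ax ay bx bY cx cy ≤ 0 := deathNum_nonpos hab hbc
    have := mul_nonneg (sub_nonneg.2 hy) hD
    linarith

theorem sqDist_lt_of_above {x y ax ay bY : ℝ} (h : ay < bY) (hy : bY ≤ y) :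
    sqDist x y ax bY < sqDist x y ax ay := by
  unfold sqDist
  nlinarith

/-- If `a` is at least as near as `b`, the first term of `alive_ineq` is nonpositive, so the second
must be nonnegative, and its weight can be cancelled when `ax < bx`. For `ax = bx` the order puts
`b` above `a`, hence strictly nearer, and the assumption fails. -/
theorem unimodal_right {ax ay bx bY cx cy x y : ℝ} (hab : LexLt ax ay bx bY)
    (hbc : LexLt bx bY cx cy) (hby : bY ≤ y)
    (halive : deathDen ax ay bx bY cx cy < 0 →
      y ≤ bY + deathNum ax ay bx bY cx cy / deathDen ax ay bx bY cx cy)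
    (h : sqDist x y ax ay ≤ sqDist x y bx bY) : sqDist x y bx bY ≤ sqDist x y cx cy := by
  have h1 := alive_ineq hab.le hbc.le hby halive x
  rcases hab with hab | ⟨rfl, hab⟩
  · have h2 : (cx - bx) * (sqDist x y ax ay - sqDist x y bx bY) ≤ 0 :=
      mul_nonpos_of_nonneg_of_nonpos (sub_nonneg.2 hbc.le) (sub_nonpos.2 h)
    have h3 : 0 ≤ (bx - ax) * (sqDist x y cx cy - sqDist x y bx bY) := by linarith
    exact sub_nonneg.1 (nonneg_of_mul_nonneg_right h3 (sub_pos.2 hab))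
  · exact absurd h (sqDist_lt_of_above hab hby).not_ge

/-- The mirror image, except for ties, since the lexicographic order is not symmetric: for `bx = cx`
the site `c` is strictly nearer than `b`, and then `alive_ineq` forces `ax = bx`, where `b` is
nearer than `a`. -/
theorem unimodal_left {ax ay bx bY cx cy x y : ℝ} (hab : LexLt ax ay bx bY)
    (hbc : LexLt bx bY cx cy) (hby : bY ≤ y) (hcy : cy ≤ y)
    (halive : deathDen ax ay bx bY cx cy < 0 →
      y ≤ bY + deathNum ax ay bx bY cx cy / deathDen ax ay bx bY cx cy)
    (h : sqDist x y cx cy ≤ sqDist x y bx bY) : sqDist x y bx bY ≤ sqDist x y ax ay := by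
  have h1 := alive_ineq hab.le hbc.le hby halive x
  have h2 : (bx - ax) * (sqDist x y cx cy - sqDist x y bx bY) ≤ 0 :=
    mul_nonpos_of_nonneg_of_nonpos (sub_nonneg.2 hab.le) (sub_nonpos.2 h)
  rcases hbc with hbc | ⟨rfl, hbc⟩
  · have h3 : 0 ≤ (cx - bx) * (sqDist x y ax ay - sqDist x y bx bY) := by linarith
    exact sub_nonneg.1 (nonneg_of_mul_nonneg_right h3 (sub_pos.2 hbc))
  · have h4 := sqDist_lt_of_above (x := x) (ax := bx) hbc hcy
    have h5 : bx - ax ≤ 0 := by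
      by_contra! h5
      have := mul_neg_of_pos_of_neg h5 (sub_neg.2 h4)
      linarith
    rcases hab with hab | ⟨rfl, hab⟩
    · linarith
    · exact (sqDist_lt_of_above hab hby).le

/-! ## Tournament trees in the memory

A complete binary tree with `2 ^ K` leaves is stored in heap order: the root is the node `1`, the
children of `v` are `2 * v` and `2 * v + 1`, and the leaves are `2 ^ K, …, 2 ^ (K + 1) - 1`. The
natural arrays `4`, `5` and `6` hold, for each node, the leftmost and the rightmost active leaf and
the leaf of minimum key below it, and the real array `3` holds that minimum key. The value `0` stands
for the absence of such a leaf. -/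

namespace RealRAM

/-- The entries of the node `v` agree with those of its children. -/
structure NodeOK (s : State) (v : ℕ) : Prop where
  left : s.nmem 4 v = if s.nmem 4 (v + v) = 0 then s.nmem 4 (v + v + 1) else s.nmem 4 (v + v)
  right : s.nmem 5 v = if s.nmem 5 (v + v + 1) = 0 then s.nmem 5 (v + v)
    else s.nmem 5 (v + v + 1)
  arg : s.nmem 6 v = if s.nmem 6 (v + v) = 0 then s.nmem 6 (v + v + 1)
    else if s.nmem 6 (v + v + 1) ≠ 0 ∧ s.rmem 3 (v + v + 1) < s.rmem 3 (v + v)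
    then s.nmem 6 (v + v + 1) else s.nmem 6 (v + v)
  key : s.rmem 3 v = if s.nmem 6 (v + v) = 0 then s.rmem 3 (v + v + 1)
    else if s.nmem 6 (v + v + 1) ≠ 0 ∧ s.rmem 3 (v + v + 1) < s.rmem 3 (v + v)
    then s.rmem 3 (v + v + 1) else s.rmem 3 (v + v)

/-- The leaf `l` is active if `l ∈ A`, and has the key `κ l` if `l ∈ B`. -/
structure LeafOK (A B : Finset ℕ) (κ : ℕ → ℝ) (s : State) (l : ℕ) : Prop where
  left : s.nmem 4 l = if l ∈ A then l else 0
  right : s.nmem 5 l = if l ∈ A then l else 0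
  arg : s.nmem 6 l = if l ∈ B then l else 0
  key : l ∈ B → s.rmem 3 l = κ l

/-- The memory holds a tournament tree for the set `A` of active leaves and the set `B` of leaves
with keys, whose inner nodes are correct, except possibly the node `w`. -/
structure TreeInv (K : ℕ) (A B : Finset ℕ) (κ : ℕ → ℝ) (w : ℕ) (s : State) : Prop where
  subA : ∀ l ∈ A, 2 ^ K ≤ l ∧ l < 2 * 2 ^ K
  subB : ∀ l ∈ B, 2 ^ K ≤ l ∧ l < 2 * 2 ^ K
  leaf : ∀ l, 2 ^ K ≤ l → l < 2 * 2 ^ K → LeafOK A B κ s l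
  node : ∀ v, 1 ≤ v → v < 2 ^ K → v ≠ w → NodeOK s v

/-- In heap order, `l / 2 ^ e = v` says that the leaf `l` lies below the node `v` of height `e`. The
equation distributes the leaves below a node among its two children. -/
theorem div_two_pow_succ_eq_iff {l e v : ℕ} :
    l / 2 ^ (e + 1) = v ↔ l / 2 ^ e = v + v ∨ l / 2 ^ e = v + v + 1 := by
  rw [pow_succ, ← Nat.div_div_eq_div_mul]
  omega

theorem lt_of_div_lt_div {l l' d : ℕ} (h : l / d < l' / d) : l < l' := by
  by_contra! h'
  exact absurd (Nat.div_le_div_right (c := d) h') (not_le.2 h)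

/-- The induction principle for the nodes of a complete binary tree, by height. -/
theorem node_induction {K : ℕ} {p : ℕ → ℕ → Prop} (leaf : ∀ l, 2 ^ K ≤ l → l < 2 * 2 ^ K → p 0 l)
    (node : ∀ e v, e < K → 1 ≤ v → v < 2 ^ K → p e (v + v) → p e (v + v + 1) → p (e + 1) v) :
    ∀ e v, e ≤ K → 2 ^ (K - e) ≤ v → v < 2 * 2 ^ (K - e) → p e v := by
  intro e
  induction e with
  | zero => exact fun v _ => leaf v
  | succ e ih =>
    intro v he h1 h2
    have h3 : 2 ^ (K - e) = 2 * 2 ^ (K - (e + 1)) := by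
      rw [← pow_succ']
      congr 1
      omega
    have h4 : 0 < 2 ^ (K - (e + 1)) := by positivity
    have h5 : 2 ^ (K - e) ≤ 2 ^ K := Nat.pow_le_pow_right (by norm_num) (by omega)
    exact node e v he (by omega) (by omega) (ih _ (by omega) (by omega) (by omega))
      (ih _ (by omega) (by omega) (by omega))

variable {K : ℕ} {A B : Finset ℕ} {κ : ℕ → ℝ} {s : State}

/-- `x` is the least element of `A` with the property `p`, or `0` if there is none. -/
def IsFirst (A : Finset ℕ) (p : ℕ → Prop) (x : ℕ) : Prop :=
  (x = 0 ∧ ∀ l ∈ A, ¬ p l) ∨ (x ∈ A ∧ p x ∧ ∀ l ∈ A, p l → x ≤ l)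

/-- `x` is the greatest element of `A` with the property `p`, or `0` if there is none. -/
def IsLast (A : Finset ℕ) (p : ℕ → Prop) (x : ℕ) : Prop :=
  (x = 0 ∧ ∀ l ∈ A, ¬ p l) ∨ (x ∈ A ∧ p x ∧ ∀ l ∈ A, p l → l ≤ x)

/-- The left candidate wins whenever it exists. The value `0` can stand for absence because no leaf
has this number. -/
theorem IsFirst.or {p q r : ℕ → Prop} {x y : ℕ} (h0 : 0 ∉ A) (hx : IsFirst A p x)
    (hy : IsFirst A q y) (hpq : ∀ l l', p l → q l' → l < l') (hr : ∀ l, r l ↔ p l ∨ q l) :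
    IsFirst A r (if x = 0 then y else x) := by
  rcases hx with ⟨rfl, hx⟩ | ⟨h1, h2, h3⟩
  · rcases hy with ⟨rfl, hy⟩ | ⟨h4, h5, h6⟩
    · exact Or.inl ⟨by simp, fun l hl h => ((hr l).1 h).elim (hx l hl) (hy l hl)⟩
    · exact Or.inr ⟨by simpa using h4, by simpa using (hr y).2 (Or.inr h5), fun l hl h => by
        simpa using h6 l hl (((hr l).1 h).resolve_left (hx l hl))⟩
  · have hx0 : x ≠ 0 := fun h => h0 (h ▸ h1)
    rw [if_neg hx0]
    refine Or.inr ⟨h1, (hr x).2 (Or.inl h2), fun l hl h => ?_⟩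
    rcases (hr l).1 h with h | h
    · exact h3 l hl h
    · exact (hpq x l h2 h).le

theorem IsLast.or {p q r : ℕ → Prop} {x y : ℕ} (h0 : 0 ∉ A) (hx : IsLast A p x)
    (hy : IsLast A q y) (hpq : ∀ l l', p l → q l' → l' < l) (hr : ∀ l, r l ↔ p l ∨ q l) :
    IsLast A r (if x = 0 then y else x) := by
  rcases hx with ⟨rfl, hx⟩ | ⟨h1, h2, h3⟩
  · rcases hy with ⟨rfl, hy⟩ | ⟨h4, h5, h6⟩
    · exact Or.inl ⟨by simp, fun l hl h => ((hr l).1 h).elim (hx l hl) (hy l hl)⟩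
    · exact Or.inr ⟨by simpa using h4, by simpa using (hr y).2 (Or.inr h5), fun l hl h => by
        simpa using h6 l hl (((hr l).1 h).resolve_left (hx l hl))⟩
  · have hx0 : x ≠ 0 := fun h => h0 (h ▸ h1)
    rw [if_neg hx0]
    refine Or.inr ⟨h1, (hr x).2 (Or.inl h2), fun l hl h => ?_⟩
    rcases (hr l).1 h with h | h
    · exact h3 l hl h
    · exact (hpq x l h2 h).le

/-- The leaf `x` has the least key in `B` among those with the property `p`, and is the leftmost
one of this kind; `x` is `0` if there is none. -/
def IsArgMin (B : Finset ℕ) (κ : ℕ → ℝ) (p : ℕ → Prop) (x : ℕ) : Prop :=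
  (x = 0 ∧ ∀ l ∈ B, ¬ p l) ∨
    (x ∈ B ∧ p x ∧ ∀ l ∈ B, p l → κ x < κ l ∨ κ x = κ l ∧ x ≤ l)

theorem TreeInv.zero_notMem_A {w : ℕ} (h : TreeInv K A B κ w s) : 0 ∉ A := fun h0 => by
  have := (h.subA 0 h0).1
  have : 0 < 2 ^ K := by positivity
  omega

theorem TreeInv.zero_notMem_B {w : ℕ} (h : TreeInv K A B κ w s) : 0 ∉ B := fun h0 => by
  have := (h.subB 0 h0).1
  have : 0 < 2 ^ K := by positivity
  omega

theorem TreeInv.isFirst (h : TreeInv K A B κ 0 s) : ∀ e v, e ≤ K → 2 ^ (K - e) ≤ v →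
    v < 2 * 2 ^ (K - e) → IsFirst A (fun l => l / 2 ^ e = v) (s.nmem 4 v) := by
  refine node_induction ?_ ?_
  · intro l h1 h2
    rw [(h.leaf l h1 h2).left]
    split_ifs with hl
    · exact Or.inr ⟨hl, by simp, fun l' _ h' => by simp at h'; omega⟩
    · refine Or.inl ⟨rfl, fun l' hl' h' => hl ?_⟩
      simp only [pow_zero, Nat.div_one] at h'
      exact h' ▸ hl'
  · intro e v _ h1 h2 ih1 ih2
    rw [(h.node v h1 h2 (by omega)).left]
    refine ih1.or h.zero_notMem_A ih2 (fun l l' h3 h4 => ?_) fun l => div_two_pow_succ_eq_iff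
    exact lt_of_div_lt_div (d := 2 ^ e) (by omega)

theorem TreeInv.isLast (h : TreeInv K A B κ 0 s) : ∀ e v, e ≤ K → 2 ^ (K - e) ≤ v →
    v < 2 * 2 ^ (K - e) → IsLast A (fun l => l / 2 ^ e = v) (s.nmem 5 v) := by
  refine node_induction ?_ ?_
  · intro l h1 h2
    rw [(h.leaf l h1 h2).right]
    split_ifs with hl
    · exact Or.inr ⟨hl, by simp, fun l' _ h' => by simp at h'; omega⟩
    · refine Or.inl ⟨rfl, fun l' hl' h' => hl ?_⟩
      simp only [pow_zero, Nat.div_one] at h'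
      exact h' ▸ hl'
  · intro e v _ h1 h2 ih1 ih2
    rw [(h.node v h1 h2 (by omega)).right]
    refine ih2.or h.zero_notMem_A ih1 (fun l l' h3 h4 => ?_) fun l =>
      div_two_pow_succ_eq_iff.trans or_comm
    exact lt_of_div_lt_div (d := 2 ^ e) (by omega)

/-- The right child wins only with a strictly smaller key, so equal keys are resolved to the left.
Sorting by key and then by index depends on this. -/
theorem TreeInv.isArgMin (h : TreeInv K A B κ 0 s) : ∀ e v, e ≤ K → 2 ^ (K - e) ≤ v →
    v < 2 * 2 ^ (K - e) → IsArgMin B κ (fun l => l / 2 ^ e = v) (s.nmem 6 v) ∧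
      (s.nmem 6 v ≠ 0 → s.rmem 3 v = κ (s.nmem 6 v)) := by
  refine node_induction ?_ ?_
  · intro l h1 h2
    rw [(h.leaf l h1 h2).arg]
    split_ifs with hl
    · exact ⟨Or.inr ⟨hl, by simp, fun l' _ h' => by simp at h'; simp [h']⟩,
        fun _ => (h.leaf l h1 h2).key hl⟩
    · refine ⟨Or.inl ⟨rfl, fun l' hl' h' => hl ?_⟩, fun h => absurd rfl h⟩
      simp only [pow_zero, Nat.div_one] at h'
      exact h' ▸ hl'
  · intro e v _ h1 h2 ih1 ih2
    have h0 := h.zero_notMem_B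
    rw [(h.node v h1 h2 (by omega)).arg, (h.node v h1 h2 (by omega)).key]
    obtain ⟨ih1, ik1⟩ := ih1
    obtain ⟨ih2, ik2⟩ := ih2
    rcases ih1 with ⟨e1, m1⟩ | ⟨i1, j1, m1⟩
    · simp only [e1, if_true]
      refine ⟨?_, ik2⟩
      rcases ih2 with ⟨e2, m2⟩ | ⟨i2, j2, m2⟩
      · exact Or.inl ⟨e2, fun l hl hp =>
          (div_two_pow_succ_eq_iff.1 hp).elim (m1 l hl) (m2 l hl)⟩
      · exact Or.inr ⟨i2, div_two_pow_succ_eq_iff.2 (Or.inr j2), fun l hl hp =>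
          m2 l hl ((div_two_pow_succ_eq_iff.1 hp).resolve_left (m1 l hl))⟩
    · have e1 : s.nmem 6 (v + v) ≠ 0 := fun h => h0 (h ▸ i1)
      rw [if_neg e1, if_neg e1]
      rcases ih2 with ⟨e2, m2⟩ | ⟨i2, j2, m2⟩
      · rw [if_neg (by simp [e2]), if_neg (by simp [e2])]
        exact ⟨Or.inr ⟨i1, div_two_pow_succ_eq_iff.2 (Or.inl j1), fun l hl hp =>
          m1 l hl ((div_two_pow_succ_eq_iff.1 hp).resolve_right (m2 l hl))⟩, ik1⟩
      · have e2 : s.nmem 6 (v + v + 1) ≠ 0 := fun h => h0 (h ▸ i2)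
        rw [ik1 e1, ik2 e2]
        have h12 : s.nmem 6 (v + v) < s.nmem 6 (v + v + 1) :=
          lt_of_div_lt_div (d := 2 ^ e) (by omega)
        split_ifs with hc
        · refine ⟨Or.inr ⟨i2, div_two_pow_succ_eq_iff.2 (Or.inr j2), fun l hl hp => ?_⟩,
            fun _ => rfl⟩
          rcases div_two_pow_succ_eq_iff.1 hp with hp | hp
          · rcases m1 l hl hp with h | ⟨h, -⟩
            · exact Or.inl (hc.2.trans h)
            · exact Or.inl (h ▸ hc.2)
          · exact m2 l hl hp
        · have hc' : κ (s.nmem 6 (v + v)) ≤ κ (s.nmem 6 (v + v + 1)) :=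
            not_lt.1 fun h => hc ⟨e2, h⟩
          refine ⟨Or.inr ⟨i1, div_two_pow_succ_eq_iff.2 (Or.inl j1), fun l hl hp => ?_⟩,
            fun _ => rfl⟩
          rcases div_two_pow_succ_eq_iff.1 hp with hp | hp
          · exact m1 l hl hp
          · have hm := m2 l hl hp
            rcases hc'.lt_or_eq with h | h
            · rcases hm with h' | ⟨h', -⟩
              · exact Or.inl (h.trans h')
              · exact Or.inl (h' ▸ h)
            · rcases hm with h' | ⟨h', h''⟩
              · exact Or.inl (h ▸ h')
              · exact Or.inr ⟨h.trans h', by omega⟩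

end RealRAM

/-! ## Programs on tournament trees -/

namespace RealRAM

/-- Registers below `b` and memory outside the tournament tree have not been changed. -/
structure Frame (b : ℕ) (s s' : State) : Prop where
  nreg : ∀ r < b, s'.nreg r = s.nreg r
  rreg : ∀ r < b, s'.rreg r = s.rreg r
  nmem : ∀ A, A ≠ 4 → A ≠ 5 → A ≠ 6 → s'.nmem A = s.nmem A
  rmem : ∀ A, A ≠ 3 → s'.rmem A = s.rmem A

theorem Frame.refl (b : ℕ) (s : State) : Frame b s s :=
  ⟨fun _ _ => rfl, fun _ _ => rfl, fun _ _ _ _ => rfl, fun _ _ => rfl⟩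

theorem Frame.trans {b b' b'' : ℕ} {s s' s'' : State} (h : Frame b' s s') (h' : Frame b'' s' s'')
    (hb' : b ≤ b') (hb'' : b ≤ b'') : Frame b s s'' :=
  ⟨fun r hr => (h'.nreg r (by omega)).trans (h.nreg r (by omega)),
    fun r hr => (h'.rreg r (by omega)).trans (h.rreg r (by omega)),
    fun A h4 h5 h6 => (h'.nmem A h4 h5 h6).trans (h.nmem A h4 h5 h6),
    fun A h3 => (h'.rmem A h3).trans (h.rmem A h3)⟩

/-- The constants used by all programs: register `1` is `0`, register `2` is `1`, register `3` is
the number of leaves, and the natural array `3` holds the parents of the nodes. -/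
structure Env (K : ℕ) (s : State) : Prop where
  zero : s.nreg 1 = 0
  one : s.nreg 2 = 1
  leaves : s.nreg 3 = 2 ^ K
  parent : ∀ v < 2 * 2 ^ K, s.nmem 3 v = v / 2

theorem Env.of_frame {K b : ℕ} {s s' : State} (h : Env K s) (hf : Frame b s s') (hb : 4 ≤ b) :
    Env K s' :=
  ⟨(hf.nreg 1 (by omega)).trans h.zero, (hf.nreg 2 (by omega)).trans h.one,
    (hf.nreg 3 (by omega)).trans h.leaves, fun v hv => by
      rw [hf.nmem 3 (by norm_num) (by norm_num) (by norm_num), h.parent v hv]⟩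

/-- Recomputes the leftmost active leaf below the node in register `25`. -/
def nodeLeftProg : Stmt :=
  .seq (block [.nadd 26 25 25, .nadd 27 26 2, .nload 28 4 26]) <|
  .seq (.ite (.neq 28 1) (block [.nload 28 4 27]) .skip) <|
  block [.nstore 4 25 28]

theorem nodeLeftProg_out {s : State} (h1 : s.nreg 1 = 0) (h2 : s.nreg 2 = 1) {w : ℕ}
    (hw : s.nreg 25 = w) : ∃ x, nodeLeftProg.out s =
      ⟨Function.update (Function.update (Function.update s.nreg 26 (w + w)) 27 (w + w + 1)) 28 x,
        s.rreg, Function.update s.nmem 4 (Function.update (s.nmem 4) w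
          (if s.nmem 4 (w + w) = 0 then s.nmem 4 (w + w + 1) else s.nmem 4 (w + w))), s.rmem⟩ := by
  by_cases h : s.nmem 4 (w + w) = 0
  · refine ⟨s.nmem 4 (w + w + 1), ?_⟩
    simp [nodeLeftProg, block, Stmt.out, Instr.effect, State.setN, State.putN, Test.Holds, h1, h2,
      hw, h]
  · refine ⟨s.nmem 4 (w + w), ?_⟩
    simp [nodeLeftProg, block, Stmt.out, Instr.effect, State.setN, State.putN, Test.Holds, h1, h2,
      hw, h]

/-- Recomputes the rightmost active leaf below the node in register `25`. -/
def nodeRightProg : Stmt :=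
  .seq (.instr (.nload 28 5 27)) <|
  .seq (.ite (.neq 28 1) (.instr (.nload 28 5 26)) .skip) <|
  .instr (.nstore 5 25 28)

theorem nodeRightProg_out {s : State} (h1 : s.nreg 1 = 0) {w : ℕ}
    (hw : s.nreg 25 = w) (h26 : s.nreg 26 = w + w) (h27 : s.nreg 27 = w + w + 1) :
    ∃ x, nodeRightProg.out s =
      ⟨Function.update s.nreg 28 x,
        s.rreg, Function.update s.nmem 5 (Function.update (s.nmem 5) w
          (if s.nmem 5 (w + w + 1) = 0 then s.nmem 5 (w + w) else s.nmem 5 (w + w + 1))),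
        s.rmem⟩ := by
  by_cases h : s.nmem 5 (w + w + 1) = 0
  · refine ⟨s.nmem 5 (w + w), ?_⟩
    simp [nodeRightProg, Stmt.out, Instr.effect, State.setN, State.putN, Test.Holds, h1, h26, h27,
      hw, h]
  · refine ⟨s.nmem 5 (w + w + 1), ?_⟩
    simp [nodeRightProg, Stmt.out, Instr.effect, State.setN, State.putN, Test.Holds, h1, h27,
      hw, h]

/-- Recomputes the leaf of minimum key below the node in register `25`. -/
def nodeMinProg : Stmt :=
  .seq (block [.nload 28 6 26, .nload 29 6 27, .rload 25 3 26, .rload 26 3 27]) <|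
  .seq (.ite (.neq 28 1) (block [.nmove 28 29, .rmove 25 26])
    (.ite (.neq 29 1) .skip (.ite (.rlt 26 25) (block [.nmove 28 29, .rmove 25 26]) .skip))) <|
  block [.nstore 6 25 28, .rstore 3 25 25]

theorem nodeMinProg_out {s : State} (h1 : s.nreg 1 = 0) {w : ℕ}
    (hw : s.nreg 25 = w) (h26 : s.nreg 26 = w + w) (h27 : s.nreg 27 = w + w + 1) :
    ∃ x y z z', nodeMinProg.out s =
      ⟨Function.update (Function.update s.nreg 28 x) 29 y,
        Function.update (Function.update s.rreg 25 z) 26 z',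
        Function.update s.nmem 6 (Function.update (s.nmem 6) w
          (if s.nmem 6 (w + w) = 0 then s.nmem 6 (w + w + 1)
            else if s.nmem 6 (w + w + 1) ≠ 0 ∧ s.rmem 3 (w + w + 1) < s.rmem 3 (w + w)
            then s.nmem 6 (w + w + 1) else s.nmem 6 (w + w))),
        Function.update s.rmem 3 (Function.update (s.rmem 3) w
          (if s.nmem 6 (w + w) = 0 then s.rmem 3 (w + w + 1)
            else if s.nmem 6 (w + w + 1) ≠ 0 ∧ s.rmem 3 (w + w + 1) < s.rmem 3 (w + w)
            then s.rmem 3 (w + w + 1) else s.rmem 3 (w + w)))⟩ := by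
  by_cases h : s.nmem 6 (w + w) = 0 ∨
    s.nmem 6 (w + w + 1) ≠ 0 ∧ s.rmem 3 (w + w + 1) < s.rmem 3 (w + w)
  · refine ⟨s.nmem 6 (w + w + 1), s.nmem 6 (w + w + 1), s.rmem 3 (w + w + 1),
      s.rmem 3 (w + w + 1), ?_⟩
    rcases eq_or_ne (s.nmem 6 (w + w)) 0 with h' | h'
    · simp [nodeMinProg, block, Stmt.out, Instr.effect, State.setN, State.putN, State.setR,
        State.putR, Test.Holds, h1, h26, h27, hw, h', Function.update_comm]
    · obtain ⟨h2, h3⟩ := h.resolve_left h'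
      simp [nodeMinProg, block, Stmt.out, Instr.effect, State.setN, State.putN, State.setR,
        State.putR, Test.Holds, h1, h26, h27, hw, h', h2, h3, Function.update_comm]
  · refine ⟨s.nmem 6 (w + w), s.nmem 6 (w + w + 1), s.rmem 3 (w + w), s.rmem 3 (w + w + 1), ?_⟩
    rw [not_or] at h
    rcases eq_or_ne (s.nmem 6 (w + w + 1)) 0 with h' | h'
    · simp [nodeMinProg, block, Stmt.out, Instr.effect, State.setN, State.putN, State.setR,
        State.putR, Test.Holds, h1, h26, h27, hw, h, h']
    · have h2 : ¬ s.rmem 3 (w + w + 1) < s.rmem 3 (w + w) := fun h3 => h.2 ⟨h', h3⟩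
      simp [nodeMinProg, block, Stmt.out, Instr.effect, State.setN, State.putN, State.setR,
        State.putR, Test.Holds, h1, h26, h27, hw, h.1, h', h2]

/-- Recomputes the entries of the node in register `25` from those of its children, and moves on to
its parent. -/
def nodeProg : Stmt :=
  .seq nodeLeftProg (.seq nodeRightProg (.seq nodeMinProg (.instr (.nload 25 3 25))))

/-- Once `w` is recomputed, only its parent may disagree with its children, so the exceptional node
moves up. There is no node `0`; `TreeInv` with exception `0` means a fully correct tree. -/
theorem nodeProg_out {K : ℕ} {A B : Finset ℕ} {κ : ℕ → ℝ} {s : State} {w : ℕ}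
    (hE : Env K s) (hT : TreeInv K A B κ w s) (hw : s.nreg 25 = w) (hw1 : 1 ≤ w)
    (hw2 : w < 2 ^ K) : TreeInv K A B κ (w / 2) (nodeProg.out s) ∧
      (nodeProg.out s).nreg 25 = w / 2 ∧ Frame 25 s (nodeProg.out s) := by
  obtain ⟨x, e1⟩ := nodeLeftProg_out hE.zero hE.one hw
  obtain ⟨x2, e2⟩ := nodeRightProg_out (s := nodeLeftProg.out s) (w := w)
    (by rw [e1]; simp [hE.zero]) (by rw [e1]; simp [hw]) (by rw [e1]; simp) (by rw [e1]; simp)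
  obtain ⟨x3, y3, z3, z3', e3⟩ := nodeMinProg_out (s := nodeRightProg.out (nodeLeftProg.out s))
    (w := w) (by rw [e2, e1]; simp [hE.zero]) (by rw [e2, e1]; simp [hw]) (by rw [e2, e1]; simp)
    (by rw [e2, e1]; simp)
  have hp := hE.parent w (by omega)
  have e4 : nodeProg.out s = (Instr.nload 25 3 25).effect
    (nodeMinProg.out (nodeRightProg.out (nodeLeftProg.out s))) := rfl
  rw [e3, e2, e1] at e4
  simp only [Instr.effect, State.setN, ne_eq, Nat.reduceEqDiff,
    not_false_eq_true, Function.update_of_ne, hw, hp] at e4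
  rw [e4]
  refine ⟨⟨hT.subA, hT.subB, fun l hl1 hl2 => ?_, fun v hv1 hv2 hv => ?_⟩, by simp, ?_⟩
  · have hl := hT.leaf l hl1 hl2
    have hne : l ≠ w := by omega
    exact ⟨by simp [hne, hl.left], by simp [hne, hl.right], by simp [hne, hl.arg],
      fun h => by simp [hne, hl.key h]⟩
  · have n1 : v + v ≠ w := by omega
    have n2 : v + v + 1 ≠ w := by omega
    by_cases hvw : v = w
    · subst hvw
      constructor <;> simp [Function.update_of_ne n1, Function.update_of_ne n2]
    · have hl := hT.node v hv1 hv2 hvw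
      constructor
      · simpa [Function.update_of_ne n1, Function.update_of_ne n2, hvw] using hl.left
      · simpa [Function.update_of_ne n1, Function.update_of_ne n2, hvw] using hl.right
      · simpa [Function.update_of_ne n1, Function.update_of_ne n2, hvw] using hl.arg
      · simpa [Function.update_of_ne n1, Function.update_of_ne n2, hvw] using hl.key
  · constructor
    · intro r hr
      simp [show r ≠ 25 by omega, show r ≠ 26 by omega, show r ≠ 27 by omega,
        show r ≠ 28 by omega, show r ≠ 29 by omega]
    · intro r hr
      simp [show r ≠ 25 by omega, show r ≠ 26 by omega]
    · intro A h4 h5 h6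
      simp [h4, h5, h6]
    · intro A h3
      simp [h3]

/-- Recomputes the entries of all ancestors of the leaf in register `24`. -/
def walkProg : Stmt :=
  .seq (.instr (.nload 25 3 24)) (.loop (.nlt 1 25) nodeProg)

/-- Each level costs at most 39 steps and a test. The machine has no division of natural numbers, so
parents are looked up in a table; the invariant `w < 2 ^ j` records that the path has at most `j`
nodes left. -/
theorem walkProg_spec {K : ℕ} {A B : Finset ℕ} {κ : ℕ → ℝ} {s : State} {m l : ℕ}
    {Q : State → ℕ → Prop} (hE : Env K s) (hT : TreeInv K A B κ (l / 2) s) (hl : s.nreg 24 = l)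
    (hl2 : l < 2 * 2 ^ K) (hm : 40 * K + 2 ≤ m)
    (hQ : ∀ s' m', TreeInv K A B κ 0 s' → Frame 25 s s' → m - (40 * K + 2) ≤ m' → Q s' m') :
    Run walkProg s m Q := by
  refine Run.seq (Run.instr (by omega) ?_)
  refine Run.loop (fun s' m' => ∃ w j, w < 2 ^ j ∧ j ≤ K ∧ TreeInv K A B κ w s' ∧ s'.nreg 25 = w ∧
    Frame 25 s s' ∧ m ≤ m' + 1 + 40 * (K - j)) ?_ ?_ ⟨l / 2, K, by omega, le_rfl, ?_, ?_, ?_, ?_⟩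
  · rintro s' m' ⟨w, j, hw, hj, hT', h25, hF, hm'⟩ hlt
    have hE' := hE.of_frame hF (by norm_num)
    simp only [Test.Holds, hE'.zero, h25] at hlt
    have hwK : w < 2 ^ K := hw.trans_le (Nat.pow_le_pow_right (by norm_num) hj)
    obtain ⟨h1, h2, h3⟩ := nodeProg_out hE' hT' h25 hlt hwK
    have hst : nodeProg.steps ≤ 39 := by decide
    have hj0 : j ≠ 0 := by
      rintro rfl
      omega
    obtain ⟨j, rfl⟩ := Nat.exists_eq_succ_of_ne_zero hj0
    refine ⟨by omega, Run.of_loopFree ?_ (by omega) ⟨w / 2, j, ?_, by omega, h1, h2,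
      hF.trans h3 le_rfl le_rfl, by omega⟩⟩
    · simp [nodeProg, nodeLeftProg, nodeRightProg, nodeMinProg, block, Stmt.LoopFree]
    · rw [Nat.succ_eq_add_one, pow_succ] at hw
      omega
  · rintro s' m' ⟨w, j, hw, hj, hT', h25, hF, hm'⟩ hlt
    have hE' := hE.of_frame hF (by norm_num)
    simp only [Test.Holds, hE'.zero, h25, not_lt, nonpos_iff_eq_zero] at hlt
    subst hlt
    exact ⟨by omega, hQ _ _ hT' hF (by omega)⟩
  · exact ⟨hT.subA, hT.subB, fun l hl1 hl2 =>
      ⟨(hT.leaf l hl1 hl2).left, (hT.leaf l hl1 hl2).right, (hT.leaf l hl1 hl2).arg,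
        (hT.leaf l hl1 hl2).key⟩, fun v hv1 hv2 hv =>
      ⟨(hT.node v hv1 hv2 hv).left, (hT.node v hv1 hv2 hv).right, (hT.node v hv1 hv2 hv).arg,
        (hT.node v hv1 hv2 hv).key⟩⟩
  · simp [Instr.effect, State.setN, hl, hE.parent l hl2]
  · constructor
    · intro r hr
      simp [Instr.effect, State.setN, show r ≠ 25 by omega]
    all_goals intros; rfl
  · omega

end RealRAM

/-! ## Neighbours and nearest leaves -/

namespace RealRAM

theorem TreeInv.congr {K : ℕ} {A B : Finset ℕ} {κ : ℕ → ℝ} {w : ℕ} {s s' : State}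
    (hT : TreeInv K A B κ w s) (h4 : s'.nmem 4 = s.nmem 4) (h5 : s'.nmem 5 = s.nmem 5)
    (h6 : s'.nmem 6 = s.nmem 6) (h3 : s'.rmem 3 = s.rmem 3) : TreeInv K A B κ w s' :=
  ⟨hT.subA, hT.subB, fun l hl1 hl2 =>
    ⟨by rw [h4]; exact (hT.leaf l hl1 hl2).left, by rw [h5]; exact (hT.leaf l hl1 hl2).right,
      by rw [h6]; exact (hT.leaf l hl1 hl2).arg, by rw [h3]; exact (hT.leaf l hl1 hl2).key⟩,
    fun v hv1 hv2 hv =>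
      ⟨by rw [h4]; exact (hT.node v hv1 hv2 hv).left, by rw [h5]; exact (hT.node v hv1 hv2 hv).right,
        by rw [h6, h3]; exact (hT.node v hv1 hv2 hv).arg,
        by rw [h6, h3]; exact (hT.node v hv1 hv2 hv).key⟩⟩

theorem IsLast.congr {A : Finset ℕ} {p q : ℕ → Prop} {x : ℕ} (h : IsLast A p x)
    (hpq : ∀ l ∈ A, (p l ↔ q l)) : IsLast A q x := by
  rcases h with ⟨h1, h2⟩ | ⟨h1, h2, h3⟩
  · exact Or.inl ⟨h1, fun l hl hq => h2 l hl ((hpq l hl).2 hq)⟩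
  · exact Or.inr ⟨h1, (hpq x h1).1 h2, fun l hl hq => h3 l hl ((hpq l hl).2 hq)⟩

theorem IsFirst.congr {A : Finset ℕ} {p q : ℕ → Prop} {x : ℕ} (h : IsFirst A p x)
    (hpq : ∀ l ∈ A, (p l ↔ q l)) : IsFirst A q x := by
  rcases h with ⟨h1, h2⟩ | ⟨h1, h2, h3⟩
  · exact Or.inl ⟨h1, fun l hl hq => h2 l hl ((hpq l hl).2 hq)⟩
  · exact Or.inr ⟨h1, (hpq x h1).1 h2, fun l hl hq => h3 l hl ((hpq l hl).2 hq)⟩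

theorem IsLast.congr' {A A' : Finset ℕ} {p : ℕ → Prop} {x : ℕ} (h : IsLast A p x)
    (hA : ∀ l, p l → (l ∈ A ↔ l ∈ A')) : IsLast A' p x := by
  rcases h with ⟨h1, h2⟩ | ⟨h1, h2, h3⟩
  · exact Or.inl ⟨h1, fun l hl hq => h2 l ((hA l hq).2 hl) hq⟩
  · exact Or.inr ⟨(hA x h2).1 h1, h2, fun l hl hq => h3 l ((hA l hq).2 hl) hq⟩

theorem IsFirst.congr' {A A' : Finset ℕ} {p : ℕ → Prop} {x : ℕ} (h : IsFirst A p x)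
    (hA : ∀ l, p l → (l ∈ A ↔ l ∈ A')) : IsFirst A' p x := by
  rcases h with ⟨h1, h2⟩ | ⟨h1, h2, h3⟩
  · exact Or.inl ⟨h1, fun l hl hq => h2 l ((hA l hq).2 hl) hq⟩
  · exact Or.inr ⟨(hA x h2).1 h1, h2, fun l hl hq => h3 l ((hA l hq).2 hl) hq⟩

/-- One step of the climb in `neighboursProg`. -/
def neighboursStep : Stmt :=
  .seq (block [.nload 24 3 23, .nadd 25 24 24]) <|
  .seq (.ite (.neq 25 23)
    (.ite (.neq 22 1) (block [.nadd 25 23 2, .nload 22 4 25]) .skip)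
    (.ite (.neq 21 1) (block [.nsub 25 23 2, .nload 21 5 25]) .skip)) <|
  .instr (.nmove 23 24)

theorem neighboursStep_out {s : State} {v u x y : ℕ} (h1 : s.nreg 1 = 0) (h2 : s.nreg 2 = 1)
    (hv : s.nreg 23 = v) (hx : s.nreg 21 = x) (hy : s.nreg 22 = y) (hu : s.nmem 3 v = u) :
    (neighboursStep.out s).nreg 23 = u ∧
    (neighboursStep.out s).nreg 21 =
      (if u + u = v then x else if x = 0 then s.nmem 5 (v - 1) else x) ∧
    (neighboursStep.out s).nreg 22 =
      (if u + u = v then if y = 0 then s.nmem 4 (v + 1) else y else y) ∧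
    (∀ r < 21, (neighboursStep.out s).nreg r = s.nreg r) ∧
    (neighboursStep.out s).rreg = s.rreg ∧ (neighboursStep.out s).nmem = s.nmem ∧
    (neighboursStep.out s).rmem = s.rmem := by
  have hP := Preserved.of_loopFree (S := neighboursStep)
    (by simp [neighboursStep, block, Stmt.LoopFree]) s
  have hreg : ∀ r ∈ neighboursStep.collect Instr.nregs, 21 ≤ r := by decide
  refine ⟨?_, ?_, ?_, fun r hr => hP.nreg r fun h => ?_, funext fun r => hP.rreg r (by
    simp [neighboursStep, block, Stmt.collect, Instr.rregs]), funext fun r => hP.nmem r (by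
    simp [neighboursStep, block, Stmt.collect, Instr.narrays]), funext fun r => hP.rmem r (by
    simp [neighboursStep, block, Stmt.collect, Instr.rarrays])⟩
  · by_cases h : u + u = v <;> by_cases hx0 : x = 0 <;> by_cases hy0 : y = 0 <;>
      simp [neighboursStep, block, Stmt.out, Instr.effect, State.setN, Test.Holds, h1, h2,
        hv, hu, h, hx, hy, hx0, hy0]
  · by_cases h : u + u = v <;> by_cases hx0 : x = 0 <;> by_cases hy0 : y = 0 <;>
      simp [neighboursStep, block, Stmt.out, Instr.effect, State.setN, Test.Holds, h1, h2,
        hv, hu, h, hx, hy, hx0, hy0]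
  · by_cases h : u + u = v <;> by_cases hx0 : x = 0 <;> by_cases hy0 : y = 0 <;>
      simp [neighboursStep, block, Stmt.out, Instr.effect, State.setN, Test.Holds, h1, h2,
        hv, hu, h, hx, hy, hx0, hy0]
  · have := hreg r h
    omega

/-- Computes the predecessor and the successor of the leaf in register `20` among the active
leaves. -/
def neighboursProg : Stmt :=
  .seq (block [.nmove 23 20, .nconst 21 0, .nconst 22 0]) (.loop (.nlt 2 23) neighboursStep)

/-- At the ancestor of height `e`, the registers `21` and `22` hold the predecessor and the
successor of `l` among the active leaves below that ancestor. From a left child the sibling can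
contribute only a successor, from a right child only a predecessor, and anything found earlier is
closer. -/
theorem neighboursProg_spec {K : ℕ} {A B : Finset ℕ} {κ : ℕ → ℝ} {s : State} {m l : ℕ}
    {Q : State → ℕ → Prop} (hE : Env K s) (hT : TreeInv K A B κ 0 s) (hl : s.nreg 20 = l)
    (hl1 : 2 ^ K ≤ l) (hl2 : l < 2 * 2 ^ K) (hm : 10 * K + 4 ≤ m)
    (hQ : ∀ s' m', IsLast A (· < l) (s'.nreg 21) → IsFirst A (l < ·) (s'.nreg 22) →
      (∀ r < 21, s'.nreg r = s.nreg r) → s'.rreg = s.rreg → s'.nmem = s.nmem → s'.rmem = s.rmem →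
      m - (10 * K + 4) ≤ m' → Q s' m') :
    Run neighboursProg s m Q := by
  refine Run.seq (Run.of_loopFree (by simp [block, Stmt.LoopFree]) ?_ ?_)
  · simp [block, Stmt.steps]; omega
  have hst : (block [.nmove 23 20, .nconst 21 0, .nconst 22 0]).steps = 3 := rfl
  rw [hst]
  refine Run.loop (fun s' m' => ∃ e ≤ K, s'.nreg 23 = l / 2 ^ e ∧
    IsLast A (fun x => x < l ∧ x / 2 ^ e = l / 2 ^ e) (s'.nreg 21) ∧
    IsFirst A (fun x => l < x ∧ x / 2 ^ e = l / 2 ^ e) (s'.nreg 22) ∧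
    (∀ r < 21, s'.nreg r = s.nreg r) ∧ s'.rreg = s.rreg ∧ s'.nmem = s.nmem ∧ s'.rmem = s.rmem ∧
    m ≤ m' + 3 + 10 * e) ?_ ?_ ⟨0, Nat.zero_le _, ?_, ?_, ?_, ?_, ?_, ?_, ?_, by omega⟩
  · rintro s' m' ⟨e, he, h23, h21, h22, hr, hrr, hn, hrm, hm'⟩ hlt
    have hz : s'.nreg 1 = 0 := (hr 1 (by norm_num)).trans hE.zero
    have ho : s'.nreg 2 = 1 := (hr 2 (by norm_num)).trans hE.one
    simp only [Test.Holds, ho, h23] at hlt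
    have heK : e < K := by
      refine lt_of_le_of_ne he ?_
      rintro rfl
      have : l / 2 ^ e < 2 := Nat.div_lt_of_lt_mul (by omega)
      omega
    set v := l / 2 ^ e with hv
    have hvl : v < 2 * 2 ^ K := (Nat.div_le_self _ _).trans_lt hl2
    have hu : s'.nmem 3 v = v / 2 := by rw [hn]; exact hE.parent v hvl
    obtain ⟨a1, a2, a3, a4, a5, a6, a7⟩ := neighboursStep_out hz ho h23 rfl rfl hu
    have hpow : (2 : ℕ) ^ K = 2 ^ (K - e) * 2 ^ e := by
      rw [← pow_add]
      congr 1
      omega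
    have hv1 : 2 ^ (K - e) ≤ v := by
      rw [hv, Nat.le_div_iff_mul_le (by positivity)]
      omega
    have hv2 : v < 2 * 2 ^ (K - e) := by
      rw [hv, Nat.div_lt_iff_lt_mul (by positivity), mul_assoc]
      omega
    have hpow2 : (2 : ℕ) ^ (K - e) = 2 * 2 ^ (K - e - 1) := by
      rw [← pow_succ']
      congr 1
      omega
    have hvu : l / 2 ^ (e + 1) = v / 2 := by
      rw [pow_succ, ← Nat.div_div_eq_div_mul]
    refine ⟨by omega, Run.of_loopFree (by simp [neighboursStep, block, Stmt.LoopFree])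
      (by have : neighboursStep.steps ≤ 9 := by decide
          omega) ⟨e + 1, heK, by rw [a1, hvu], ?_, ?_, ?_, a5.trans hrr, a6.trans hn, a7.trans hrm,
          by have : neighboursStep.steps ≤ 9 := by decide
             omega⟩⟩
    · rw [a2, hvu]
      split_ifs with h1 h2
      · refine h21.congr fun x _ => and_congr_right fun hx => ?_
        rw [div_two_pow_succ_eq_iff]
        have : x / 2 ^ e ≤ v := Nat.div_le_div_right hx.le
        omega
      · have hL := hT.isLast e (v - 1) he (by omega) (by omega)
        have := h21.or hT.zero_notMem_A hL (r := fun x => x < l ∧ x / 2 ^ (e + 1) = v / 2)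
          (fun x y hx hy => lt_of_div_lt_div (d := 2 ^ e) (by omega)) fun x => ?_
        · rwa [if_pos h2, ← hn] at this
        · rw [div_two_pow_succ_eq_iff]
          have h3 : x / 2 ^ e = v - 1 → x < l := fun h =>
            lt_of_div_lt_div (d := 2 ^ e) (by omega)
          omega
      · have hL := hT.isLast e (v - 1) he (by omega) (by omega)
        have := h21.or hT.zero_notMem_A hL (r := fun x => x < l ∧ x / 2 ^ (e + 1) = v / 2)
          (fun x y hx hy => lt_of_div_lt_div (d := 2 ^ e) (by omega)) fun x => ?_
        · rwa [if_neg h2] at this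
        · rw [div_two_pow_succ_eq_iff]
          have h3 : x / 2 ^ e = v - 1 → x < l := fun h =>
            lt_of_div_lt_div (d := 2 ^ e) (by omega)
          omega
    · rw [a3, hvu]
      split_ifs with h1 h2
      · have hL := hT.isFirst e (v + 1) he (by omega) (by omega)
        have := h22.or hT.zero_notMem_A hL (r := fun x => l < x ∧ x / 2 ^ (e + 1) = v / 2)
          (fun x y hx hy => lt_of_div_lt_div (d := 2 ^ e) (by omega)) fun x => ?_
        · rwa [if_pos h2, ← hn] at this
        · rw [div_two_pow_succ_eq_iff]
          have h3 : x / 2 ^ e = v + 1 → l < x := fun h =>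
            lt_of_div_lt_div (d := 2 ^ e) (by omega)
          omega
      · have hL := hT.isFirst e (v + 1) he (by omega) (by omega)
        have := h22.or hT.zero_notMem_A hL (r := fun x => l < x ∧ x / 2 ^ (e + 1) = v / 2)
          (fun x y hx hy => lt_of_div_lt_div (d := 2 ^ e) (by omega)) fun x => ?_
        · rwa [if_neg h2] at this
        · rw [div_two_pow_succ_eq_iff]
          have h3 : x / 2 ^ e = v + 1 → l < x := fun h =>
            lt_of_div_lt_div (d := 2 ^ e) (by omega)
          omega
      · refine h22.congr fun x _ => and_congr_right fun hx => ?_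
        rw [div_two_pow_succ_eq_iff]
        have : v ≤ x / 2 ^ e := Nat.div_le_div_right hx.le
        omega
    · exact fun r hr' => (a4 r hr').trans (hr r hr')
  · rintro s' m' ⟨e, he, h23, h21, h22, hr, hrr, hn, hrm, hm'⟩ hlt
    have ho : s'.nreg 2 = 1 := (hr 2 (by norm_num)).trans hE.one
    simp only [Test.Holds, ho, h23, not_lt] at hlt
    obtain rfl : e = K := by
      by_contra hne
      have : l / 2 ^ e < 2 := by omega
      rw [Nat.div_lt_iff_lt_mul (by positivity), ← pow_succ'] at this
      have h3 : 2 ^ (e + 1) ≤ 2 ^ K := Nat.pow_le_pow_right (by norm_num) (by omega)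
      omega
    have hroot : ∀ x, 2 ^ e ≤ x → x < 2 * 2 ^ e → x / 2 ^ e = 1 := fun x h1 h2 => by
      have h3 : 1 ≤ x / 2 ^ e := by rw [Nat.le_div_iff_mul_le (by positivity)]; omega
      have h4 : x / 2 ^ e < 2 := by rw [Nat.div_lt_iff_lt_mul (by positivity)]; omega
      omega
    refine ⟨by omega, hQ _ _ (h21.congr fun x hx => ?_) (h22.congr fun x hx => ?_) hr hrr hn hrm
      (by omega)⟩
    · rw [hroot x (hT.subA x hx).1 (hT.subA x hx).2, hroot l hl1 hl2]
      simp
    · rw [hroot x (hT.subA x hx).1 (hT.subA x hx).2, hroot l hl1 hl2]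
      simp
  · simp [block, Stmt.out, Instr.effect, State.setN, hl]
  · refine Or.inl ⟨by simp [block, Stmt.out, Instr.effect, State.setN], fun x _ h => ?_⟩
    simp at h
    omega
  · refine Or.inl ⟨by simp [block, Stmt.out, Instr.effect, State.setN], fun x _ h => ?_⟩
    simp at h
    omega
  · intro r hr
    simp [block, Stmt.out, Instr.effect, State.setN, show r ≠ 21 by omega, show r ≠ 22 by omega,
      show r ≠ 23 by omega]
  all_goals rfl

/-! ### Binary search for a nearest site -/

/-- Along the consecutive elements of `A`, the function `δ` first decreases and then increases. -/
def Unimodal (A : Finset ℕ) (δ : ℕ → ℝ) : Prop :=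
  ∀ a ∈ A, ∀ b ∈ A, ∀ c ∈ A, a < b → b < c → (∀ x ∈ A, x ≤ a ∨ x = b ∨ c ≤ x) →
    (δ a ≤ δ b → δ b ≤ δ c) ∧ (δ c ≤ δ b → δ b ≤ δ a)

/-- Once the values do not decrease from `l` to its successor, they do not decrease anywhere further
right. The induction therefore also carries the comparison of `x` with its predecessor in `A`. -/
theorem Unimodal.right {A : Finset ℕ} {δ : ℕ → ℝ} (h : Unimodal A δ) {l r : ℕ} (hl : l ∈ A)
    (hr : r ∈ A) (hlr : l < r) (hadj : ∀ x ∈ A, x ≤ l ∨ r ≤ x) (hδ : δ l ≤ δ r) :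
    ∀ x ∈ A, r ≤ x → δ l ≤ δ x := by
  have key : ∀ x, x ∈ A → r ≤ x → δ l ≤ δ x ∧
      ∀ y ∈ A, y < x → (∀ z ∈ A, z ≤ y ∨ x ≤ z) → δ y ≤ δ x := by
    intro x
    induction x using Nat.strong_induction_on with
    | _ x ih =>
      intro hx hrx
      obtain ⟨y, hy, hmax⟩ := Finset.exists_max_image (A.filter (· < x)) id
        ⟨l, by simp [hl]; omega⟩
      simp only [Finset.mem_filter, id] at hy hmax
      have hyx : ∀ z ∈ A, z ≤ y ∨ x ≤ z := fun z hz => by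
        by_cases hzx : z < x
        · exact Or.inl (hmax z ⟨hz, hzx⟩)
        · exact Or.inr (by omega)
      have huniq : ∀ y' ∈ A, y' < x → (∀ z ∈ A, z ≤ y' ∨ x ≤ z) → y' = y := fun y' h1 h2 h3 => by
        have h4 := h3 y hy.1
        have h5 := hyx y' h1
        omega
      rcases hrx.eq_or_lt with rfl | hrx
      · refine ⟨hδ, fun y' h1 h2 h3 => ?_⟩
        rw [huniq y' h1 h2 h3, ← huniq l hl hlr hadj]
        exact hδ
      · have hry : r ≤ y := hmax r ⟨hr, hrx⟩
        obtain ⟨i1, i2⟩ := ih y hy.2 hy.1 hry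
        obtain ⟨z, hz, hzmax⟩ := Finset.exists_max_image (A.filter (· < y)) id
          ⟨l, by simp [hl]; omega⟩
        simp only [Finset.mem_filter, id] at hz hzmax
        have hzy : ∀ w ∈ A, w ≤ z ∨ y ≤ w := fun w hw => by
          by_cases hwy : w < y
          · exact Or.inl (hzmax w ⟨hw, hwy⟩)
          · exact Or.inr (by omega)
        have h1 := (h z hz.1 y hy.1 x hx hz.2 hy.2 fun w hw => by
          have := hzy w hw
          have := hyx w hw
          omega).1 (i2 z hz.1 hz.2 hzy)
        refine ⟨i1.trans h1, fun y' h1' h2 h3 => ?_⟩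
        rwa [huniq y' h1' h2 h3]
  exact fun x hx hrx => (key x hx hrx).1

/-- The mirror image of `Unimodal.right`; the induction runs on the distance of `x` from `l`, as it
proceeds to the left. -/
theorem Unimodal.left {A : Finset ℕ} {δ : ℕ → ℝ} (h : Unimodal A δ) {l r : ℕ} (hl : l ∈ A)
    (hr : r ∈ A) (hlr : l < r) (hadj : ∀ x ∈ A, x ≤ l ∨ r ≤ x) (hδ : δ r ≤ δ l) :
    ∀ x ∈ A, x ≤ l → δ r ≤ δ x := by
  have key : ∀ d x, x + d = l → x ∈ A → δ r ≤ δ x ∧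
      ∀ y ∈ A, x < y → (∀ z ∈ A, z ≤ x ∨ y ≤ z) → δ y ≤ δ x := by
    intro d
    induction d using Nat.strong_induction_on with
    | _ d ih =>
      intro x hd hx
      obtain ⟨y, hy, hmin⟩ := Finset.exists_min_image (A.filter (x < ·)) id
        ⟨r, by simp [hr]; omega⟩
      simp only [Finset.mem_filter, id] at hy hmin
      have hyx : ∀ z ∈ A, z ≤ x ∨ y ≤ z := fun z hz => by
        by_cases hzx : x < z
        · exact Or.inr (hmin z ⟨hz, hzx⟩)
        · exact Or.inl (by omega)
      have huniq : ∀ y' ∈ A, x < y' → (∀ z ∈ A, z ≤ x ∨ y' ≤ z) → y' = y := fun y' h1 h2 h3 => by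
        have h4 := h3 y hy.1
        have h5 := hyx y' h1
        omega
      rcases Nat.eq_zero_or_pos d with rfl | hd0
      · obtain rfl : x = l := by omega
        refine ⟨hδ, fun y' h1 h2 h3 => ?_⟩
        rw [huniq y' h1 h2 h3, ← huniq r hr hlr hadj]
        exact hδ
      · have hry : y ≤ l := hmin l ⟨hl, by omega⟩
        obtain ⟨i1, i2⟩ := ih (l - y) (by omega) y (by omega) hy.1
        obtain ⟨z, hz, hzmin⟩ := Finset.exists_min_image (A.filter (y < ·)) id
          ⟨r, by simp [hr]; omega⟩
        simp only [Finset.mem_filter, id] at hz hzmin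
        have hzy : ∀ w ∈ A, w ≤ y ∨ z ≤ w := fun w hw => by
          by_cases hwy : y < w
          · exact Or.inr (hzmin w ⟨hw, hwy⟩)
          · exact Or.inl (by omega)
        have h1 := (h x hx y hy.1 z hz.1 hy.2 hz.2 fun w hw => by
          have := hzy w hw
          have := hyx w hw
          omega).2 (i2 z hz.1 hz.2 hzy)
        refine ⟨i1.trans h1, fun y' h1' h2 h3 => ?_⟩
        rwa [huniq y' h1' h2 h3]
  exact fun x hx hxl => (key (l - x) x (by omega) hx).1

theorem Frame.of_preserved {S : Stmt} {s s' : State} {b : ℕ} (h : Preserved S s s')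
    (h1 : ∀ r ∈ S.collect Instr.nregs, b ≤ r) (h2 : ∀ r ∈ S.collect Instr.rregs, b ≤ r)
    (h3 : ∀ r ∈ S.collect Instr.narrays, r = 4 ∨ r = 5 ∨ r = 6)
    (h4 : ∀ r ∈ S.collect Instr.rarrays, r = 3) : Frame b s s' :=
  ⟨fun r hr => h.nreg r fun h => absurd (h1 r h) (by omega),
    fun r hr => h.rreg r fun h => absurd (h2 r h) (by omega),
    fun A h4 h5 h6 => h.nmem A fun h => by have := h3 A h; omega,
    fun A hA => h.rmem A fun h => hA (h4 A h)⟩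

/-- One step of the descent in `descendProg`. -/
def descendStep : Stmt :=
  .seq (block [.nadd 21 20 20, .nadd 22 21 2, .nload 23 5 21, .nload 24 4 22]) <|
  .ite (.neq 23 1) (.instr (.nmove 20 22)) <|
  .ite (.neq 24 1) (.instr (.nmove 20 21)) <|
  .seq (block [.rload 20 4 23, .rsub 20 10 20, .rmul 20 20 20, .rload 21 5 23, .rsub 21 11 21,
    .rmul 21 21 21, .radd 22 20 21, .rload 20 4 24, .rsub 20 10 20, .rmul 20 20 20,
    .rload 21 5 24, .rsub 21 11 21, .rmul 21 21 21, .radd 23 20 21]) <|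
  .ite (.rle 22 23) (.instr (.nmove 20 21)) (.instr (.nmove 20 22))

theorem descendStep_out {s : State} {v : ℕ} {δ : ℕ → ℝ} (h1 : s.nreg 1 = 0) (h2 : s.nreg 2 = 1)
    (hv : s.nreg 20 = v)
    (hδ : ∀ l, sqDist (s.rreg 10) (s.rreg 11) (s.rmem 4 l) (s.rmem 5 l) = δ l) :
    (descendStep.out s).nreg 20 = if s.nmem 5 (v + v) = 0 then v + v + 1
      else if s.nmem 4 (v + v + 1) = 0 then v + v
      else if δ (s.nmem 5 (v + v)) ≤ δ (s.nmem 4 (v + v + 1)) then v + v else v + v + 1 := by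
  simp only [← hδ, sqDist, pow_two]
  split_ifs with c1 c2 c3
  · simp [descendStep, block, Stmt.out, Instr.effect, State.setN, Test.Holds, h1, h2, hv, c1]
  · simp [descendStep, block, Stmt.out, Instr.effect, State.setN, Test.Holds, h1, h2, hv, c1, c2]
  · simp [descendStep, block, Stmt.out, Instr.effect, State.setN, State.setR, Test.Holds, h1, h2,
      hv, c1, c2, c3]
  · simp [descendStep, block, Stmt.out, Instr.effect, State.setN, State.setR, Test.Holds, h1, h2,
      hv, c1, c2, c3]

/-- Finds an active leaf whose site is nearest to the point in the real registers `10` and `11`. -/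
def descendProg : Stmt :=
  .seq (.instr (.nmove 20 2)) (.loop (.nlt 20 3) descendStep)

/-- Throughout the descent, every active leaf is matched or beaten by one below the current node. If
both children have active leaves, comparing the last one on the left with the first one on the right
decides, by unimodality, which child may be discarded. -/
theorem descendProg_spec {K : ℕ} {A B : Finset ℕ} {κ δ : ℕ → ℝ} {s : State} {m : ℕ}
    {Q : State → ℕ → Prop} (hE : Env K s) (hT : TreeInv K A B κ 0 s) (hA : A.Nonempty)
    (hδ : ∀ l, sqDist (s.rreg 10) (s.rreg 11) (s.rmem 4 l) (s.rmem 5 l) = δ l)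
    (hU : Unimodal A δ) (hm : 30 * K + 2 ≤ m)
    (hQ : ∀ s' m', s'.nreg 20 ∈ A → (∀ x ∈ A, δ (s'.nreg 20) ≤ δ x) →
      (∀ r < 20, s'.nreg r = s.nreg r) → (∀ r < 20, s'.rreg r = s.rreg r) → s'.nmem = s.nmem →
      s'.rmem = s.rmem → m - (30 * K + 2) ≤ m' → Q s' m') :
    Run descendProg s m Q := by
  refine Run.preserving (Run.seq (Run.instr (by omega) ?_))
  refine Run.loop (fun s' m' => ∃ e ≤ K, ∃ v, s'.nreg 20 = v ∧ 2 ^ (K - e) ≤ v ∧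
    v < 2 * 2 ^ (K - e) ∧ (∀ x ∈ A, ∃ y ∈ A, y / 2 ^ e = v ∧ δ y ≤ δ x) ∧
    (∀ r < 20, s'.nreg r = s.nreg r) ∧ (∀ r < 20, s'.rreg r = s.rreg r) ∧ s'.nmem = s.nmem ∧
    s'.rmem = s.rmem ∧ m ≤ m' + 1 + 30 * (K - e)) ?_ ?_ ⟨K, le_rfl, 1, ?_, ?_, ?_, ?_, ?_, ?_, ?_,
      ?_, by omega⟩
  · rintro s' m' ⟨e, he, v, h20, hv1, hv2, hx, hr, hrr, hn, hrm, hm'⟩ hlt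
    have hz : s'.nreg 1 = 0 := (hr 1 (by norm_num)).trans hE.zero
    have ho : s'.nreg 2 = 1 := (hr 2 (by norm_num)).trans hE.one
    have hN : s'.nreg 3 = 2 ^ K := (hr 3 (by norm_num)).trans hE.leaves
    simp only [Test.Holds, hN, h20] at hlt
    have he0 : e ≠ 0 := by
      rintro rfl
      simp at hv1
      omega
    obtain ⟨e, rfl⟩ := Nat.exists_eq_succ_of_ne_zero he0
    rw [Nat.succ_eq_add_one] at *
    have hpow : (2 : ℕ) ^ (K - e) = 2 * 2 ^ (K - (e + 1)) := by
      rw [← pow_succ']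
      congr 1
      omega
    have hlf : descendStep.LoopFree := by simp [descendStep, block, Stmt.LoopFree]
    have hst : descendStep.steps ≤ 29 := by decide
    have hP := Preserved.of_loopFree hlf s'
    have hnr : ∀ r ∈ descendStep.collect Instr.nregs, 20 ≤ r := by decide
    have hrr' : ∀ r ∈ descendStep.collect Instr.rregs, 20 ≤ r := by decide
    have h20' := descendStep_out (s := s') (δ := δ) hz ho h20 fun l => by
      rw [hrr 10 (by norm_num), hrr 11 (by norm_num), hrm, hδ]
    refine ⟨by omega, Run.of_loopFree hlf (by omega) ⟨e, by omega, _, h20', ?_, ?_, ?_, ?_, ?_, ?_,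
      ?_, by omega⟩⟩
    · split_ifs <;> omega
    · split_ifs <;> omega
    · rw [hn]
      have hL := hT.isLast e (v + v) (by omega) (by omega) (by omega)
      have hF := hT.isFirst e (v + v + 1) (by omega) (by omega) (by omega)
      have h0 := hT.zero_notMem_A
      intro x hxA
      obtain ⟨y, hyA, hy, hyx⟩ := hx x hxA
      rw [div_two_pow_succ_eq_iff] at hy
      rcases hL with ⟨l0, hL⟩ | ⟨l1, l2, l3⟩
      · rw [if_pos l0]
        exact ⟨y, hyA, hy.resolve_left (hL y hyA), hyx⟩
      have l0 : s.nmem 5 (v + v) ≠ 0 := fun h => h0 (h ▸ l1)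
      rcases hF with ⟨r0, hF⟩ | ⟨r1, r2, r3⟩
      · rw [if_neg l0, if_pos r0]
        exact ⟨y, hyA, hy.resolve_right (hF y hyA), hyx⟩
      have r0 : s.nmem 4 (v + v + 1) ≠ 0 := fun h => h0 (h ▸ r1)
      have hlr : s.nmem 5 (v + v) < s.nmem 4 (v + v + 1) :=
        lt_of_div_lt_div (d := 2 ^ e) (by omega)
      -- The subtrees of the two children are adjacent, so their inner extreme active leaves are
      -- consecutive in `A`.
      have hadj : ∀ x ∈ A, x ≤ s.nmem 5 (v + v) ∨ s.nmem 4 (v + v + 1) ≤ x := fun x hx => by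
        rcases lt_trichotomy (x / 2 ^ e) (v + v) with h | h | h
        · exact Or.inl (lt_of_div_lt_div (d := 2 ^ e) (by omega)).le
        · exact Or.inl (l3 x hx h)
        · rcases (Nat.succ_le_of_lt h).eq_or_lt with h | h
          · exact Or.inr (r3 x hx h.symm)
          · exact Or.inr (lt_of_div_lt_div (d := 2 ^ e) (by omega)).le
      rw [if_neg l0, if_neg r0]
      split_ifs with hc
      · rcases hy with hy | hy
        · exact ⟨y, hyA, hy, hyx⟩
        · exact ⟨_, l1, l2, (hU.right l1 r1 hlr hadj hc y hyA (r3 y hyA hy)).trans hyx⟩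
      · rcases hy with hy | hy
        · exact ⟨_, r1, r2,
            (hU.left l1 r1 hlr hadj (not_le.1 hc).le y hyA (l3 y hyA hy)).trans hyx⟩
        · exact ⟨y, hyA, hy, hyx⟩
    · exact fun r hr' => (hP.nreg r fun h => absurd (hnr r h) (by omega)).trans (hr r hr')
    · exact fun r hr' => (hP.rreg r fun h => absurd (hrr' r h) (by omega)).trans (hrr r hr')
    · rw [← hn]
      exact funext fun r => hP.nmem r (by simp [descendStep, block, Stmt.collect, Instr.narrays])
    · rw [← hrm]
      exact funext fun r => hP.rmem r (by simp [descendStep, block, Stmt.collect, Instr.rarrays])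
  · rintro s' m' ⟨e, he, v, h20, hv1, hv2, hx, hr, hrr, hn, hrm, hm'⟩ hlt
    have hN : s'.nreg 3 = 2 ^ K := (hr 3 (by norm_num)).trans hE.leaves
    simp only [Test.Holds, hN, h20, not_lt] at hlt
    obtain rfl : e = 0 := by
      by_contra hne
      have h3 : 2 * 2 ^ (K - e) = 2 ^ (K - e + 1) := (pow_succ' _ _).symm
      have h4 : 2 ^ (K - e + 1) ≤ 2 ^ K := Nat.pow_le_pow_right (by norm_num) (by omega)
      omega
    refine ⟨by omega, fun _ => hQ _ _ ?_ (fun x hxA => ?_) hr hrr hn hrm (by omega)⟩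
    · obtain ⟨x, hxA⟩ := hA
      obtain ⟨y, hyA, hy, -⟩ := hx x hxA
      simp only [pow_zero, Nat.div_one] at hy
      rwa [h20, ← hy]
    · obtain ⟨y, hyA, hy, hyx⟩ := hx x hxA
      simp only [pow_zero, Nat.div_one] at hy
      rwa [h20, ← hy]
  · simp [Instr.effect, State.setN, hE.one]
  · simp
  · simp
  · intro x hx
    have := hT.subA x hx
    refine ⟨x, hx, ?_, le_rfl⟩
    have h3 : 1 ≤ x / 2 ^ K := by rw [Nat.le_div_iff_mul_le (by positivity)]; omega
    have h4 : x / 2 ^ K < 2 := by rw [Nat.div_lt_iff_lt_mul (by positivity)]; omega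
    omega
  · intro r hr
    simp [Instr.effect, State.setN, show r ≠ 20 by omega]
  all_goals intros; rfl

/-! ## Insertion and deletion of active leaves -/

/-- The leaves `a`, `b`, `c` are consecutive elements of `A`. -/
structure Consecutive (A : Finset ℕ) (a b c : ℕ) : Prop where
  memA : a ∈ A
  memB : b ∈ A
  memC : c ∈ A
  lt₁ : a < b
  lt₂ : b < c
  between : ∀ x ∈ A, x ≤ a ∨ x = b ∨ c ≤ x

/-- The sites `a`, `b`, `c` with coordinates given by `X` and `Y` have a bisector intersection above
which `b` is dominated. -/
def Mortal (X Y : ℕ → ℝ) (a b c : ℕ) : Prop :=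
  deathDen (X a) (Y a) (X b) (Y b) (X c) (Y c) < 0

/-- The height above which `b` is dominated by `a` and `c`, for a mortal triple. -/
noncomputable def deathHeight (X Y : ℕ → ℝ) (a b c : ℕ) : ℝ :=
  Y b + deathNum (X a) (Y a) (X b) (Y b) (X c) (Y c) /
    deathDen (X a) (Y a) (X b) (Y b) (X c) (Y c)

/-- The leaf `b` has a key if and only if it is mortal, and then the key is its death height. -/
structure KeyOK (X Y : ℕ → ℝ) (A B : Finset ℕ) (κ : ℕ → ℝ) (b : ℕ) : Prop where
  mem_iff : b ∈ B ↔ ∃ a c, Consecutive A a b c ∧ Mortal X Y a b c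
  key : ∀ a c, Consecutive A a b c → Mortal X Y a b c → κ b = deathHeight X Y a b c

theorem consecutive_iff {A : Finset ℕ} {a b c p q : ℕ} (h0 : 0 ∉ A) (hp : IsLast A (· < b) p)
    (hq : IsFirst A (b < ·) q) :
    Consecutive A a b c ↔ b ∈ A ∧ p ≠ 0 ∧ q ≠ 0 ∧ a = p ∧ c = q := by
  constructor
  · intro h
    rcases hp with ⟨-, hp⟩ | ⟨p1, p2, p3⟩
    · exact absurd h.lt₁ (hp a h.memA)
    rcases hq with ⟨-, hq⟩ | ⟨q1, q2, q3⟩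
    · exact absurd h.lt₂ (hq c h.memC)
    refine ⟨h.memB, fun h => h0 (h ▸ p1), fun h => h0 (h ▸ q1), ?_, ?_⟩
    · have h1 := p3 a h.memA h.lt₁
      have h2 := h.between p p1
      have := h.lt₂
      omega
    · have h1 := q3 c h.memC h.lt₂
      have h2 := h.between q q1
      have := h.lt₁
      omega
  · rintro ⟨hb, p0, q0, rfl, rfl⟩
    rcases hp with ⟨hp, -⟩ | ⟨p1, p2, p3⟩
    · exact absurd hp p0
    rcases hq with ⟨hq, -⟩ | ⟨q1, q2, q3⟩
    · exact absurd hq q0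
    refine ⟨p1, hb, q1, p2, q2, fun x hx => ?_⟩
    rcases lt_trichotomy x b with h | h | h
    · exact Or.inl (p3 x hx h)
    · exact Or.inr (Or.inl h)
    · exact Or.inr (Or.inr (q3 x hx h))

/-- A change of the activity of the leaf `l` concerns only triples around `l` and its neighbours. -/
theorem Consecutive.congr {A A' : Finset ℕ} {a b c l p q : ℕ}
    (hAA' : ∀ x, x ≠ l → (x ∈ A ↔ x ∈ A')) (hp : IsLast A' (· < l) p) (hq : IsFirst A' (l < ·) q)
    (hl : b ≠ l) (hbp : b ≠ p) (hbq : b ≠ q) (h : Consecutive A a b c) : Consecutive A' a b c := by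
  have h1 := h.lt₁
  have h2 := h.lt₂
  have hb := (hAA' b hl).1 h.memB
  -- If `l < b`, then `q`, being different from `b`, lies strictly between `l` and `b`. Since
  -- nothing in `A` lies between `a` and `b`, this forces `q ≤ a`, so `l` is to the left of the
  -- whole triple. The other side is analogous with `p`.
  have hright : l < b → l ≤ a := by
    intro hlb
    by_contra! hal
    rcases hq with ⟨-, hq⟩ | ⟨q1, q2, q3⟩
    · exact hq b hb hlb
    · have := q3 b hb hlb
      have := h.between q ((hAA' q (by omega)).2 q1)
      omega
  have hleft : b < l → c ≤ l := by
    intro hlb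
    by_contra! hal
    rcases hp with ⟨-, hp⟩ | ⟨q1, q2, q3⟩
    · exact hp b hb hlb
    · have := q3 b hb hlb
      have := h.between p ((hAA' p (by omega)).2 q1)
      omega
  have hal : a ≠ l := by
    rintro rfl
    rcases hq with ⟨-, hq⟩ | ⟨q1, q2, q3⟩
    · exact hq b hb h1
    · have := q3 b hb h1
      have := h.between q ((hAA' q (by omega)).2 q1)
      omega
  have hcl : c ≠ l := by
    rintro rfl
    rcases hp with ⟨-, hp⟩ | ⟨q1, q2, q3⟩
    · exact hp b hb h2
    · have := q3 b hb h2
      have := h.between p ((hAA' p (by omega)).2 q1)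
      omega
  refine ⟨(hAA' a hal).1 h.memA, hb, (hAA' c hcl).1 h.memC, h1, h2, fun x hx => ?_⟩
  by_cases hxl : x = l
  · subst hxl
    omega
  · exact h.between x ((hAA' x hxl).2 hx)

/-- Sets or clears the key of the leaf in register `15`, whose neighbours are in the registers `21`
and `22`. -/
def keyProg : Stmt :=
  .seq (block [.rload 20 4 21, .rload 21 5 21, .rload 22 4 15, .rload 23 5 15, .rload 24 4 22,
    .rload 25 5 22, .rsub 20 20 22, .rsub 21 21 23, .rsub 24 24 22, .rsub 25 25 23,
    .rmul 26 25 20, .rmul 27 21 24, .rsub 26 26 27, .radd 26 26 26,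
    .rmul 27 24 24, .rmul 28 25 25, .radd 27 27 28, .rmul 27 27 20,
    .rmul 28 20 20, .rmul 29 21 21, .radd 28 28 29, .rmul 28 28 24, .rsub 27 27 28,
    .rdiv 27 27 26, .radd 27 23 27, .rconst 28 0, .nload 23 4 15, .nmove 24 15,
    .nstore 6 15 1]) <|
  .ite (.neq 21 1) .skip <| .ite (.neq 22 1) .skip <| .ite (.neq 23 1) .skip <|
  .ite (.rlt 26 28) (block [.nstore 6 15 15, .rstore 3 15 27]) .skip

/-- The program computes the death height before it tests whether the triple exists and is mortal.
Reading cell `0` for an absent neighbour and dividing by zero are harmless, as the result is then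
not stored. -/
theorem keyProg_out {s : State} {b : ℕ} (h1 : s.nreg 1 = 0) (hb : s.nreg 15 = b) :
    (keyProg.out s).nreg 24 = b ∧
    (s.nreg 21 ≠ 0 ∧ s.nreg 22 ≠ 0 ∧ s.nmem 4 b ≠ 0 ∧
        Mortal (s.rmem 4) (s.rmem 5) (s.nreg 21) b (s.nreg 22) →
      (keyProg.out s).nmem 6 = Function.update (s.nmem 6) b b ∧
      (keyProg.out s).rmem 3 = Function.update (s.rmem 3) b
        (deathHeight (s.rmem 4) (s.rmem 5) (s.nreg 21) b (s.nreg 22))) ∧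
    (¬ (s.nreg 21 ≠ 0 ∧ s.nreg 22 ≠ 0 ∧ s.nmem 4 b ≠ 0 ∧
        Mortal (s.rmem 4) (s.rmem 5) (s.nreg 21) b (s.nreg 22)) →
      (keyProg.out s).nmem 6 = Function.update (s.nmem 6) b 0 ∧
      (keyProg.out s).rmem 3 = s.rmem 3) := by
  simp only [Mortal, deathHeight, deathNum, deathDen, pow_two, two_mul]
  by_cases c1 : s.nreg 21 = 0
  · simp [keyProg, block, Stmt.out, Instr.effect, State.setN, State.setR, State.putN, Test.Holds,
      h1, hb, c1]
  by_cases c2 : s.nreg 22 = 0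
  · simp [keyProg, block, Stmt.out, Instr.effect, State.setN, State.setR, State.putN, Test.Holds,
      h1, hb, c1, c2]
  by_cases c3 : s.nmem 4 b = 0
  · simp [keyProg, block, Stmt.out, Instr.effect, State.setN, State.setR, State.putN, Test.Holds,
      h1, hb, c1, c2, c3]
  by_cases c4 : (s.rmem 5 (s.nreg 22) - s.rmem 5 b) * (s.rmem 4 (s.nreg 21) - s.rmem 4 b) -
      (s.rmem 5 (s.nreg 21) - s.rmem 5 b) * (s.rmem 4 (s.nreg 22) - s.rmem 4 b) +
      ((s.rmem 5 (s.nreg 22) - s.rmem 5 b) * (s.rmem 4 (s.nreg 21) - s.rmem 4 b) -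
      (s.rmem 5 (s.nreg 21) - s.rmem 5 b) * (s.rmem 4 (s.nreg 22) - s.rmem 4 b)) < 0
  · simp [keyProg, block, Stmt.out, Instr.effect, State.setN, State.setR, State.putN, State.putR,
      Test.Holds, h1, hb, c1, c2, c3, c4]
  · simp [keyProg, block, Stmt.out, Instr.effect, State.setN, State.setR, State.putN, Test.Holds,
      h1, hb, c1, c2, c3, c4]

/-- Recomputes the key of the leaf in register `15`, unless this register is `0`. -/
def refreshProg : Stmt :=
  .ite (.neq 15 1) .skip <|
  .seq (.instr (.nmove 20 15)) <| .seq neighboursProg <| .seq keyProg walkProg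

/-- The active set stays fixed, so a refresh repairs the key of `b` without spoiling any other.
Stating this for each leaf separately lets successive refreshes be composed until all keys are
correct. -/
theorem refreshProg_spec {K : ℕ} {A B : Finset ℕ} {κ X Y : ℕ → ℝ} {s : State} {m b : ℕ}
    {Q : State → ℕ → Prop} (hE : Env K s) (hT : TreeInv K A B κ 0 s) (hb : s.nreg 15 = b)
    (hb' : b = 0 ∨ 2 ^ K ≤ b ∧ b < 2 * 2 ^ K) (hX : s.rmem 4 = X) (hY : s.rmem 5 = Y)
    (hm : 50 * K + 50 ≤ m)
    (hQ : ∀ s' m' B' κ', TreeInv K A B' κ' 0 s' →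
      (∀ x, x = b ∨ KeyOK X Y A B κ x → KeyOK X Y A B' κ' x) → Frame 16 s s' →
      m - (50 * K + 50) ≤ m' → Q s' m') :
    Run refreshProg s m Q := by
  refine Run.preserving (Run.ite (by omega) (fun h0 => ?_) fun h0 => ?_)
  · refine Run.skip (by omega) fun _ => hQ s _ B κ hT ?_ (Frame.refl _ _) (by omega)
    simp only [Test.Holds, hb, hE.zero] at h0
    subst h0
    rintro x (rfl | hx)
    · refine ⟨⟨fun h => absurd h hT.zero_notMem_B, fun ⟨a, c, h, _⟩ =>
        absurd h.memB hT.zero_notMem_A⟩, fun a c h _ => absurd h.memB hT.zero_notMem_A⟩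
    · exact hx
  simp only [Test.Holds, hb, hE.zero] at h0
  have hbl := hb'.resolve_left h0
  refine Run.seq (Run.instr (by omega) (Run.seq ?_))
  have hF1 : Frame 16 s ((Instr.nmove 20 15).effect s) := by
    refine ⟨fun r hr => ?_, fun _ _ => rfl, fun _ _ _ _ => rfl, fun _ _ => rfl⟩
    simp [Instr.effect, State.setN, show r ≠ 20 by omega]
  refine neighboursProg_spec (hE.of_frame hF1 (by norm_num)) (l := b)
    (hT.congr rfl rfl rfl rfl) (by simp [Instr.effect, State.setN, hb]) hbl.1 hbl.2 (by omega) ?_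
  intro s₁ m₁ hp hq hr hrr hn hrm hm₁
  have hF2 : Frame 16 s s₁ := hF1.trans (b' := 16) (b'' := 16) ⟨fun r hr' => hr r (by omega),
    fun r _ => by rw [hrr], fun A _ _ _ => by rw [hn], fun A _ => by rw [hrm]⟩ le_rfl le_rfl
  have hE₁ := hE.of_frame hF2 (by norm_num)
  have hT₁ : TreeInv K A B κ 0 s₁ := hT.congr (by rw [hn]; rfl) (by rw [hn]; rfl) (by rw [hn]; rfl)
    (by rw [hrm]; rfl)
  have hb₁ : s₁.nreg 15 = b := (hF2.nreg 15 (by norm_num)).trans hb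
  have hX₁ : s₁.rmem 4 = X := by rw [hrm]; exact hX
  have hY₁ : s₁.rmem 5 = Y := by rw [hrm]; exact hY
  have hlf : keyProg.LoopFree := by simp [keyProg, block, Stmt.LoopFree]
  have hst : keyProg.steps ≤ 36 := by decide
  obtain ⟨k1, k2, k3⟩ := keyProg_out hE₁.zero hb₁
  have hP := Preserved.of_loopFree hlf s₁
  have hF3 : Frame 16 s₁ (keyProg.out s₁) :=
    .of_preserved hP (by decide) (by decide) (by decide) (by decide)
  have hcond : (s₁.nreg 21 ≠ 0 ∧ s₁.nreg 22 ≠ 0 ∧ s₁.nmem 4 b ≠ 0 ∧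
      Mortal (s₁.rmem 4) (s₁.rmem 5) (s₁.nreg 21) b (s₁.nreg 22)) ↔
      ∃ a c, Consecutive A a b c ∧ Mortal X Y a b c := by
    rw [hX₁, hY₁, (hT₁.leaf b hbl.1 hbl.2).left]
    have hA0 : (if b ∈ A then b else 0) ≠ 0 ↔ b ∈ A := by
      split_ifs with h <;> simp [h, h0]
    rw [hA0]
    constructor
    · rintro ⟨c1, c2, c3, c4⟩
      exact ⟨_, _, (consecutive_iff hT.zero_notMem_A hp hq).2 ⟨c3, c1, c2, rfl, rfl⟩, c4⟩
    · rintro ⟨a, c, hc, hM⟩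
      obtain ⟨c3, c1, c2, rfl, rfl⟩ := (consecutive_iff hT.zero_notMem_A hp hq).1 hc
      exact ⟨c1, c2, c3, hM⟩
  have hne : ∀ v, 1 ≤ v → v < 2 ^ K → v ≠ b / 2 → v + v ≠ b ∧ v + v + 1 ≠ b ∧ v ≠ b := by omega
  have h4 : (keyProg.out s₁).nmem 4 = s₁.nmem 4 :=
    hP.nmem 4 (by simp [keyProg, block, Stmt.collect, Instr.narrays])
  have h5 : (keyProg.out s₁).nmem 5 = s₁.nmem 5 :=
    hP.nmem 5 (by simp [keyProg, block, Stmt.collect, Instr.narrays])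
  refine Run.seq (Run.of_loopFree hlf (by omega) ?_)
  have hE₂ := hE₁.of_frame hF3 (by norm_num)
  obtain ⟨B', κ', hT₂, hK⟩ : ∃ B' κ', TreeInv K A B' κ' (b / 2) (keyProg.out s₁) ∧
      ∀ x, x = b ∨ KeyOK X Y A B κ x → KeyOK X Y A B' κ' x := by
    by_cases hc : ∃ a c, Consecutive A a b c ∧ Mortal X Y a b c
    · obtain ⟨e6, e3⟩ := k2 (hcond.2 hc)
      refine ⟨insert b B, Function.update κ b (deathHeight X Y (s₁.nreg 21) b (s₁.nreg 22)),
        ⟨hT.subA, fun l hl => ?_, fun l hl1 hl2 => ?_, fun v hv1 hv2 hv => ?_⟩, ?_⟩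
      · rcases Finset.mem_insert.1 hl with rfl | hl
        · exact hbl
        · exact hT.subB l hl
      · have hl := hT₁.leaf l hl1 hl2
        refine ⟨h4 ▸ hl.left, h5 ▸ hl.right, ?_, ?_⟩
        · by_cases hlb : l = b
          · simp [e6, hlb]
          · simp [e6, hlb, hl.arg]
        · by_cases hlb : l = b
          · simp [e3, hlb, hX₁, hY₁]
          · intro hlB
            simpa [e3, hlb] using hl.key (by simpa [hlb] using hlB)
      · obtain ⟨n1, n2, n3⟩ := hne v hv1 hv2 hv
        have hl := hT₁.node v hv1 hv2 (by omega)
        constructor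
        · rw [h4]; exact hl.left
        · rw [h5]; exact hl.right
        · simpa only [e6, e3, Function.update_of_ne n1, Function.update_of_ne n2,
            Function.update_of_ne n3] using hl.arg
        · simpa only [e6, e3, Function.update_of_ne n1, Function.update_of_ne n2,
            Function.update_of_ne n3] using hl.key
      · intro x hx
        by_cases hxb : x = b
        · subst hxb
          refine ⟨by simpa using hc, fun a c hac hM => ?_⟩
          obtain ⟨-, -, -, rfl, rfl⟩ := (consecutive_iff hT.zero_notMem_A hp hq).1 hac
          simp
        · have hx := hx.resolve_left hxb
          refine ⟨by simpa [hxb] using hx.mem_iff, fun a c hac hM => ?_⟩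
          simpa [hxb] using hx.key a c hac hM
    · obtain ⟨e6, e3⟩ := k3 (fun h => hc (hcond.1 h))
      refine ⟨B.erase b, κ,
        ⟨hT.subA, fun l hl => ?_, fun l hl1 hl2 => ?_, fun v hv1 hv2 hv => ?_⟩, ?_⟩
      · exact hT.subB l (Finset.mem_of_mem_erase hl)
      · have hl := hT₁.leaf l hl1 hl2
        refine ⟨h4 ▸ hl.left, h5 ▸ hl.right, ?_, ?_⟩
        · by_cases hlb : l = b
          · simp [e6, hlb]
          · simp [e6, hlb, hl.arg]
        · rw [e3]
          exact fun h => hl.key (Finset.mem_of_mem_erase h)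
      · obtain ⟨n1, n2, n3⟩ := hne v hv1 hv2 hv
        have hl := hT₁.node v hv1 hv2 (by omega)
        constructor
        · rw [h4]; exact hl.left
        · rw [h5]; exact hl.right
        · simpa only [e6, e3, Function.update_of_ne n1, Function.update_of_ne n2,
            Function.update_of_ne n3] using hl.arg
        · simpa only [e6, e3, Function.update_of_ne n1, Function.update_of_ne n2,
            Function.update_of_ne n3] using hl.key
      · intro x hx
        by_cases hxb : x = b
        · subst hxb
          exact ⟨by simpa using hc, fun a c hac hM => absurd ⟨a, c, hac, hM⟩ hc⟩
        · have hx := hx.resolve_left hxb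
          exact ⟨by simpa [hxb] using hx.mem_iff, hx.key⟩
  refine walkProg_spec hE₂ hT₂ k1 hbl.2 (by omega) fun s₃ m₃ hT₃ hF₃ hm₃ _ => ?_
  exact hQ s₃ m₃ B' κ' hT₃ hK ((hF2.trans hF3 le_rfl le_rfl).trans hF₃ le_rfl (by norm_num))
    (by omega)

/-- Makes the leaf in register `10` active, if register `11` has the same value, and inactive, if
register `11` is `0`. -/
def toggleProg : Stmt :=
  .seq (block [.nstore 4 10 11, .nstore 5 10 11, .nstore 6 10 1, .nmove 24 10]) <|
  .seq walkProg <|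
  .seq (.instr (.nmove 20 10)) <|
  .seq neighboursProg <|
  .seq (block [.nmove 12 21, .nmove 13 22, .nmove 15 12]) <|
  .seq refreshProg <|
  .seq (.instr (.nmove 15 13)) <|
  .seq refreshProg <|
  .seq (.instr (.nmove 15 10)) refreshProg

/-- Only triples whose middle is `l` or one of its two neighbours are affected, so three refreshes
restore all keys. The budget consists of one walk (`40 * K`), one search for neighbours (`10 * K`),
three refreshes (`150 * K`) and constants. -/
theorem toggleProg_spec {K : ℕ} {A A' B : Finset ℕ} {κ X Y : ℕ → ℝ} {s : State} {m l f : ℕ}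
    {Q : State → ℕ → Prop} (hE : Env K s) (hT : TreeInv K A B κ 0 s)
    (hK : ∀ b, KeyOK X Y A B κ b) (hl : s.nreg 10 = l) (hf : s.nreg 11 = f)
    (hl1 : 2 ^ K ≤ l) (hl2 : l < 2 * 2 ^ K) (hX : s.rmem 4 = X) (hY : s.rmem 5 = Y)
    (hA' : f = l ∧ A' = insert l A ∨ f = 0 ∧ A' = A.erase l) (hm : 200 * K + 200 ≤ m)
    (hQ : ∀ s' m' B' κ', TreeInv K A' B' κ' 0 s' → (∀ b, KeyOK X Y A' B' κ' b) → Frame 12 s s' →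
      m - (200 * K + 200) ≤ m' → Q s' m') :
    Run toggleProg s m Q := by
  have hAA' : ∀ x, x ≠ l → (x ∈ A ↔ x ∈ A') := by
    rcases hA' with ⟨-, rfl⟩ | ⟨-, rfl⟩ <;> intro x hx <;> simp [hx]
  have hfl : f = if l ∈ A' then l else 0 := by
    rcases hA' with ⟨rfl, rfl⟩ | ⟨rfl, rfl⟩ <;> simp
  refine Run.seq (Run.of_loopFree (by simp [block, Stmt.LoopFree]) ?_ ?_)
  · simp [block, Stmt.steps]; omega
  have hst : (block [.nstore 4 10 11, .nstore 5 10 11, .nstore 6 10 1, .nmove 24 10]).steps = 4 :=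
    rfl
  rw [hst]
  set s₁ := (block [.nstore 4 10 11, .nstore 5 10 11, .nstore 6 10 1, .nmove 24 10]).out s with hs₁
  have hF1 : Frame 14 s s₁ := .of_preserved
    (Preserved.of_loopFree (by simp [block, Stmt.LoopFree]) s) (by decide) (by decide) (by decide)
    (by decide)
  have h4 : s₁.nmem 4 = Function.update (s.nmem 4) l f := by
    simp [hs₁, block, Stmt.out, Instr.effect, State.setN, State.putN, hl, hf]
  have h5 : s₁.nmem 5 = Function.update (s.nmem 5) l f := by
    simp [hs₁, block, Stmt.out, Instr.effect, State.setN, State.putN, hl, hf]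
  have h6 : s₁.nmem 6 = Function.update (s.nmem 6) l 0 := by
    simp [hs₁, block, Stmt.out, Instr.effect, State.setN, State.putN, hl, hE.zero]
  have h3 : s₁.rmem 3 = s.rmem 3 := rfl
  have h24 : s₁.nreg 24 = l := by
    simp [hs₁, block, Stmt.out, Instr.effect, State.setN, State.putN, hl]
  have hT₁ : TreeInv K A' (B.erase l) κ (l / 2) s₁ := by
    refine ⟨fun x hx => ?_, fun x hx => hT.subB x (Finset.mem_of_mem_erase hx),
      fun x hx1 hx2 => ?_, fun v hv1 hv2 hv => ?_⟩
    · by_cases hxl : x = l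
      · subst hxl
        exact ⟨hl1, hl2⟩
      · exact hT.subA x ((hAA' x hxl).2 hx)
    · have hx := hT.leaf x hx1 hx2
      by_cases hxl : x = l
      · subst hxl
        exact ⟨by simpa [h4] using hfl, by simpa [h5] using hfl, by simp [h6], by simp⟩
      · refine ⟨?_, ?_, ?_, ?_⟩
        · simp only [h4, ne_eq, hxl, not_false_eq_true, Function.update_of_ne, hx.left, hAA' x hxl]
        · simp only [h5, ne_eq, hxl, not_false_eq_true, Function.update_of_ne, hx.right, hAA' x hxl]
        · simp [h6, hxl, hx.arg]
        · exact fun h => hx.key (Finset.mem_of_mem_erase h)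
    · have n1 : v + v ≠ l := by omega
      have n2 : v + v + 1 ≠ l := by omega
      have n3 : v ≠ l := by omega
      have hx := hT.node v hv1 hv2 (by omega)
      constructor
      · simpa only [h4, Function.update_of_ne n1, Function.update_of_ne n2,
          Function.update_of_ne n3] using hx.left
      · simpa only [h5, Function.update_of_ne n1, Function.update_of_ne n2,
          Function.update_of_ne n3] using hx.right
      · simpa only [h6, h3, Function.update_of_ne n1, Function.update_of_ne n2,
          Function.update_of_ne n3] using hx.arg
      · simpa only [h6, h3, Function.update_of_ne n1, Function.update_of_ne n2,
          Function.update_of_ne n3] using hx.key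
  refine Run.seq (walkProg_spec (hE.of_frame hF1 (by norm_num)) hT₁ h24 hl2 (by omega) ?_)
  intro s₂ m₂ hT₂ hF₂ hm₂
  have hF2 := hF1.trans hF₂ le_rfl (by norm_num)
  refine Run.seq (Run.instr (by omega) (Run.seq ?_))
  have hF₃ : Frame 14 s₂ ((Instr.nmove 20 10).effect s₂) := by
    refine ⟨fun r hr => ?_, fun _ _ => rfl, fun _ _ _ _ => rfl, fun _ _ => rfl⟩
    simp [Instr.effect, State.setN, show r ≠ 20 by omega]
  have hF3 := hF2.trans hF₃ le_rfl le_rfl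
  refine neighboursProg_spec (l := l) (hE.of_frame hF3 (by norm_num)) (hT₂.congr rfl rfl rfl rfl)
    ?_ hl1 hl2 (by omega) ?_
  · simp [Instr.effect, State.setN, hF2.nreg 10, hl]
  intro s₄ m₄ hp hq hr hrr hn hrm hm₄
  have hF₄ : Frame 14 ((Instr.nmove 20 10).effect s₂) s₄ := ⟨fun r hr' => hr r (by omega),
    fun r _ => by rw [hrr], fun A _ _ _ => by rw [hn], fun A _ => by rw [hrm]⟩
  have hF4 := hF3.trans hF₄ le_rfl le_rfl
  have hT₄ : TreeInv K A' (B.erase l) κ 0 s₄ := hT₂.congr (by rw [hn]; rfl) (by rw [hn]; rfl)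
    (by rw [hn]; rfl) (by rw [hrm]; rfl)
  generalize hpe : s₄.nreg 21 = p at hp
  generalize hqe : s₄.nreg 22 = q at hq
  refine Run.seq (Run.of_loopFree (by simp [block, Stmt.LoopFree]) ?_ ?_)
  · simp [block, Stmt.steps]; omega
  have hst : (block [.nmove 12 21, .nmove 13 22, .nmove 15 12]).steps = 3 := rfl
  rw [hst]
  set s₅ := (block [.nmove 12 21, .nmove 13 22, .nmove 15 12]).out s₄ with hs₅
  have hF₅ : Frame 12 s₄ s₅ := .of_preserved
    (Preserved.of_loopFree (by simp [block, Stmt.LoopFree]) s₄) (by decide) (by decide)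
    (by decide) (by decide)
  have hF5 := hF4.trans hF₅ (by norm_num) le_rfl
  have hT₅ : TreeInv K A' (B.erase l) κ 0 s₅ := hT₄.congr rfl rfl rfl rfl
  have hp15 : s₅.nreg 15 = p := by
    simp [hs₅, block, Stmt.out, Instr.effect, State.setN, hpe]
  have hq13 : s₅.nreg 13 = q := by
    simp [hs₅, block, Stmt.out, Instr.effect, State.setN, hqe]
  have hpl : p = 0 ∨ 2 ^ K ≤ p ∧ p < 2 * 2 ^ K := by
    rcases hp with h | h
    · exact Or.inl h.1
    · exact Or.inr (hT₄.subA p h.1)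
  have hql : q = 0 ∨ 2 ^ K ≤ q ∧ q < 2 * 2 ^ K := by
    rcases hq with h | h
    · exact Or.inl h.1
    · exact Or.inr (hT₄.subA q h.1)
  have hK₅ : ∀ b, b ≠ l → b ≠ p → b ≠ q → KeyOK X Y A' (B.erase l) κ b := by
    intro b hb hbp hbq
    have hcons : ∀ a c, Consecutive A a b c ↔ Consecutive A' a b c := fun a c =>
      -- The neighbours of `l` differ from `l`, so they are the same in `A` and in `A'`, and the
      -- lemma applies in both directions.
      ⟨Consecutive.congr hAA' hp hq hb hbp hbq, Consecutive.congr
        (fun x hx => (hAA' x hx).symm) (hp.congr' fun x hx => (hAA' x (by omega)).symm)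
        (hq.congr' fun x hx => (hAA' x (by omega)).symm) hb hbp hbq⟩
    refine ⟨?_, fun a c hac => (hK b).key a c ((hcons a c).2 hac)⟩
    simp only [← hcons, ← (hK b).mem_iff, Finset.mem_erase, ne_eq, hb, not_false_eq_true, true_and]
  refine Run.seq (refreshProg_spec (X := X) (Y := Y) (hE.of_frame hF5 (by norm_num)) hT₅ hp15 hpl
    ((hF5.rmem 4 (by norm_num)).trans hX) ((hF5.rmem 5 (by norm_num)).trans hY) (by omega) ?_)
  intro s₆ m₆ B₆ κ₆ hT₆ hK₆ hF₆ hm₆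
  have hF6 := hF5.trans hF₆ le_rfl (by norm_num)
  refine Run.seq (Run.instr (by omega) (Run.seq ?_))
  have hF₇ : Frame 12 s₆ ((Instr.nmove 15 13).effect s₆) := by
    refine ⟨fun r hr => ?_, fun _ _ => rfl, fun _ _ _ _ => rfl, fun _ _ => rfl⟩
    simp [Instr.effect, State.setN, show r ≠ 15 by omega]
  have hF7 := hF6.trans hF₇ le_rfl le_rfl
  refine refreshProg_spec (X := X) (Y := Y) (b := q) (hE.of_frame hF7 (by norm_num))
    (hT₆.congr rfl rfl rfl rfl)
    (by simp [Instr.effect, State.setN, hF₆.nreg 13 (by norm_num), hq13]) hql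
    ((hF7.rmem 4 (by norm_num)).trans hX) ((hF7.rmem 5 (by norm_num)).trans hY) (by omega) ?_
  intro s₈ m₈ B₈ κ₈ hT₈ hK₈ hF₈ hm₈
  have hF8 := hF7.trans hF₈ le_rfl (by norm_num)
  refine Run.seq (Run.instr (by omega) ?_)
  have hF₉ : Frame 12 s₈ ((Instr.nmove 15 10).effect s₈) := by
    refine ⟨fun r hr => ?_, fun _ _ => rfl, fun _ _ _ _ => rfl, fun _ _ => rfl⟩
    simp [Instr.effect, State.setN, show r ≠ 15 by omega]
  have hF9 := hF8.trans hF₉ le_rfl le_rfl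
  refine refreshProg_spec (X := X) (Y := Y) (b := l) (hE.of_frame hF9 (by norm_num))
    (hT₈.congr rfl rfl rfl rfl)
    (by simp [Instr.effect, State.setN, hF8.nreg 10 (by norm_num), hl]) (Or.inr ⟨hl1, hl2⟩)
    ((hF9.rmem 4 (by norm_num)).trans hX) ((hF9.rmem 5 (by norm_num)).trans hY) (by omega) ?_
  intro s' m' B' κ' hT' hK' hF' hm'
  refine hQ s' m' B' κ' hT' (fun b => hK' b ?_) (hF9.trans hF' le_rfl (by norm_num)) (by omega)
  by_cases hbl : b = l
  · exact Or.inl hbl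
  refine Or.inr (hK₈ b ?_)
  by_cases hbq : b = q
  · exact Or.inl hbq
  refine Or.inr (hK₆ b ?_)
  by_cases hbp : b = p
  · exact Or.inl hbp
  exact Or.inr (hK₅ b hbl hbp hbq)

end RealRAM

/-! ## Sorting by tournament trees -/

namespace RealRAM

/-- Without leaves that carry keys, the key function is immaterial. An emptied tree can thus be
reused with other keys. -/
theorem TreeInv.of_empty {K : ℕ} {A : Finset ℕ} {κ : ℕ → ℝ} {w : ℕ} {s : State}
    (hT : TreeInv K A ∅ κ w s) (κ' : ℕ → ℝ) : TreeInv K A ∅ κ' w s :=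
  ⟨hT.subA, hT.subB, fun l hl1 hl2 => ⟨(hT.leaf l hl1 hl2).left, (hT.leaf l hl1 hl2).right,
    (hT.leaf l hl1 hl2).arg, fun h => absurd h (Finset.notMem_empty l)⟩, hT.node⟩

theorem TreeInv.setKey {K : ℕ} {A B B' : Finset ℕ} {κ κ' : ℕ → ℝ} {s s' : State} {l x : ℕ} {y : ℝ}
    (hT : TreeInv K A B κ 0 s) (hl1 : 2 ^ K ≤ l) (hl2 : l < 2 * 2 ^ K)
    (h4 : s'.nmem 4 = s.nmem 4) (h5 : s'.nmem 5 = s.nmem 5)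
    (h6 : s'.nmem 6 = Function.update (s.nmem 6) l x)
    (h3 : s'.rmem 3 = Function.update (s.rmem 3) l y) (hB : ∀ z, z ≠ l → (z ∈ B' ↔ z ∈ B))
    (hκ : ∀ z, z ≠ l → κ' z = κ z) (hx : x = if l ∈ B' then l else 0) (hy : l ∈ B' → y = κ' l) :
    TreeInv K A B' κ' (l / 2) s' := by
  refine ⟨hT.subA, fun z hz => ?_, fun z hz1 hz2 => ?_, fun v hv1 hv2 hv => ?_⟩
  · by_cases hzl : z = l
    · subst hzl
      exact ⟨hl1, hl2⟩
    · exact hT.subB z ((hB z hzl).1 hz)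
  · have hz := hT.leaf z hz1 hz2
    refine ⟨h4 ▸ hz.left, h5 ▸ hz.right, ?_, ?_⟩
    · by_cases hzl : z = l
      · subst hzl
        simpa [h6] using hx
      · simp only [h6, ne_eq, hzl, not_false_eq_true, Function.update_of_ne, hz.arg, hB z hzl]
    · by_cases hzl : z = l
      · subst hzl
        simpa [h3] using hy
      · intro hzB
        rw [h3, Function.update_of_ne hzl, hκ z hzl, hz.key ((hB z hzl).1 hzB)]
  · have n1 : v + v ≠ l := by omega
    have n2 : v + v + 1 ≠ l := by omega
    have n3 : v ≠ l := by omega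
    have hz := hT.node v hv1 hv2 (by omega)
    constructor
    · rw [h4]; exact hz.left
    · rw [h5]; exact hz.right
    · simpa only [h6, h3, Function.update_of_ne n1, Function.update_of_ne n2,
        Function.update_of_ne n3] using hz.arg
    · simpa only [h6, h3, Function.update_of_ne n1, Function.update_of_ne n2,
        Function.update_of_ne n3] using hz.key

theorem TreeInv.root_arg {K : ℕ} {A B : Finset ℕ} {κ : ℕ → ℝ} {s : State}
    (hT : TreeInv K A B κ 0 s) : IsArgMin B κ (fun _ => True) (s.nmem 6 1) := by
  have hroot : ∀ x ∈ B, x / 2 ^ K = 1 := fun x hx => by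
    have := hT.subB x hx
    have h3 : 1 ≤ x / 2 ^ K := by rw [Nat.le_div_iff_mul_le (by positivity)]; omega
    have h4 : x / 2 ^ K < 2 := by rw [Nat.div_lt_iff_lt_mul (by positivity)]; omega
    omega
  rcases (hT.isArgMin K 1 le_rfl (by simp) (by simp)).1 with ⟨h1, h2⟩ | ⟨h1, h2, h3⟩
  · exact Or.inl ⟨h1, fun l hl _ => h2 l hl (hroot l hl)⟩
  · exact Or.inr ⟨h1, trivial, fun l hl _ => h3 l hl (hroot l hl)⟩

theorem TreeInv.root_left {K : ℕ} {A B : Finset ℕ} {κ : ℕ → ℝ} {s : State}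
    (hT : TreeInv K A B κ 0 s) : IsFirst A (fun _ => True) (s.nmem 4 1) :=
  (hT.isFirst K 1 le_rfl (by simp) (by simp)).congr fun x hx => by
    have := hT.subA x hx
    have h3 : 1 ≤ x / 2 ^ K := by rw [Nat.le_div_iff_mul_le (by positivity)]; omega
    have h4 : x / 2 ^ K < 2 := by rw [Nat.div_lt_iff_lt_mul (by positivity)]; omega
    simp only [iff_true]
    omega

/-- Lexicographic order by a key and the index. -/
def KeyLt (key : ℕ → ℝ) (i j : ℕ) : Prop := key i < key j ∨ key i = key j ∧ i < j

theorem KeyLt.irrefl {key : ℕ → ℝ} {i : ℕ} : ¬ KeyLt key i i := by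
  rintro (h | ⟨-, h⟩)
  · exact lt_irrefl _ h
  · exact lt_irrefl _ h

/-- The first `n` values of `f` list the numbers below `n` by increasing keys. -/
structure IsSorting (n : ℕ) (key : ℕ → ℝ) (f : ℕ → ℕ) : Prop where
  lt : ∀ i < n, f i < n
  keyLt : ∀ i j, i < j → j < n → KeyLt key (f i) (f j)

theorem IsSorting.injOn {n : ℕ} {key : ℕ → ℝ} {f : ℕ → ℕ} (h : IsSorting n key f) {i j : ℕ}
    (hi : i < n) (hj : j < n) (hij : f i = f j) : i = j := by
  rcases lt_trichotomy i j with h' | h' | h'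
  · exact absurd (hij ▸ h.keyLt i j h' hj) KeyLt.irrefl
  · exact h'
  · exact absurd (hij ▸ h.keyLt j i h' hi) KeyLt.irrefl

theorem IsSorting.exists_eq {n : ℕ} {key : ℕ → ℝ} {f : ℕ → ℕ} (h : IsSorting n key f) {j : ℕ}
    (hj : j < n) : ∃ i < n, f i = j := by
  have h1 : (Finset.range n).image f = Finset.range n := by
    refine Finset.eq_of_subset_of_card_le ?_ ?_
    · intro x hx
      obtain ⟨i, hi, rfl⟩ := Finset.mem_image.1 hx
      exact Finset.mem_range.2 (h.lt i (Finset.mem_range.1 hi))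
    · rw [Finset.card_image_of_injOn]
      intro i hi j hj hij
      exact h.injOn (by simpa using hi) (by simpa using hj) hij
  have h2 : j ∈ (Finset.range n).image f := by rw [h1]; exact Finset.mem_range.2 hj
  obtain ⟨i, hi, rfl⟩ := Finset.mem_image.1 h2
  exact ⟨i, Finset.mem_range.1 hi, rfl⟩

/-- Enters the keys of all items into the tournament tree. -/
def sortLoad (inA keyA : ℕ) : Stmt :=
  .seq (block [.nload 5 inA 4, .rload 0 keyA 5, .nadd 24 3 4, .rstore 3 24 0, .nstore 6 24 24,
    .nadd 4 4 2]) walkProg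

/-- Extracts the item of minimum key from the tournament tree. -/
def sortExtract (outA : ℕ) : Stmt :=
  .seq (block [.nload 24 6 2, .nsub 5 24 3, .nstore outA 4 5, .nstore 6 24 1, .nadd 4 4 2]) walkProg

/-- Sorts the numbers `j` less than the value of the register `0` by the keys `keyA[inA[j]]`. -/
def sortProg (inA keyA outA : ℕ) : Stmt :=
  .seq (.instr (.nconst 4 0)) <|
  .seq (.loop (.nlt 4 0) (sortLoad inA keyA)) <|
  .seq (.instr (.nconst 4 0)) <|
  .loop (.nlt 4 0) (sortExtract outA)

theorem nregs_sortProg (inA keyA outA : ℕ) :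
    ∀ r ∈ (sortProg inA keyA outA).collect Instr.nregs, 4 ≤ r := by
  show ∀ r ∈ (sortProg 0 0 0).collect Instr.nregs, 4 ≤ r
  decide

theorem narrays_sortProg (inA keyA outA : ℕ) :
    ∀ r ∈ (sortProg inA keyA outA).collect Instr.narrays, r = 4 ∨ r = 5 ∨ r = 6 ∨ r = outA := by
  have : (sortProg inA keyA outA).collect Instr.narrays = [6, 4, 5, 6, outA, 6, 4, 5, 6] := rfl
  rw [this]
  intro r hr
  simp only [List.mem_cons, List.not_mem_nil, or_false] at hr
  omega

theorem rarrays_sortProg (inA keyA outA : ℕ) :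
    ∀ r ∈ (sortProg inA keyA outA).collect Instr.rarrays, r = 3 := by
  show ∀ r ∈ (sortProg 0 0 0).collect Instr.rarrays, r = 3
  decide

theorem Env.of_preserved {K : ℕ} {s s' : State} {S : Stmt} (h : Env K s) (hP : Preserved S s s')
    (h1 : ∀ r ∈ S.collect Instr.nregs, 4 ≤ r) (h2 : 3 ∉ S.collect Instr.narrays) : Env K s' := by
  have hr : ∀ r < 4, s'.nreg r = s.nreg r := fun r hr =>
    hP.nreg r fun h => absurd (h1 r h) (by omega)
  exact ⟨(hr 1 (by norm_num)).trans h.zero, (hr 2 (by norm_num)).trans h.one,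
    (hr 3 (by norm_num)).trans h.leaves, fun v hv => by rw [hP.nmem 3 h2, h.parent v hv]⟩

/-- A selection sort in which the tree provides the minimum. Item `j` sits at the leaf `2 ^ K + j`,
so the preference for the left resolves equal keys by index. The tree has no keys left at the end
and can be used again. -/
theorem sortProg_spec {K n : ℕ} {A : Finset ℕ} {κ₀ : ℕ → ℝ} {s : State} {m inA keyA outA : ℕ}
    {Q : State → ℕ → Prop} (hE : Env K s) (hT : TreeInv K A ∅ κ₀ 0 s) (hn : s.nreg 0 = n)
    (hnK : n ≤ 2 ^ K) (hin : 7 ≤ inA) (hkey : keyA ≠ 3) (hout : 7 ≤ outA)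
    (hm : n * (100 * K + 100) + 10 ≤ m)
    (hQ : ∀ s' m', (∀ κ, TreeInv K A ∅ κ 0 s') →
      IsSorting n (fun j => s.rmem keyA (s.nmem inA j)) (s'.nmem outA) →
      Preserved (sortProg inA keyA outA) s s' → m - (n * (100 * K + 100) + 10) ≤ m' → Q s' m') :
    Run (sortProg inA keyA outA) s m Q := by
  set key : ℕ → ℝ := fun j => s.rmem keyA (s.nmem inA j) with hkeydef
  set κ : ℕ → ℝ := fun l => key (l - 2 ^ K) with hκ
  have hmul1 : n * (40 * K + 20 + 1) = 40 * (n * K) + 21 * n := by ring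
  have hmul2 : n * (100 * K + 100) = 100 * (n * K) + 100 * n := by ring
  refine Run.preserving (Run.seq (Run.instr (by omega) (Run.seq ?_)))
  set s₁ := (Instr.nconst 4 0).effect s with hs₁
  have hE₁ : Env K s₁ := hE.of_preserved (Exec.instr _ _ : Exec [] _ _ _ _).preserved
    (by decide) (by decide)
  have hT₁ : TreeInv K A ∅ κ₀ 0 s₁ := hT.congr rfl rfl rfl rfl
  have hregs : ∀ r ∈ (sortLoad inA keyA).collect Instr.nregs, 4 ≤ r := by
    show ∀ r ∈ (sortLoad 0 0).collect Instr.nregs, 4 ≤ r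
    decide
  have harr : (sortLoad inA keyA).collect Instr.narrays = [6, 4, 5, 6] := rfl
  have harr' : (sortLoad inA keyA).collect Instr.rarrays = [3, 3] := rfl
  refine Run.forLoop (n := n) (c := 40 * K + 20)
    (fun j s' => s'.nreg 4 = j ∧ TreeInv K A (Finset.Ico (2 ^ K) (2 ^ K + j)) κ 0 s')
    (by simp [hs₁, Instr.effect, State.setN, hn])
    (fun h => absurd (hregs 0 h) (by norm_num)) (fun _ _ h => h.1)
    ⟨by simp [hs₁, Instr.effect, State.setN], by simpa using hT₁.of_empty κ⟩ (by omega) ?_ ?_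
  · rintro j s' m' hj ⟨h4, hT'⟩ hP' hm'
    have hE' : Env K s' := hE₁.of_preserved hP' hregs (by rw [harr]; decide)
    have hin' : s'.nmem inA = s.nmem inA := hP'.nmem inA (by
      rw [harr]; simp; omega)
    have hkey' : s'.rmem keyA = s.rmem keyA := hP'.rmem keyA (by
      rw [harr']; simpa using hkey)
    refine Run.seq (Run.of_loopFree (by simp [block, Stmt.LoopFree]) ?_ ?_)
    · simp [block, Stmt.steps]; omega
    set s₂ := (block [.nload 5 inA 4, .rload 0 keyA 5, .nadd 24 3 4, .rstore 3 24 0,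
      .nstore 6 24 24, .nadd 4 4 2]).out s' with hs₂
    have hsteps : (block [.nload 5 inA 4, .rload 0 keyA 5, .nadd 24 3 4, .rstore 3 24 0,
      .nstore 6 24 24, .nadd 4 4 2]).steps = 6 := rfl
    rw [hsteps]
    have e24 : s₂.nreg 24 = 2 ^ K + j := by
      simp [hs₂, block, Stmt.out, Instr.effect, State.setN, State.setR, State.putN, State.putR,
        hE'.leaves, h4]
    have e4 : s₂.nreg 4 = j + 1 := by
      simp [hs₂, block, Stmt.out, Instr.effect, State.setN, State.setR, State.putN, State.putR,
        hE'.one, h4]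
    have e6 : s₂.nmem 6 = Function.update (s'.nmem 6) (2 ^ K + j) (2 ^ K + j) := by
      simp [hs₂, block, Stmt.out, Instr.effect, State.setN, State.setR, State.putN, State.putR,
        hE'.leaves, h4]
    have e3 : s₂.rmem 3 = Function.update (s'.rmem 3) (2 ^ K + j) (key j) := by
      simp [hs₂, block, Stmt.out, Instr.effect, State.setN, State.setR, State.putN, State.putR,
        hE'.leaves, h4, hkeydef, hin', hkey']
    have hE₂ : Env K s₂ := hE'.of_preserved
      (Preserved.of_loopFree (by simp [block, Stmt.LoopFree]) s')
      (by simp [block, Stmt.collect, Instr.nregs])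
      (by simp [block, Stmt.collect, Instr.narrays])
    refine walkProg_spec (A := A) (B := Finset.Ico (2 ^ K) (2 ^ K + (j + 1))) (κ := κ)
      (l := 2 ^ K + j) hE₂ ?_ e24 (by omega) (by omega) fun s₃ m₃ hT₃ hF₃ hm₃ =>
        ⟨⟨(hF₃.nreg 4 (by norm_num)).trans e4, hT₃⟩, by omega⟩
    refine hT'.setKey (by omega) (by omega) rfl rfl e6 e3 (fun z hz => ?_) (fun z _ => rfl) ?_ ?_
    · simp only [Finset.mem_Ico]; omega
    · simp
    · simp [hκ]
  intro s₄ m₄ ⟨h4, hT₄⟩ hP₄ hm₄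
  have hE₄ : Env K s₄ := hE₁.of_preserved hP₄ hregs (by rw [harr]; decide)
  refine Run.seq (Run.instr (by omega) ?_)
  set s₅ := (Instr.nconst 4 0).effect s₄ with hs₅
  have hE₅ : Env K s₅ := hE₄.of_preserved (Exec.instr _ _ : Exec [] _ _ _ _).preserved
    (by decide) (by decide)
  have hT₅ : TreeInv K A (Finset.Ico (2 ^ K) (2 ^ K + n)) κ 0 s₅ := hT₄.congr rfl rfl rfl rfl
  have hregs₂ : ∀ r ∈ (sortExtract outA).collect Instr.nregs, 4 ≤ r := by
    show ∀ r ∈ (sortExtract 0).collect Instr.nregs, 4 ≤ r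
    decide
  have harr₂ : (sortExtract outA).collect Instr.narrays = [outA, 6, 4, 5, 6] := rfl
  have hn₅ : s₅.nreg 0 = n := by
    have : s₄.nreg 0 = s₁.nreg 0 := hP₄.nreg 0 fun h => absurd (hregs 0 h) (by norm_num)
    simp [hs₅, Instr.effect, State.setN, this, hs₁, hn]
  refine Run.forLoop (n := n) (c := 40 * K + 20)
    -- All items extracted so far precede all items that remain; hence the next minimum can be
    -- appended.
    (fun t s' => s'.nreg 4 = t ∧ ∃ B, TreeInv K A B κ 0 s' ∧ B ⊆ Finset.Ico (2 ^ K) (2 ^ K + n) ∧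
      B.card + t = n ∧ (∀ i < t, s'.nmem outA i < n) ∧
      (∀ i < t, ∀ l ∈ B, KeyLt key (s'.nmem outA i) (l - 2 ^ K)) ∧
      ∀ i j, i < j → j < t → KeyLt key (s'.nmem outA i) (s'.nmem outA j))
    hn₅ (fun h => absurd (hregs₂ 0 h) (by norm_num)) (fun _ _ h => h.1)
    ⟨by simp [hs₅, Instr.effect, State.setN], _, hT₅, subset_rfl, by simp, by simp, by simp,
      by simp⟩ (by omega) ?_ ?_
  · rintro t s' m' ht ⟨h4, B, hT', hB, hcard, hlt, hBt, hsort⟩ hP' hm'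
    have hE' : Env K s' := hE₅.of_preserved hP' hregs₂ (by
      rw [harr₂]; simp; omega)
    have hBne : B.Nonempty := by
      rw [← Finset.card_pos]; omega
    obtain ⟨b, hb⟩ : ∃ b, s'.nmem 6 1 = b := ⟨_, rfl⟩
    have hroot := hT'.root_arg
    rw [hb] at hroot
    rcases hroot with ⟨-, h0⟩ | ⟨hbB, -, hmin⟩
    · obtain ⟨x, hx⟩ := hBne
      exact absurd trivial (h0 x hx)
    have hbI := Finset.mem_Ico.1 (hB hbB)
    refine Run.seq (Run.of_loopFree (by simp [block, Stmt.LoopFree]) ?_ ?_)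
    · simp [block, Stmt.steps]; omega
    set s₂ := (block [.nload 24 6 2, .nsub 5 24 3, .nstore outA 4 5, .nstore 6 24 1,
      .nadd 4 4 2]).out s' with hs₂
    have hsteps : (block [.nload 24 6 2, .nsub 5 24 3, .nstore outA 4 5, .nstore 6 24 1,
      .nadd 4 4 2]).steps = 5 := rfl
    rw [hsteps]
    have o4 : outA ≠ 4 := by omega
    have o5 : outA ≠ 5 := by omega
    have o6 : outA ≠ 6 := by omega
    have e24 : s₂.nreg 24 = b := by
      simp [hs₂, block, Stmt.out, Instr.effect, State.setN, State.putN, hE'.one, hb]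
    have e4 : s₂.nreg 4 = t + 1 := by
      simp [hs₂, block, Stmt.out, Instr.effect, State.setN, State.putN, hE'.one, h4]
    have e6 : s₂.nmem 6 = Function.update (s'.nmem 6) b 0 := by
      simp [hs₂, block, Stmt.out, Instr.effect, State.setN, State.putN, hE'.one, hE'.zero, hb,
        o6.symm]
    have eo : s₂.nmem outA = Function.update (s'.nmem outA) t (b - 2 ^ K) := by
      simp [hs₂, block, Stmt.out, Instr.effect, State.setN, State.putN, hE'.one, hE'.leaves, h4, hb,
        o6]
    have hE₂ : Env K s₂ := hE'.of_preserved
      (Preserved.of_loopFree (by simp [block, Stmt.LoopFree]) s')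
      (by simp [block, Stmt.collect, Instr.nregs])
      (by simp [block, Stmt.collect, Instr.narrays]; omega)
    refine walkProg_spec (A := A) (B := B.erase b) (κ := κ)
      (l := b) hE₂ ?_ e24 (by omega) (by omega) fun s₃ m₃ hT₃ hF₃ hm₃ =>
        ⟨⟨(hF₃.nreg 4 (by norm_num)).trans e4, B.erase b, hT₃, (Finset.erase_subset _ _).trans hB,
          ?_, ?_⟩, by omega⟩
    -- The key cell of `b` is not written; overwriting it with its own value brings the step into
    -- the form of `TreeInv.setKey`.
    · refine hT'.setKey (by omega) (by omega) ?_ ?_ e6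
        (y := s'.rmem 3 b) ?_ (fun z hz => ?_) (fun z _ => rfl) ?_ ?_
      · simp [hs₂, block, Stmt.out, Instr.effect, State.setN, State.putN, o4.symm]
      · simp [hs₂, block, Stmt.out, Instr.effect, State.setN, State.putN, o5.symm]
      · rw [Function.update_eq_self]; rfl
      · simp [hz]
      · simp
      · simp
    · rw [Finset.card_erase_of_mem hbB]; omega
    · have eo' : s₃.nmem outA = Function.update (s'.nmem outA) t (b - 2 ^ K) := by
        rw [hF₃.nmem outA o4 o5 o6, eo]
      rw [eo']
      have hkb : ∀ l ∈ B.erase b, KeyLt key (b - 2 ^ K) (l - 2 ^ K) := by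
        intro l hl
        obtain ⟨hlb, hlB⟩ := Finset.mem_erase.1 hl
        have hlI := Finset.mem_Ico.1 (hB hlB)
        rcases hmin l hlB trivial with h | ⟨h, h'⟩
        · exact Or.inl h
        · exact Or.inr ⟨h, by omega⟩
      refine ⟨fun i hi => ?_, fun i hi l hl => ?_, fun i j hij hj => ?_⟩
      · by_cases hit : i = t
        · subst hit
          simp only [Function.update_self]
          omega
        · rw [Function.update_of_ne hit]
          exact hlt i (by omega)
      · by_cases hit : i = t
        · subst hit
          simp only [Function.update_self]
          exact hkb l hl
        · rw [Function.update_of_ne hit]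
          exact hBt i (by omega) l (Finset.mem_of_mem_erase hl)
      · rw [Function.update_of_ne (show i ≠ t by omega)]
        by_cases hjt : j = t
        · subst hjt
          simp only [Function.update_self]
          exact hBt i hij b hbB
        · rw [Function.update_of_ne hjt]
          exact hsort i j hij (by omega)
  · rintro s' m' ⟨h4, B, hT', hB, hcard, hlt, hBt, hsort⟩ hP' hm' hP
    obtain rfl : B = ∅ := Finset.card_eq_zero.1 (by omega)
    exact hQ s' m' (fun κ => hT'.of_empty κ) ⟨hlt, hsort⟩ hP (by omega)

end RealRAM

/-! ## The sweep -/

namespace RealRAM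

/-- The points, indexed by increasing height, have the coordinates `xs` and `ys`; the `j`-th of them
is the site at the leaf `pos j`. The leaves are ordered lexicographically. -/
structure SweepData (K n : ℕ) (pos : ℕ → ℕ) (xs ys X Y : ℕ → ℝ) : Prop where
  pos_ge : ∀ j < n, 2 ^ K ≤ pos j
  pos_lt : ∀ j < n, pos j < 2 * 2 ^ K
  x_pos : ∀ j < n, X (pos j) = xs j
  y_pos : ∀ j < n, Y (pos j) = ys j
  ys_lt : ∀ i j, i < j → j < n → ys i < ys j
  lex : ∀ i j, i < n → j < n → pos i < pos j → LexLt (xs i) (ys i) (xs j) (ys j)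

theorem SweepData.ys_le {K n : ℕ} {pos : ℕ → ℕ} {xs ys X Y : ℕ → ℝ}
    (h : SweepData K n pos xs ys X Y) {i j : ℕ} (hij : i ≤ j) (hj : j < n) : ys i ≤ ys j := by
  rcases hij.eq_or_lt with rfl | hij
  · exact le_rfl
  · exact (h.ys_lt i j hij hj).le

/-- The `i`-th point precedes the `j`-th one, but not the last root that does. -/
structure Elig (rt : ℕ → Prop) (i j : ℕ) : Prop where
  lt : i < j
  exists_root : ∃ r ≤ i, rt r
  le : ∀ r < j, rt r → r ≤ i

theorem exists_elig {rt : ℕ → Prop} {j r : ℕ} (hr : rt r) (hj : r < j) : ∃ i, Elig rt i j := by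
  classical
  obtain ⟨i, hi, hmax⟩ := Finset.exists_max_image ((Finset.range j).filter rt) id
    ⟨r, by simp [hr, hj]⟩
  simp only [Finset.mem_filter, Finset.mem_range, id] at hi hmax
  exact ⟨i, hi.1, ⟨i, le_rfl, hi.2⟩, fun r hr h => hmax r ⟨hr, h⟩⟩

/-- Eligibility changes incrementally along the sweep: a root makes all earlier points ineligible,
whereas any other point merely joins the eligible ones, provided that a root precedes it. -/
theorem elig_succ_of_root {rt : ℕ → Prop} {i j : ℕ} (hj : rt j) : Elig rt i (j + 1) ↔ i = j := by
  constructor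
  · intro h
    have := h.le j (Nat.lt_succ_self j) hj
    have := h.lt
    omega
  · rintro rfl
    exact ⟨Nat.lt_succ_self i, ⟨i, le_rfl, hj⟩, fun r hr _ => by omega⟩

theorem elig_succ_of_not_root {rt : ℕ → Prop} {i j : ℕ} (hj : ¬ rt j) :
    Elig rt i (j + 1) ↔ Elig rt i j ∨ i = j ∧ ∃ r < j, rt r := by
  constructor
  · intro h
    have h1 := h.lt
    obtain ⟨r, hr, hr'⟩ := h.exists_root
    rcases (Nat.lt_succ_iff.1 h1).eq_or_lt with rfl | hij
    · exact Or.inr ⟨rfl, r, lt_of_le_of_ne hr (fun h => hj (h ▸ hr')), hr'⟩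
    · exact Or.inl ⟨hij, h.exists_root, fun r hr hr' => h.le r (by omega) hr'⟩
  · rintro (h | ⟨rfl, r, hr, hr'⟩)
    · refine ⟨by have := h.lt; omega, h.exists_root, fun r hr hr' => ?_⟩
      have : r ≠ j := fun h => hj (h ▸ hr')
      exact h.le r (by omega) hr'
    · exact ⟨by omega, ⟨r, hr.le, hr'⟩, fun r hr _ => by omega⟩

/-- The active leaves belong to eligible points for the `j`-th point, and dominate all these above
the height `h`. -/
structure SweepInv (rt : ℕ → Prop) (pos : ℕ → ℕ) (xs ys X Y : ℕ → ℝ) (j : ℕ) (h : ℝ)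
    (A : Finset ℕ) : Prop where
  elig : ∀ l ∈ A, ∃ i, Elig rt i j ∧ pos i = l
  dom : ∀ i, Elig rt i j → ∀ x y, h ≤ y →
    ∃ l ∈ A, sqDist x y (X l) (Y l) ≤ sqDist x y (xs i) (ys i)

variable {K n : ℕ} {rt : ℕ → Prop} {pos : ℕ → ℕ} {xs ys X Y : ℕ → ℝ} {j : ℕ} {h : ℝ} {A : Finset ℕ}

theorem SweepInv.lexLt (hD : SweepData K n pos xs ys X Y) (hA : SweepInv rt pos xs ys X Y j h A)
    (hj : j ≤ n) {a b : ℕ} (ha : a ∈ A) (hb : b ∈ A) (hab : a < b) :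
    LexLt (X a) (Y a) (X b) (Y b) := by
  obtain ⟨i, hi, rfl⟩ := hA.elig a ha
  obtain ⟨i', hi', rfl⟩ := hA.elig b hb
  have h1 := hi.lt.trans_le hj
  have h2 := hi'.lt.trans_le hj
  rw [hD.x_pos i h1, hD.x_pos i' h2, hD.y_pos i h1, hD.y_pos i' h2]
  exact hD.lex i i' h1 h2 hab

/-- Wherever `b` served as a witness of domination, `a` or `c` takes over. The invariant concerns
all queries at height `h` or more, so the deletion needs no later revision. -/
theorem SweepInv.erase (hD : SweepData K n pos xs ys X Y) (hA : SweepInv rt pos xs ys X Y j h A)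
    (hj : j ≤ n) {a b c : ℕ} (hc : Consecutive A a b c) (hM : Mortal X Y a b c)
    (hh : deathHeight X Y a b c < h) : SweepInv rt pos xs ys X Y j h (A.erase b) := by
  refine ⟨fun l hl => hA.elig l (Finset.mem_of_mem_erase hl), fun i hi x y hy => ?_⟩
  obtain ⟨l, hl, hle⟩ := hA.dom i hi x y hy
  by_cases hlb : l = b
  · subst hlb
    rcases dominated_of_death (x := x) (y := y) (hA.lexLt hD hj hc.memA hc.memB hc.lt₁).le
      (hA.lexLt hD hj hc.memB hc.memC hc.lt₂).le hy hM hh with h' | h'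
    · exact ⟨a, Finset.mem_erase.2 ⟨hc.lt₁.ne, hc.memA⟩, h'.trans hle⟩
    · exact ⟨c, Finset.mem_erase.2 ⟨hc.lt₂.ne', hc.memC⟩, h'.trans hle⟩
  · exact ⟨l, Finset.mem_erase.2 ⟨hlb, hl⟩, hle⟩

/-- If no key is below the sweep line, every mortal consecutive triple is still at or below its
threshold, and the local inequalities for triples are exactly unimodality. -/
theorem SweepInv.unimodal (hD : SweepData K n pos xs ys X Y) (hA : SweepInv rt pos xs ys X Y j h A)
    (hj : j < n) (hh : h = ys j) {B : Finset ℕ} {κ : ℕ → ℝ} (hK : ∀ b, KeyOK X Y A B κ b)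
    (hB : ∀ b ∈ B, h ≤ κ b) (x : ℝ) : Unimodal A fun l => sqDist x h (X l) (Y l) := by
  have hY : ∀ l ∈ A, Y l ≤ h := fun l hl => by
    obtain ⟨i, hi, rfl⟩ := hA.elig l hl
    rw [hD.y_pos i (hi.lt.trans hj), hh]
    exact hD.ys_le hi.lt.le hj
  intro a ha b hb c hc hab hbc hbet
  have hcons : Consecutive A a b c := ⟨ha, hb, hc, hab, hbc, hbet⟩
  have halive : deathDen (X a) (Y a) (X b) (Y b) (X c) (Y c) < 0 →
      h ≤ Y b + deathNum (X a) (Y a) (X b) (Y b) (X c) (Y c) /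
        deathDen (X a) (Y a) (X b) (Y b) (X c) (Y c) := fun hM => by
    have h1 := hB b ((hK b).mem_iff.2 ⟨a, c, hcons, hM⟩)
    rwa [(hK b).key a c hcons hM] at h1
  have l1 := hA.lexLt hD hj.le ha hb hab
  have l2 := hA.lexLt hD hj.le hb hc hbc
  exact ⟨unimodal_right l1 l2 (hY b hb) halive, unimodal_left l1 l2 (hY b hb) (hY c hc) halive⟩

theorem SweepInv.mono {h' : ℝ} (hA : SweepInv rt pos xs ys X Y j h A) (hh : h ≤ h') :
    SweepInv rt pos xs ys X Y j h' A :=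
  ⟨hA.elig, fun i hi x y hy => hA.dom i hi x y (hh.trans hy)⟩

/-- Allows the program to test for an earlier root by testing whether some leaf is active. -/
theorem SweepInv.exists_root_iff (hA : SweepInv rt pos xs ys X Y j h A) :
    (∃ r < j, rt r) ↔ A.Nonempty := by
  constructor
  · rintro ⟨r, hr, hr'⟩
    obtain ⟨i, hi⟩ := exists_elig hr' hr
    obtain ⟨l, hl, -⟩ := hA.dom i hi 0 h le_rfl
    exact ⟨l, hl⟩
  · rintro ⟨l, hl⟩
    obtain ⟨i, hi, -⟩ := hA.elig l hl
    obtain ⟨r, hr, hr'⟩ := hi.exists_root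
    exact ⟨r, hr.trans_lt hi.lt, hr'⟩

theorem SweepInv.succ_of_root (hD : SweepData K n pos xs ys X Y) (hj : j < n) (hr : rt j) :
    SweepInv rt pos xs ys X Y (j + 1) h {pos j} := by
  refine ⟨fun l hl => ⟨j, (elig_succ_of_root hr).2 rfl, (Finset.mem_singleton.1 hl).symm⟩,
    fun i hi x y _ => ⟨pos j, Finset.mem_singleton_self _, ?_⟩⟩
  rw [(elig_succ_of_root hr).1 hi, hD.x_pos j hj, hD.y_pos j hj]

theorem SweepInv.succ_of_not_root (hD : SweepData K n pos xs ys X Y) (hj : j < n)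
    (hA : SweepInv rt pos xs ys X Y j h A) (hr : ¬ rt j) :
    SweepInv rt pos xs ys X Y (j + 1) h (if A.Nonempty then insert (pos j) A else A) := by
  split_ifs with hne
  · refine ⟨fun l hl => ?_, fun i hi x y hy => ?_⟩
    · rcases Finset.mem_insert.1 hl with rfl | hl
      · exact ⟨j, (elig_succ_of_not_root hr).2 (Or.inr ⟨rfl, hA.exists_root_iff.2 hne⟩), rfl⟩
      · obtain ⟨i, hi, rfl⟩ := hA.elig l hl
        exact ⟨i, (elig_succ_of_not_root hr).2 (Or.inl hi), rfl⟩
    · rcases (elig_succ_of_not_root hr).1 hi with hi | ⟨rfl, -⟩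
      · obtain ⟨l, hl, hle⟩ := hA.dom i hi x y hy
        exact ⟨l, Finset.mem_insert_of_mem hl, hle⟩
      · exact ⟨pos i, Finset.mem_insert_self _ _, by rw [hD.x_pos i hj, hD.y_pos i hj]⟩
  · refine ⟨fun l hl => absurd ⟨l, hl⟩ hne, fun i hi x y hy => ?_⟩
    rcases (elig_succ_of_not_root hr).1 hi with hi | ⟨-, h'⟩
    · exact hA.dom i hi x y hy
    · exact absurd (hA.exists_root_iff.1 h') hne

/-- The tree together with the keys of all leaves. -/
structure TreeKeys (K : ℕ) (A : Finset ℕ) (s : State) (B : Finset ℕ) (κ : ℕ → ℝ) : Prop where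
  tree : TreeInv K A B κ 0 s
  keys : ∀ b, KeyOK (s.rmem 4) (s.rmem 5) A B κ b

theorem TreeKeys.congr {K : ℕ} {A B : Finset ℕ} {κ : ℕ → ℝ} {s s' : State}
    (hT : TreeKeys K A s B κ) (hn : s'.nmem = s.nmem) (hr : s'.rmem = s.rmem) :
    TreeKeys K A s' B κ :=
  ⟨hT.tree.congr (by rw [hn]) (by rw [hn]) (by rw [hn]) (by rw [hr]), by rw [hr]; exact hT.keys⟩

/-- Loads the leaf of minimum key and its key, or the current height if there is none. -/
def purgeHead : Stmt :=
  .seq (block [.nload 10 6 2, .rload 12 3 2]) (.ite (.neq 10 1) (.instr (.rmove 12 11)) .skip)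

theorem purgeHead_out {s : State} (h1 : s.nreg 1 = 0) (h2 : s.nreg 2 = 1) :
    (purgeHead.out s).nreg 10 = s.nmem 6 1 ∧
    (purgeHead.out s).rreg 12 = (if s.nmem 6 1 = 0 then s.rreg 11 else s.rmem 3 1) ∧
    (purgeHead.out s).nmem = s.nmem ∧ (purgeHead.out s).rmem = s.rmem ∧
    (∀ r < 10, (purgeHead.out s).nreg r = s.nreg r) ∧
    ∀ r < 12, (purgeHead.out s).rreg r = s.rreg r := by
  have hP := Preserved.of_loopFree (S := purgeHead) (by simp [purgeHead, block, Stmt.LoopFree]) s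
  have hn : ∀ r ∈ purgeHead.collect Instr.nregs, 10 ≤ r := by decide
  have hr : ∀ r ∈ purgeHead.collect Instr.rregs, 12 ≤ r := by decide
  refine ⟨?_, ?_, funext fun r => hP.nmem r (by
    simp [purgeHead, block, Stmt.collect, Instr.narrays]), funext fun r => hP.rmem r (by
    simp [purgeHead, block, Stmt.collect, Instr.rarrays]),
    fun r hr' => hP.nreg r fun h => absurd (hn r h) (by omega),
    fun r hr' => hP.rreg r fun h => absurd (hr r h) (by omega)⟩
  · by_cases h : s.nmem 6 1 = 0 <;>
      simp [purgeHead, block, Stmt.out, Instr.effect, State.setN, State.setR, Test.Holds, h1, h2, h]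
  · by_cases h : s.nmem 6 1 = 0 <;>
      simp [purgeHead, block, Stmt.out, Instr.effect, State.setN, State.setR, Test.Holds, h1, h2, h]

/-! ### Operations of the sweep and their amortized cost -/

/-- Deletes the leaves whose keys are less than the current height in the real register `11`. -/
def purgeProg : Stmt :=
  .seq purgeHead <| .loop (.rlt 12 11) <|
  .seq (.instr (.nconst 11 0)) <| .seq toggleProg purgeHead

/-- The number of deletions has no useful bound in a single call, so the cost is measured against
the potential `(200 * K + 210) * A.card`: each deletion is paid by the leaf that it removes. -/
theorem purgeProg_spec {s : State} {m : ℕ} {B : Finset ℕ} {κ : ℕ → ℝ} {Q : State → ℕ → Prop}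
    (hE : Env K s) (hT : TreeKeys K A s B κ) (hX : s.rmem 4 = X) (hY : s.rmem 5 = Y)
    (hD : SweepData K n pos xs ys X Y) (hh : s.rreg 11 = h)
    (hA : SweepInv rt pos xs ys X Y j h A) (hj : j ≤ n) (hm : (200 * K + 210) * A.card + 10 ≤ m)
    (hQ : ∀ s' m' A' B' κ', TreeKeys K A' s' B' κ' → (∀ b ∈ B', h ≤ κ' b) →
      SweepInv rt pos xs ys X Y j h A' → Frame 10 s s' → s'.rreg 10 = s.rreg 10 →
      s'.rreg 11 = s.rreg 11 →
      m + (200 * K + 210) * A'.card ≤ m' + (200 * K + 210) * A.card + 10 → Q s' m') :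
    Run purgeProg s m Q := by
  have hlf : purgeHead.LoopFree := by simp [purgeHead, block, Stmt.LoopFree]
  have hst : purgeHead.steps = 4 := rfl
  -- The factor is made opaque so that its products with cardinalities are atoms for linear
  -- arithmetic.
  obtain ⟨C, hC⟩ : ∃ C, C = 200 * K + 210 := ⟨_, rfl⟩
  rw [← hC] at hm hQ
  refine Run.seq (Run.of_loopFree hlf (by omega) ?_)
  refine Run.loop (fun s' m' => ∃ A' B' κ', TreeKeys K A' s' B' κ' ∧
    SweepInv rt pos xs ys X Y j h A' ∧ Frame 10 s s' ∧ s'.rreg 10 = s.rreg 10 ∧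
    s'.rreg 11 = s.rreg 11 ∧ s'.nreg 10 = s'.nmem 6 1 ∧
    s'.rreg 12 = (if s'.nmem 6 1 = 0 then s'.rreg 11 else s'.rmem 3 1) ∧
    m + C * A'.card ≤ m' + C * A.card + 4) ?_ ?_ ?_
  · rintro s₁ m₁ ⟨A₁, B₁, κ₁, hT₁, hA₁, hF₁, h10, h11, e10, e12, hm₁⟩ hlt
    have hE₁ := hE.of_frame hF₁ (by norm_num)
    simp only [Test.Holds] at hlt
    have hX₁ : s₁.rmem 4 = X := (hF₁.rmem 4 (by norm_num)).trans hX
    have hY₁ : s₁.rmem 5 = Y := (hF₁.rmem 5 (by norm_num)).trans hY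
    have hb0 : s₁.nmem 6 1 ≠ 0 := fun h0 => by
      rw [e12, if_pos h0] at hlt
      exact lt_irrefl _ hlt
    rw [e12, if_neg hb0, (hT₁.tree.isArgMin K 1 le_rfl (by simp) (by simp)).2 hb0, h11, hh] at hlt
    obtain ⟨b, hb⟩ : ∃ b, s₁.nmem 6 1 = b := ⟨_, rfl⟩
    have hroot := hT₁.tree.root_arg
    rw [hb] at hroot hlt e10 hb0
    obtain ⟨hbB, -, -⟩ := hroot.resolve_left fun h => hb0 h.1
    obtain ⟨a, c, hc, hM⟩ := (hT₁.keys b).mem_iff.1 hbB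
    have hκ := (hT₁.keys b).key a c hc hM
    rw [hX₁, hY₁] at hM hκ
    rw [hκ] at hlt
    have hbl := hT₁.tree.subA b hc.memB
    have hcard : C * A₁.card = C * (A₁.erase b).card + C := by
      rw [← Finset.card_erase_add_one hc.memB, Nat.mul_succ]
    refine ⟨by omega, Run.seq (Run.instr (by omega) (Run.seq ?_))⟩
    set s₂ := (Instr.nconst 11 0).effect s₁ with hs₂
    have hF₂ : Frame 10 s₁ s₂ := by
      refine ⟨fun r hr => ?_, fun _ _ => rfl, fun _ _ _ _ => rfl, fun _ _ => rfl⟩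
      simp [hs₂, Instr.effect, State.setN, show r ≠ 11 by omega]
    refine toggleProg_spec (K := K) (A := A₁) (A' := A₁.erase b) (l := b) (f := 0)
      (X := X) (Y := Y) (hE₁.of_frame hF₂ (by norm_num)) (hT₁.tree.congr rfl rfl rfl rfl)
      (by rw [← hX₁, ← hY₁]; exact hT₁.keys) (by simp [hs₂, Instr.effect, State.setN, e10])
      (by simp [hs₂, Instr.effect, State.setN]) hbl.1 hbl.2 hX₁ hY₁ (Or.inr ⟨rfl, rfl⟩) (by omega)
      fun s₃ m₃ B₃ κ₃ hT₃ hK₃ hF₃ hm₃ => ?_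
    have hF12 := (hF₁.trans hF₂ le_rfl le_rfl)
    have hF13 := hF12.trans hF₃ le_rfl (by norm_num)
    have hE₃ := hE.of_frame hF13 (by norm_num)
    obtain ⟨f1, f2, f3, f4, f5, f6⟩ := purgeHead_out hE₃.zero hE₃.one
    have hX₃ : s₃.rmem 4 = X := (hF13.rmem 4 (by norm_num)).trans hX
    have hY₃ : s₃.rmem 5 = Y := (hF13.rmem 5 (by norm_num)).trans hY
    have hTK : TreeKeys K (A₁.erase b) s₃ B₃ κ₃ := ⟨hT₃, by rw [hX₃, hY₃]; exact hK₃⟩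
    refine Run.of_loopFree hlf (by omega) ⟨A₁.erase b, B₃, κ₃, hTK.congr f3 f4,
      hA₁.erase hD hj hc hM hlt, hF13.trans (b' := 10) (b'' := 10) ⟨f5, fun r hr => f6 r (by omega),
        fun A _ _ _ => by rw [f3], fun A _ => by rw [f4]⟩ le_rfl le_rfl, ?_, ?_, ?_, ?_, ?_⟩
    · rw [f6 10 (by norm_num), hF₃.rreg 10 (by norm_num)]
      exact h10
    · rw [f6 11 (by norm_num), hF₃.rreg 11 (by norm_num)]
      exact h11
    · rw [f1, f3]
    · rw [f2, f3, f4, f6 11 (by norm_num)]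
    · omega
  · rintro s₁ m₁ ⟨A₁, B₁, κ₁, hT₁, hA₁, hF₁, h10, h11, e10, e12, hm₁⟩ hlt
    refine ⟨by omega, hQ s₁ _ A₁ B₁ κ₁ hT₁ (fun b hb => ?_) hA₁ hF₁ h10 h11 (by omega)⟩
    simp only [Test.Holds, not_lt] at hlt
    rcases hT₁.tree.root_arg with ⟨-, h0⟩ | ⟨hM, -, hmin⟩
    · exact absurd trivial (h0 b hb)
    · have hb0 : s₁.nmem 6 1 ≠ 0 := fun h0 => hT₁.tree.zero_notMem_B (h0 ▸ hM)
      rw [e12, if_neg hb0, (hT₁.tree.isArgMin K 1 le_rfl (by simp) (by simp)).2 hb0, h11, hh]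
        at hlt
      rcases hmin b hb trivial with h' | ⟨h', -⟩
      · exact hlt.trans h'.le
      · exact hlt.trans h'.le
  · obtain ⟨f1, f2, f3, f4, f5, f6⟩ := purgeHead_out hE.zero hE.one
    exact ⟨A, B, κ, hT.congr f3 f4, hA, ⟨f5, fun r hr => f6 r (by omega),
        fun A _ _ _ => by rw [f3], fun A _ => by rw [f4]⟩, f6 10 (by norm_num),
        f6 11 (by norm_num), by rw [f1, f3], by rw [f2, f3, f4, f6 11 (by norm_num)], by omega⟩

/-- Deletes all active leaves. -/
def clearProg : Stmt :=
  .seq (.instr (.nload 10 4 2)) <| .loop (.nlt 1 10) <|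
  .seq (.instr (.nconst 11 0)) <| .seq toggleProg (.instr (.nload 10 4 2))

theorem clearProg_spec {s : State} {m : ℕ} {B : Finset ℕ} {κ : ℕ → ℝ} {Q : State → ℕ → Prop}
    (hE : Env K s) (hT : TreeKeys K A s B κ) (hm : (200 * K + 210) * A.card + 10 ≤ m)
    (hQ : ∀ s' m' B' κ', TreeKeys K ∅ s' B' κ' → Frame 10 s s' →
      m ≤ m' + (200 * K + 210) * A.card + 10 → Q s' m') :
    Run clearProg s m Q := by
  obtain ⟨C, hC⟩ : ∃ C, C = 200 * K + 210 := ⟨_, rfl⟩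
  rw [← hC] at hm hQ
  have hload : ∀ s : State, Env K s → ((Instr.nload 10 4 2).effect s).nreg 10 = s.nmem 4 1 ∧
      Frame 10 s ((Instr.nload 10 4 2).effect s) := fun s hE => by
    refine ⟨by simp [Instr.effect, State.setN, hE.one], fun r hr => ?_, fun _ _ => rfl,
      fun _ _ _ _ => rfl, fun _ _ => rfl⟩
    simp [Instr.effect, State.setN, show r ≠ 10 by omega]
  refine Run.seq (Run.instr (by omega) ?_)
  refine Run.loop (fun s' m' => ∃ A' B' κ', TreeKeys K A' s' B' κ' ∧ Frame 10 s s' ∧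
    s'.nreg 10 = s'.nmem 4 1 ∧ m + C * A'.card ≤ m' + C * A.card + 4) ?_ ?_ ?_
  · rintro s₁ m₁ ⟨A₁, B₁, κ₁, hT₁, hF₁, e10, hm₁⟩ hlt
    have hE₁ := hE.of_frame hF₁ (by norm_num)
    simp only [Test.Holds, hE₁.zero] at hlt
    obtain ⟨b, hb⟩ : ∃ b, s₁.nmem 4 1 = b := ⟨_, rfl⟩
    have hroot := hT₁.tree.root_left
    rw [hb] at hroot e10
    obtain ⟨hbA, -, -⟩ := hroot.resolve_left fun h => by omega
    have hbl := hT₁.tree.subA b hbA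
    have hcard : C * A₁.card = C * (A₁.erase b).card + C := by
      rw [← Finset.card_erase_add_one hbA, Nat.mul_succ]
    refine ⟨by omega, Run.seq (Run.instr (by omega) (Run.seq ?_))⟩
    set s₂ := (Instr.nconst 11 0).effect s₁ with hs₂
    have hF₂ : Frame 10 s₁ s₂ := by
      refine ⟨fun r hr => ?_, fun _ _ => rfl, fun _ _ _ _ => rfl, fun _ _ => rfl⟩
      simp [hs₂, Instr.effect, State.setN, show r ≠ 11 by omega]
    refine toggleProg_spec (K := K) (A := A₁) (A' := A₁.erase b) (l := b) (f := 0)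
      (hE₁.of_frame hF₂ (by norm_num)) (hT₁.tree.congr rfl rfl rfl rfl)
      hT₁.keys (by simp [hs₂, Instr.effect, State.setN, e10])
      (by simp [hs₂, Instr.effect, State.setN]) hbl.1 hbl.2 rfl rfl (Or.inr ⟨rfl, rfl⟩) (by omega)
      fun s₃ m₃ B₃ κ₃ hT₃ hK₃ hF₃ hm₃ => ?_
    have hF23 := hF₂.trans hF₃ le_rfl (by norm_num)
    have hF13 := hF₁.trans hF23 le_rfl le_rfl
    have hE₃ := hE.of_frame hF13 (by norm_num)
    have hTK : TreeKeys K (A₁.erase b) s₃ B₃ κ₃ :=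
      ⟨hT₃, by rw [hF23.rmem 4 (by norm_num), hF23.rmem 5 (by norm_num)]; exact hK₃⟩
    obtain ⟨f1, f2⟩ := hload s₃ hE₃
    exact Run.instr (by omega) ⟨A₁.erase b, B₃, κ₃, hTK.congr rfl rfl,
      hF13.trans f2 le_rfl le_rfl, f1, by omega⟩
  · rintro s₁ m₁ ⟨A₁, B₁, κ₁, hT₁, hF₁, e10, hm₁⟩ hlt
    have hE₁ := hE.of_frame hF₁ (by norm_num)
    simp only [Test.Holds, hE₁.zero, not_lt, nonpos_iff_eq_zero, e10] at hlt
    rcases hT₁.tree.root_left with ⟨-, h0⟩ | ⟨hM, -, -⟩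
    · obtain rfl : A₁ = ∅ := Finset.eq_empty_of_forall_notMem fun l hl => h0 l hl trivial
      exact ⟨by omega, hQ s₁ _ B₁ κ₁ hT₁ hF₁ (by omega)⟩
    · exact absurd (hlt ▸ hM) hT₁.tree.zero_notMem_A
  · obtain ⟨f1, f2⟩ := hload s hE
    exact ⟨A, B, κ, hT.congr rfl rfl, f2, f1, by omega⟩

/-- The memory that the sweep reads: the points by increasing height, their leaves, the points at
the leaves, the marks of the roots, and the coordinates of the sites at the leaves. -/
structure SweepMem (K : ℕ) (ord pos site mark : ℕ → ℕ) (X Y : ℕ → ℝ) (s : State) : Prop where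
  env : Env K s
  ord : s.nmem 7 = ord
  pos : s.nmem 10 = pos
  site : s.nmem 11 = site
  mark : s.nmem 0 = mark
  xs : s.rmem 4 = X
  ys : s.rmem 5 = Y

theorem SweepMem.of_frame {K b : ℕ} {ord pos site mark : ℕ → ℕ} {X Y : ℕ → ℝ} {s s' : State}
    (h : SweepMem K ord pos site mark X Y s) (hF : Frame b s s') (hb : 4 ≤ b) :
    SweepMem K ord pos site mark X Y s' :=
  ⟨h.env.of_frame hF hb, (hF.nmem 7 (by norm_num) (by norm_num) (by norm_num)).trans h.ord,
    (hF.nmem 10 (by norm_num) (by norm_num) (by norm_num)).trans h.pos,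
    (hF.nmem 11 (by norm_num) (by norm_num) (by norm_num)).trans h.site,
    (hF.nmem 0 (by norm_num) (by norm_num) (by norm_num)).trans h.mark,
    (hF.rmem 4 (by norm_num)).trans h.xs, (hF.rmem 5 (by norm_num)).trans h.ys⟩

/-- Makes the leaf in register `6` active. -/
def insertProg : Stmt := .seq (block [.nmove 10 6, .nmove 11 6]) toggleProg

theorem insertProg_spec {K l : ℕ} {A B : Finset ℕ} {κ : ℕ → ℝ} {s : State} {m : ℕ}
    {Q : State → ℕ → Prop} (hE : Env K s) (hT : TreeKeys K A s B κ) (hl : s.nreg 6 = l)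
    (hl1 : 2 ^ K ≤ l) (hl2 : l < 2 * 2 ^ K) (hm : 200 * K + 202 ≤ m)
    (hQ : ∀ s' m' B' κ', TreeKeys K (insert l A) s' B' κ' → Frame 10 s s' →
      m ≤ m' + 200 * K + 202 → Q s' m') :
    Run insertProg s m Q := by
  refine Run.seq (Run.of_loopFree (by simp [block, Stmt.LoopFree]) ?_ ?_)
  · simp [block, Stmt.steps]; omega
  have hst : (block [.nmove 10 6, .nmove 11 6]).steps = 2 := rfl
  rw [hst]
  set s₁ := (block [.nmove 10 6, .nmove 11 6]).out s with hs₁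
  have hF₁ : Frame 10 s s₁ := .of_preserved
    (Preserved.of_loopFree (by simp [block, Stmt.LoopFree]) s) (by decide) (by decide) (by decide)
    (by decide)
  refine toggleProg_spec (K := K) (A := A) (A' := insert l A) (l := l) (f := l)
    (hE.of_frame hF₁ (by norm_num)) (hT.tree.congr rfl rfl rfl rfl) hT.keys
    (by simp [hs₁, block, Stmt.out, Instr.effect, State.setN, hl])
    (by simp [hs₁, block, Stmt.out, Instr.effect, State.setN, hl]) hl1 hl2 rfl rfl
    (Or.inl ⟨rfl, rfl⟩) (by omega) fun s₂ m₂ B₂ κ₂ hT₂ hK₂ hF₂ hm₂ => ?_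
  have hF := hF₁.trans hF₂ le_rfl (by norm_num)
  exact hQ s₂ m₂ B₂ κ₂ ⟨hT₂, by rw [hF.rmem 4 (by norm_num), hF.rmem 5 (by norm_num)]; exact hK₂⟩
    hF (by omega)

/-- Stores in register `8` the successor of a nearest active point, or `0` if there is none. -/
def queryProg : Stmt :=
  .seq (.instr (.nload 7 4 2)) <|
  .ite (.neq 7 1) (.instr (.nmove 8 1)) (.seq descendProg (block [.nload 8 11 20, .nadd 8 8 2]))

theorem queryProg_spec {K : ℕ} {A B : Finset ℕ} {κ : ℕ → ℝ} {s : State} {m : ℕ}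
    {Q : State → ℕ → Prop} (hE : Env K s) (hT : TreeKeys K A s B κ)
    (hU : Unimodal A fun l => sqDist (s.rreg 10) (s.rreg 11) (s.rmem 4 l) (s.rmem 5 l))
    (hm : 30 * K + 10 ≤ m)
    (hQ : ∀ s' m', (s'.nreg 7 = 0 ↔ ¬ A.Nonempty) → (¬ A.Nonempty → s'.nreg 8 = 0) →
      (A.Nonempty → ∃ v ∈ A, s'.nreg 8 = s.nmem 11 v + 1 ∧ ∀ x ∈ A,
        sqDist (s.rreg 10) (s.rreg 11) (s.rmem 4 v) (s.rmem 5 v) ≤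
          sqDist (s.rreg 10) (s.rreg 11) (s.rmem 4 x) (s.rmem 5 x)) →
      Frame 7 s s' → TreeKeys K A s' B κ → m ≤ m' + 30 * K + 10 → Q s' m') :
    Run queryProg s m Q := by
  refine Run.preserving (Run.seq (Run.instr (by omega) ?_))
  set s₁ := (Instr.nload 7 4 2).effect s with hs₁
  have e7 : s₁.nreg 7 = s.nmem 4 1 := by simp [hs₁, Instr.effect, State.setN, hE.one]
  have e1 : s₁.nreg 1 = 0 := by simp [hs₁, Instr.effect, State.setN, hE.zero]
  have hregs : ∀ r ∈ queryProg.collect Instr.nregs, 7 ≤ r := by decide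
  have hrregs : ∀ r ∈ queryProg.collect Instr.rregs, 7 ≤ r := by decide
  have hframe : ∀ {s'}, Preserved queryProg s s' → Frame 7 s s' := fun hP =>
    .of_preserved hP hregs hrregs (by decide) (by decide)
  have hcongr : ∀ {s'}, Preserved queryProg s s' → TreeKeys K A s' B κ := fun hP =>
    hT.congr (funext fun r => hP.nmem r (by
      simp [queryProg, descendProg, descendStep, block, Stmt.collect, Instr.narrays]))
      (funext fun r => hP.rmem r (by
        simp [queryProg, descendProg, descendStep, block, Stmt.collect, Instr.rarrays]))
  have hA0 : s.nmem 4 1 = 0 ↔ ¬ A.Nonempty := by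
    rcases hT.tree.root_left with ⟨h0, h⟩ | ⟨h1, -, -⟩
    · simp only [h0, true_iff]
      rintro ⟨x, hx⟩
      exact h x hx trivial
    · constructor
      · exact fun h => absurd (h ▸ h1) hT.tree.zero_notMem_A
      · exact fun h => absurd ⟨_, h1⟩ h
  refine Run.ite (by omega) (fun hc => ?_) fun hc => ?_
  · simp only [Test.Holds, e7, e1] at hc
    refine Run.instr (by omega) fun hP => hQ _ _ ?_ ?_ (fun h => absurd h (hA0.1 hc)) (hframe hP)
      (hcongr hP) (by omega)
    · simpa [Instr.effect, State.setN, e7] using hA0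
    · simp [Instr.effect, State.setN, e1]
  · simp only [Test.Holds, e7, e1] at hc
    have hne : A.Nonempty := not_not.1 fun h => hc (hA0.2 h)
    have hE₁ : Env K s₁ := hE.of_preserved (Exec.instr _ _ : Exec [] _ _ _ _).preserved
      (by decide) (by decide)
    refine Run.seq (descendProg_spec hE₁ (hT.tree.congr rfl rfl rfl rfl) hne (fun l => rfl) hU
      (by omega) fun s₂ m₂ h1 h2 h3 h4 h5 h6 hm₂ => ?_)
    refine Run.of_loopFree (by simp [block, Stmt.LoopFree]) ?_ ?_
    · simp [block, Stmt.steps]; omega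
    have hst : (block [.nload 8 11 20, .nadd 8 8 2]).steps = 2 := rfl
    have h32 : s₂.nreg 2 = 1 := (h3 2 (by norm_num)).trans hE₁.one
    have h511 : s₂.nmem 11 = s.nmem 11 := by rw [h5]; rfl
    rw [hst]
    refine fun hP => hQ _ _ ?_ (fun h => absurd hne h) (fun _ => ⟨s₂.nreg 20, h1, ?_, h2⟩)
      (hframe hP) (hcongr hP) (by omega)
    · simpa [block, Stmt.out, Instr.effect, State.setN, h3 7 (by norm_num), e7] using hA0
    · simp [block, Stmt.out, Instr.effect, State.setN, h32, h511]

/-- The processing of the point whose position by height is in register `4`. -/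
def sweepStep (outA : ℕ) : Stmt :=
  .seq (block [.nload 6 10 4, .nload 5 7 4, .rload 10 4 6, .rload 11 5 6]) <|
  .seq purgeProg <|
  .seq queryProg <|
  .seq (block [.nstore outA 5 8, .nload 9 0 5]) <|
  .seq (.ite (.neq 9 2) (.seq clearProg insertProg) (.ite (.neq 7 1) .skip insertProg)) <|
  .instr (.nadd 4 4 2)

/-- The value `v` is the successor of a nearest eligible point for the `j`-th point, or `0` if no
root precedes that point. -/
def OutOK (rt : ℕ → Prop) (ord : ℕ → ℕ) (xs ys : ℕ → ℝ) (j v : ℕ) : Prop :=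
  (v = 0 ∧ ¬ ∃ r < j, rt r) ∨ ∃ i, Elig rt i j ∧ v = ord i + 1 ∧
    ∀ i', Elig rt i' j → sqDist (xs j) (ys j) (xs i) (ys i) ≤ sqDist (xs j) (ys j) (xs i') (ys i')

/-- The query comes before the insertion, so the point is not its own candidate, and before the
clearing, so a root is still joined to the points since the previous root. The budget of the step
includes the potential of the one leaf that becomes active. -/
theorem sweepStep_spec {K n outA j m : ℕ} {ord pos site mark : ℕ → ℕ} {rt : ℕ → Prop}
    {xs ys X Y κ : ℕ → ℝ} {h : ℝ} {A B : Finset ℕ} {s : State} {Q : State → ℕ → Prop}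
    (hout : 12 ≤ outA) (hS : SweepMem K ord pos site mark X Y s) (hT : TreeKeys K A s B κ)
    (hD : SweepData K n pos xs ys X Y) (hA : SweepInv rt pos xs ys X Y j h A) (hj : j < n)
    (hh : h ≤ ys j) (hsite : ∀ i < n, site (pos i) = ord i) (hrt : ∀ j, rt j ↔ mark (ord j) = 1)
    (h4 : s.nreg 4 = j) (hm : (200 * K + 210) * A.card + (500 * K + 500) ≤ m)
    (hQ : ∀ s' m' A' B' κ', TreeKeys K A' s' B' κ' → SweepInv rt pos xs ys X Y (j + 1) (ys j) A' →
      s'.nreg 4 = j + 1 →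
      (∃ v, OutOK rt ord xs ys j v ∧ s'.nmem outA = Function.update (s.nmem outA) (ord j) v) →
      m + (200 * K + 210) * A'.card ≤ m' + (200 * K + 210) * A.card + (500 * K + 500) → Q s' m') :
    Run (sweepStep outA) s m Q := by
  obtain ⟨C, hC⟩ : ∃ C, C = 200 * K + 210 := ⟨_, rfl⟩
  rw [← hC] at hm hQ
  refine Run.seq (Run.of_loopFree (by simp [block, Stmt.LoopFree]) ?_ ?_)
  · simp [block, Stmt.steps]; omega
  have hst : (block [.nload 6 10 4, .nload 5 7 4, .rload 10 4 6, .rload 11 5 6]).steps = 4 := rfl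
  rw [hst]
  set s₁ := (block [.nload 6 10 4, .nload 5 7 4, .rload 10 4 6, .rload 11 5 6]).out s with hs₁
  have e6 : s₁.nreg 6 = pos j := by
    simp [hs₁, block, Stmt.out, Instr.effect, State.setN, State.setR, h4, hS.pos]
  have e5 : s₁.nreg 5 = ord j := by
    simp [hs₁, block, Stmt.out, Instr.effect, State.setN, State.setR, h4, hS.ord]
  have e10 : s₁.rreg 10 = xs j := by
    simp [hs₁, block, Stmt.out, Instr.effect, State.setN, State.setR, h4, hS.pos, hS.xs,
      hD.x_pos j hj]
  have e11 : s₁.rreg 11 = ys j := by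
    simp [hs₁, block, Stmt.out, Instr.effect, State.setN, State.setR, h4, hS.pos, hS.ys,
      hD.y_pos j hj]
  have hF₁ : Frame 5 s s₁ := .of_preserved
    (Preserved.of_loopFree (by simp [block, Stmt.LoopFree]) s) (by decide) (by decide) (by decide)
    (by decide)
  have hS₁ := hS.of_frame hF₁ (by norm_num)
  refine Run.seq (purgeProg_spec (h := ys j) hS₁.env (hT.congr rfl rfl) hS₁.xs hS₁.ys hD e11
    (hA.mono hh) hj.le (by rw [← hC]; omega) ?_)
  intro s₂ m₂ A₂ B₂ κ₂ hT₂ hB₂ hA₂ hF₂ h10 h11 hm₂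
  rw [← hC] at hm₂
  have hS₂ := hS₁.of_frame hF₂ (by norm_num)
  have e10' : s₂.rreg 10 = xs j := h10.trans e10
  have e11' : s₂.rreg 11 = ys j := h11.trans e11
  have hU := hA₂.unimodal hD hj rfl (by rw [← hS₂.xs, ← hS₂.ys]; exact hT₂.keys) hB₂ (xs j)
  refine Run.seq (queryProg_spec hS₂.env hT₂ (by rw [e10', e11', hS₂.xs, hS₂.ys]; exact hU)
    (by omega) ?_)
  rw [e10', e11', hS₂.xs, hS₂.ys, hS₂.site]
  intro s₃ m₃ e7 e8 e8' hF₃ hT₃ hm₃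
  have hS₃ := hS₂.of_frame hF₃ (by norm_num)
  have hF13 := hF₁.trans (hF₂.trans hF₃ (b := 5) (by norm_num) (by norm_num)) le_rfl le_rfl
  have hOut : OutOK rt ord xs ys j (s₃.nreg 8) := by
    by_cases hne : A₂.Nonempty
    · obtain ⟨v, hv, hv8, hmin⟩ := e8' hne
      obtain ⟨i, hi, rfl⟩ := hA₂.elig v hv
      have hin := hi.lt.trans hj
      refine Or.inr ⟨i, hi, by rw [hv8, hsite i hin], fun i' hi' => ?_⟩
      -- Domination turns a nearest active site into a nearest one among all eligible points,
      -- including those deleted.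
      obtain ⟨l, hl, hle⟩ := hA₂.dom i' hi' (xs j) (ys j) le_rfl
      have := (hmin l hl).trans hle
      rwa [hD.x_pos i hin, hD.y_pos i hin] at this
    · exact Or.inl ⟨e8 hne, fun h => hne (hA₂.exists_root_iff.1 h)⟩
  refine Run.seq (Run.of_loopFree (by simp [block, Stmt.LoopFree]) ?_ ?_)
  · simp [block, Stmt.steps]; omega
  have hst : (block [.nstore outA 5 8, .nload 9 0 5]).steps = 2 := rfl
  rw [hst]
  set s₄ := (block [.nstore outA 5 8, .nload 9 0 5]).out s₃ with hs₄
  have h5₃ : s₃.nreg 5 = ord j := by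
    rw [hF₃.nreg 5 (by norm_num), hF₂.nreg 5 (by norm_num), e5]
  have h6₃ : s₃.nreg 6 = pos j := by
    rw [hF₃.nreg 6 (by norm_num), hF₂.nreg 6 (by norm_num), e6]
  have hnm : ∀ r, r ≠ outA → s₄.nmem r = s₃.nmem r := fun r hr => by
    simp [hs₄, block, Stmt.out, Instr.effect, State.setN, State.putN, hr]
  have hnr : ∀ r, r ≠ 9 → s₄.nreg r = s₃.nreg r := fun r hr => by
    simp [hs₄, block, Stmt.out, Instr.effect, State.setN, State.putN, hr]
  have hrm : s₄.rmem = s₃.rmem := rfl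
  have o4 : s₄.nmem outA = Function.update (s.nmem outA) (ord j) (s₃.nreg 8) := by
    rw [← hF13.nmem outA (by omega) (by omega) (by omega)]
    simp [hs₄, block, Stmt.out, Instr.effect, State.setN, State.putN, h5₃]
  have h9 : s₄.nreg 9 = mark (ord j) := by
    have h0 : outA ≠ 0 := by omega
    simp [hs₄, block, Stmt.out, Instr.effect, State.setN, State.putN, h5₃, hS₃.mark, h0.symm]
  have hE₄ : Env K s₄ := ⟨(hnr 1 (by norm_num)).trans hS₃.env.zero,
    (hnr 2 (by norm_num)).trans hS₃.env.one, (hnr 3 (by norm_num)).trans hS₃.env.leaves,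
    fun v hv => by rw [hnm 3 (by omega), hS₃.env.parent v hv]⟩
  have hT₄ : TreeKeys K A₂ s₄ B₂ κ₂ := ⟨hT₃.tree.congr (hnm 4 (by omega)) (hnm 5 (by omega))
    (hnm 6 (by omega)) (by rw [hrm]), by rw [hrm]; exact hT₃.keys⟩
  have h4₄ : s₄.nreg 4 = j := by
    rw [hnr 4 (by norm_num), hF13.nreg 4 (by norm_num), h4]
  have h6₄ : s₄.nreg 6 = pos j := (hnr 6 (by norm_num)).trans h6₃
  have hpos1 := hD.pos_ge j hj
  have hpos2 := hD.pos_lt j hj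
  have hfin : ∀ s₅ m₅ A₅ B₅ κ₅, TreeKeys K A₅ s₅ B₅ κ₅ →
      SweepInv rt pos xs ys X Y (j + 1) (ys j) A₅ → Frame 5 s₄ s₅ → 1 ≤ m₅ →
      m + C * A₅.card ≤ m₅ - 1 + C * A.card + (500 * K + 500) →
      Run (.instr (.nadd 4 4 2)) s₅ m₅ Q := by
    intro s₅ m₅ A₅ B₅ κ₅ hT₅ hA₅ hF₅ h1 hm₅
    refine Run.instr h1 (hQ _ _ A₅ B₅ κ₅ (hT₅.congr rfl rfl) hA₅ ?_ ⟨s₃.nreg 8, hOut, ?_⟩ hm₅)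
    · simp [Instr.effect, State.setN, hF₅.nreg 4, h4₄, (hE₄.of_frame hF₅ (by norm_num)).one]
    · rw [← o4]
      exact hF₅.nmem outA (by omega) (by omega) (by omega)
  refine Run.seq (Run.ite (by omega) (fun hc => ?_) fun hc => ?_)
  · simp only [Test.Holds, h9, hE₄.one, ← hrt] at hc
    refine Run.seq (clearProg_spec hE₄ hT₄ (by rw [← hC]; omega) ?_)
    intro s₅ m₅ B₅ κ₅ hT₅ hF₅ hm₅
    rw [← hC] at hm₅
    refine insertProg_spec (hE₄.of_frame hF₅ (by norm_num)) hT₅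
      ((hF₅.nreg 6 (by norm_num)).trans h6₄) hpos1 hpos2 (by omega) ?_
    intro s₆ m₆ B₆ κ₆ hT₆ hF₆ hm₆
    refine hfin s₆ m₆ {pos j} B₆ κ₆ (by simpa using hT₆) (.succ_of_root hD hj hc)
      (hF₅.trans hF₆ (by norm_num) (by norm_num)) (by omega) ?_
    rw [Finset.card_singleton]
    omega
  · simp only [Test.Holds, h9, hE₄.one, ← hrt] at hc
    have hA₃ := hA₂.succ_of_not_root hD hj hc
    refine Run.ite (by omega) (fun hc' => ?_) fun hc' => ?_
    · simp only [Test.Holds, hE₄.zero, hnr 7 (by norm_num), e7] at hc'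
      rw [if_neg hc'] at hA₃
      exact Run.skip (by omega)
        (hfin s₄ _ A₂ B₂ κ₂ hT₄ hA₃ (Frame.refl _ _) (by omega) (by omega))
    · simp only [Test.Holds, hE₄.zero, hnr 7 (by norm_num), e7, not_not] at hc'
      rw [if_pos hc'] at hA₃
      refine insertProg_spec hE₄ hT₄ h6₄ hpos1 hpos2 (by omega) ?_
      intro s₆ m₆ B₆ κ₆ hT₆ hF₆ hm₆
      have hcard : C * (insert (pos j) A₂).card ≤ C * A₂.card + C := by
        rw [← Nat.mul_succ]
        exact Nat.mul_le_mul_left _ (Finset.card_insert_le _ _)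
      exact hfin s₆ m₆ _ B₆ κ₆ hT₆ hA₃ (Frame.trans hF₆ (Frame.refl 10 _) (by norm_num)
        (by norm_num)) (by omega) (by omega)

theorem sweepStep_narrays (outA : ℕ) :
    ∀ r ∈ (sweepStep outA).collect Instr.narrays, r = 4 ∨ r = 5 ∨ r = 6 ∨ r = outA := by
  -- The output array is a parameter, so the list is not closed. It is decided for the value `4`,
  -- which adds no new array, and the general case differs only by `outA`.
  have h : ∀ r ∈ (sweepStep 4).collect Instr.narrays, r = 4 ∨ r = 5 ∨ r = 6 := by decide
  have h2 : ∀ r ∈ (sweepStep outA).collect Instr.narrays,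
      r = outA ∨ r ∈ (sweepStep 4).collect Instr.narrays := by
    intro r hr
    simp only [sweepStep, Stmt.collect, block, Instr.narrays, List.mem_append] at hr ⊢
    simp only [List.mem_singleton, List.not_mem_nil, false_or, or_false] at hr ⊢
    tauto
  intro r hr
  rcases h2 r hr with h3 | h3
  · exact Or.inr (Or.inr (Or.inr h3))
  · have := h r h3
    tauto

theorem toggleProg_nregs : ∀ r ∈ toggleProg.collect Instr.nregs, 4 ≤ r := by decide

theorem sweepStep_nregs (outA : ℕ) : ∀ r ∈ (sweepStep outA).collect Instr.nregs, 4 ≤ r := by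
  have h1 := toggleProg_nregs
  have h2 : ∀ r ∈ queryProg.collect Instr.nregs, 4 ≤ r := by decide
  have h3 : ∀ r ∈ purgeHead.collect Instr.nregs, 4 ≤ r := by decide
  intro r hr
  simp only [sweepStep, purgeProg, clearProg, insertProg, Stmt.collect, block, Instr.nregs,
    List.mem_append, List.mem_singleton, List.not_mem_nil, false_or, or_false] at hr
  have := h1 r
  have := h2 r
  have := h3 r
  by_cases c1 : r ∈ toggleProg.collect Instr.nregs
  · exact h1 r c1
  by_cases c2 : r ∈ queryProg.collect Instr.nregs
  · exact h2 r c2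
  by_cases c3 : r ∈ purgeHead.collect Instr.nregs
  · exact h3 r c3
  simp only [c1, c2, c3, false_or, or_false] at hr
  omega

theorem sweepStep_rarrays (outA : ℕ) : ∀ r ∈ (sweepStep outA).collect Instr.rarrays, r = 3 := by
  show ∀ r ∈ (sweepStep 0).collect Instr.rarrays, r = 3
  decide

theorem SweepMem.of_preserved {K outA : ℕ} {ord pos site mark : ℕ → ℕ} {X Y : ℕ → ℝ} {S : Stmt}
    {s s' : State} (h : SweepMem K ord pos site mark X Y s) (hP : Preserved S s s')
    (h1 : ∀ r ∈ S.collect Instr.nregs, 4 ≤ r)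
    (h2 : ∀ r ∈ S.collect Instr.narrays, r = 4 ∨ r = 5 ∨ r = 6 ∨ r = outA) (hout : 12 ≤ outA)
    (h3 : ∀ r ∈ S.collect Instr.rarrays, r = 3) : SweepMem K ord pos site mark X Y s' := by
  have hn : ∀ r, r ≠ 4 → r ≠ 5 → r ≠ 6 → r < 12 → s'.nmem r = s.nmem r := fun r h4 h5 h6 hr =>
    hP.nmem r fun h => by have := h2 r h; omega
  have hr : ∀ r, r ≠ 3 → s'.rmem r = s.rmem r := fun r h' => hP.rmem r fun h => h' (h3 r h)
  refine ⟨h.env.of_preserved hP h1 fun h => by have := h2 3 h; omega, ?_, ?_, ?_, ?_, ?_, ?_⟩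
  · rw [hn 7 (by norm_num) (by norm_num) (by norm_num) (by norm_num), h.ord]
  · rw [hn 10 (by norm_num) (by norm_num) (by norm_num) (by norm_num), h.pos]
  · rw [hn 11 (by norm_num) (by norm_num) (by norm_num) (by norm_num), h.site]
  · rw [hn 0 (by norm_num) (by norm_num) (by norm_num) (by norm_num), h.mark]
  · rw [hr 4 (by norm_num), h.xs]
  · rw [hr 5 (by norm_num), h.ys]

/-- Sweeps over all points. -/
def sweepProg (outA : ℕ) : Stmt :=
  .seq (.instr (.nconst 4 0)) <| .seq (.loop (.nlt 4 0) (sweepStep outA)) clearProg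

theorem clearProg_narrays : ∀ r ∈ clearProg.collect Instr.narrays, r = 4 ∨ r = 5 ∨ r = 6 := by
  decide

theorem sweepProg_narrays (outA : ℕ) :
    ∀ r ∈ (sweepProg outA).collect Instr.narrays, r = 4 ∨ r = 5 ∨ r = 6 ∨ r = outA := by
  intro r hr
  simp only [sweepProg, Stmt.collect, Instr.narrays, List.mem_append, List.not_mem_nil,
    false_or] at hr
  rcases hr with hr | hr
  · exact sweepStep_narrays outA r hr
  · have := clearProg_narrays r hr
    tauto

theorem sweepProg_nregs (outA : ℕ) : ∀ r ∈ (sweepProg outA).collect Instr.nregs, 4 ≤ r := by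
  intro r hr
  simp only [sweepProg, clearProg, Stmt.collect, Instr.nregs, List.mem_append,
    List.mem_singleton] at hr
  have h1 := sweepStep_nregs outA r
  have h2 := toggleProg_nregs r
  by_cases c1 : r ∈ (sweepStep outA).collect Instr.nregs
  · exact h1 c1
  by_cases c2 : r ∈ toggleProg.collect Instr.nregs
  · exact h2 c2
  simp only [c1, c2, false_or] at hr
  omega

theorem sweepProg_rarrays (outA : ℕ) : ∀ r ∈ (sweepProg outA).collect Instr.rarrays, r = 3 := by
  show ∀ r ∈ (sweepProg 0).collect Instr.rarrays, r = 3
  decide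

/-- The potentials telescope over the points, which leaves `500 * K + 501` credits for each. The
closing `clearProg` hands back an empty tree, as the next pass requires. -/
theorem sweepProg_spec {K n outA m : ℕ} {ord pos site mark : ℕ → ℕ} {rt : ℕ → Prop}
    {xs ys X Y : ℕ → ℝ} {s : State} {Q : State → ℕ → Prop}
    (hout : 12 ≤ outA) (hS : SweepMem K ord pos site mark X Y s)
    (hT : ∀ κ, TreeInv K ∅ ∅ κ 0 s) (hD : SweepData K n pos xs ys X Y) (hn : s.nreg 0 = n)
    (hsite : ∀ i < n, site (pos i) = ord i) (hrt : ∀ j, rt j ↔ mark (ord j) = 1)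
    (hord : ∀ i j, i < j → j < n → ord i ≠ ord j)
    (hm : n * (500 * K + 501) + 20 ≤ m)
    (hQ : ∀ s' m', (∀ κ, TreeInv K ∅ ∅ κ 0 s') → (∀ j < n, OutOK rt ord xs ys j
      (s'.nmem outA (ord j))) → Preserved (sweepProg outA) s s' →
      m ≤ m' + n * (500 * K + 501) + 20 → Q s' m') :
    Run (sweepProg outA) s m Q := by
  obtain ⟨C, hC⟩ : ∃ C, 200 * K + 210 = C := ⟨_, rfl⟩
  obtain ⟨D, hD'⟩ : ∃ D, 500 * K + 500 = D := ⟨_, rfl⟩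
  have hD'' : 500 * K + 501 = D + 1 := congrArg (· + 1) hD'
  rw [hD''] at hm hQ
  refine Run.preserving (Run.seq (Run.instr (by omega) (Run.seq ?_)))
  set s₀ := (Instr.nconst 4 0).effect s with hs₀
  have hS₀ : SweepMem K ord pos site mark X Y s₀ :=
    hS.of_preserved (outA := 12) (Exec.instr _ _ : Exec [] _ _ _ _).preserved (by decide)
      (by decide) le_rfl (by decide)
  refine Run.loop (fun s' m' => ∃ j ≤ n, ∃ A B κ h, s'.nreg 4 = j ∧ TreeKeys K A s' B κ ∧
    SweepInv rt pos xs ys X Y j h A ∧ (j < n → h ≤ ys j) ∧ SweepMem K ord pos site mark X Y s' ∧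
    s'.nreg 0 = n ∧ (∀ i < j, OutOK rt ord xs ys i (s'.nmem outA (ord i))) ∧
    m + C * A.card ≤ m' + 1 + j * (D + 1)) ?_ ?_ ?_
  · rintro s₁ m₁ ⟨j, hj, A, B, κ, h, h4, hT₁, hA, hh, hS₁, hn₁, hO, hm₁⟩ hlt
    simp only [Test.Holds, h4, hn₁] at hlt
    have h1 : (j + 1) * (D + 1) ≤ n * (D + 1) := Nat.mul_le_mul_right _ hlt
    rw [Nat.add_mul] at h1
    refine ⟨by omega, ?_⟩
    apply Run.preserving
    refine sweepStep_spec hout hS₁ hT₁ hD hA hlt (hh hlt) hsite hrt h4 ?_ ?_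
    · rw [hC, hD']
      omega
    intro s₂ m₂ A₂ B₂ κ₂ hT₂ hA₂ h4₂ ⟨v, hv, hv'⟩ hm₂ hP
    rw [hC, hD'] at hm₂
    refine ⟨j + 1, hlt, A₂, B₂, κ₂, ys j, h4₂, hT₂, hA₂, fun h => (hD.ys_lt j _ (by omega) h).le,
      hS₁.of_preserved hP (sweepStep_nregs outA) (sweepStep_narrays outA) hout
      (sweepStep_rarrays outA),
      (hP.nreg 0 fun h => absurd (sweepStep_nregs outA 0 h) (by norm_num)).trans hn₁,
      fun i hi => ?_, ?_⟩
    · rw [hv']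
      rcases (Nat.lt_succ_iff.1 hi).eq_or_lt with rfl | hij
      · rwa [Function.update_self]
      · rw [Function.update_of_ne (hord i j hij hlt)]
        exact hO i hij
    · rw [Nat.add_mul]
      omega
  · rintro s₁ m₁ ⟨j, hj, A, B, κ, h, h4, hT₁, hA, hh, hS₁, hn₁, hO, hm₁⟩ hlt
    simp only [Test.Holds, h4, hn₁] at hlt
    obtain rfl : j = n := by omega
    refine ⟨by omega, clearProg_spec hS₁.env hT₁ (by
      rw [hC]
      omega) ?_⟩
    intro s₂ m₂ B₂ κ₂ hT₂ hF₂ hm₂ hP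
    rw [hC] at hm₂
    have hB : B₂ = ∅ := Finset.eq_empty_of_forall_notMem fun b hb => by
      obtain ⟨a, c, hc, -⟩ := (hT₂.keys b).mem_iff.1 hb
      exact absurd hc.memB (Finset.notMem_empty b)
    subst hB
    refine hQ s₂ m₂ (fun κ => hT₂.tree.of_empty κ) (fun i hi => ?_) hP (by omega)
    rw [hF₂.nmem outA (by omega) (by omega) (by omega)]
    exact hO i hi
  · refine ⟨0, Nat.zero_le _, ∅, ∅, fun _ => 0, ys 0, by simp [hs₀, Instr.effect, State.setN],
      ⟨(hT _).congr rfl rfl rfl rfl, fun b => ⟨⟨fun h => absurd h (Finset.notMem_empty b),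
        fun ⟨a, c, hc, _⟩ => absurd hc.memB (Finset.notMem_empty b)⟩,
        fun a c hc _ => absurd hc.memB (Finset.notMem_empty b)⟩⟩,
      ⟨fun l hl => absurd hl (Finset.notMem_empty l), fun i hi => by have := hi.lt; omega⟩,
      fun _ => le_rfl, hS₀, by simp [hs₀, Instr.effect, State.setN, hn], by simp, by simp; omega⟩

/-! ### From the sweep order back to heights and point numbers -/

/-- The height of the `w`-th point is below that of the `u`-th one, but not below that of any root
that is below the `u`-th point. -/
def EligibleAt (n : ℕ) (mark : ℕ → ℕ) (py : ℕ → ℝ) (u w : ℕ) : Prop :=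
  py w < py u ∧ ∀ r < n, mark r = 1 → py r < py u → py r ≤ py w

/-- The value `v` is one plus the number of a nearest eligible point, or zero if no root is below
the `u`-th point. -/
def IsNearestCode (n : ℕ) (mark : ℕ → ℕ) (px py : ℕ → ℝ) (u v : ℕ) : Prop :=
  (v = 0 ∧ ¬ ∃ r < n, mark r = 1 ∧ py r < py u) ∨
    ∃ w < n, v = w + 1 ∧ EligibleAt n mark py u w ∧ (∃ r < n, mark r = 1 ∧ py r < py u) ∧
      ∀ w' < n, EligibleAt n mark py u w' →
        sqDist (px u) (py u) (px w) (py w) ≤ sqDist (px u) (py u) (px w') (py w')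

theorem IsSorting.lt_of_injOn {n : ℕ} {py : ℕ → ℝ} {ord : ℕ → ℕ} (h : IsSorting n py ord)
    (hinj : ∀ i < n, ∀ j < n, py i = py j → i = j) {i j : ℕ} (hij : i < j) (hj : j < n) :
    py (ord i) < py (ord j) := by
  rcases h.keyLt i j hij hj with h' | ⟨h', h''⟩
  · exact h'
  · exact absurd (hinj _ (h.lt i (hij.trans hj)) _ (h.lt j hj) h') h''.ne

theorem IsSorting.lt_iff {n : ℕ} {py : ℕ → ℝ} {ord : ℕ → ℕ} (h : IsSorting n py ord)
    (hinj : ∀ i < n, ∀ j < n, py i = py j → i = j) {i j : ℕ} (hi : i < n) (hj : j < n) :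
    py (ord i) < py (ord j) ↔ i < j := by
  refine ⟨fun h' => ?_, fun h' => h.lt_of_injOn hinj h' hj⟩
  by_contra hc
  rcases (not_lt.1 hc).eq_or_lt with rfl | hc
  · exact lt_irrefl _ h'
  · exact lt_asymm h' (h.lt_of_injOn hinj hc hi)

/-- `Elig` requires a root at or before the candidate, while `EligibleAt` is vacuous in the absence
of lower roots; the two agree once some root precedes `j`. -/
theorem IsSorting.elig_iff {n : ℕ} {mark : ℕ → ℕ} {py : ℕ → ℝ} {ord : ℕ → ℕ}
    (h : IsSorting n py ord) (hinj : ∀ i < n, ∀ j < n, py i = py j → i = j) {i j : ℕ} (hi : i < n)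
    (hj : j < n) (hr : ∃ r < j, mark (ord r) = 1) :
    Elig (fun r => mark (ord r) = 1) i j ↔ EligibleAt n mark py (ord j) (ord i) := by
  constructor
  · intro he
    refine ⟨h.lt_of_injOn hinj he.lt hj, fun r hr hm hlt => ?_⟩
    obtain ⟨t, ht, rfl⟩ := h.exists_eq hr
    rcases (he.le t ((h.lt_iff hinj ht hj).1 hlt) hm).eq_or_lt with rfl | hti
    · exact le_rfl
    · exact (h.lt_of_injOn hinj hti hi).le
  · intro he
    have hle : ∀ r < j, mark (ord r) = 1 → r ≤ i := fun r hrj hm => by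
      by_contra hc
      exact absurd (he.2 (ord r) (h.lt r (hrj.trans hj)) hm (h.lt_of_injOn hinj hrj hj))
        (not_le.2 (h.lt_of_injOn hinj (not_le.1 hc) (hrj.trans hj)))
    obtain ⟨r, hrj, hm⟩ := hr
    exact ⟨(h.lt_iff hinj hi hj).1 he.1, ⟨r, hle r hrj hm, hm⟩, hle⟩

theorem OutOK.isNearestCode {n : ℕ} {mark : ℕ → ℕ} {px py : ℕ → ℝ} {ord : ℕ → ℕ}
    (h : IsSorting n py ord) (hinj : ∀ i < n, ∀ j < n, py i = py j → i = j) {j v : ℕ} (hj : j < n)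
    (hO : OutOK (fun r => mark (ord r) = 1) ord (fun i => px (ord i)) (fun i => py (ord i)) j v) :
    IsNearestCode n mark px py (ord j) v := by
  rcases hO with ⟨rfl, hno⟩ | ⟨i, hi, rfl, hmin⟩
  · refine Or.inl ⟨rfl, fun ⟨r, hr, hm, hlt⟩ => hno ?_⟩
    obtain ⟨t, ht, rfl⟩ := h.exists_eq hr
    exact ⟨t, (h.lt_iff hinj ht hj).1 hlt, hm⟩
  · have hin : i < n := hi.lt.trans hj
    have hr : ∃ r < j, mark (ord r) = 1 := by
      obtain ⟨r, hri, hm⟩ := hi.exists_root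
      exact ⟨r, hri.trans_lt hi.lt, hm⟩
    refine Or.inr ⟨ord i, h.lt i hin, rfl, (h.elig_iff hinj hin hj hr).1 hi, ?_, ?_⟩
    · obtain ⟨r, hrj, hm⟩ := hr
      exact ⟨ord r, h.lt r (hrj.trans hj), hm, h.lt_of_injOn hinj hrj hj⟩
    · intro w' hw' he
      obtain ⟨t, ht, rfl⟩ := h.exists_eq hw'
      exact hmin t ((h.elig_iff hinj ht hj hr).2 he)

/-- Assigns leaf `t` to the `t`-th point from the left. -/
def posStep : List Instr :=
  [.nload 5 8 4, .nadd 6 3 4, .nstore 10 5 6, .nload 7 7 5, .nstore 11 6 7, .rload 0 0 7,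
    .rstore 4 6 0, .rload 0 2 7, .rstore 5 6 0, .nadd 4 4 2]

/-- Assigns the points to leaves, from left to right. -/
def posProg : Stmt :=
  .seq (.instr (.nconst 4 0)) <| .loop (.nlt 4 0) (block posStep)

theorem posProg_spec {K n m : ℕ} {s : State} {Q : State → ℕ → Prop} (hE : Env K s)
    (hn : s.nreg 0 = n) (hinj : ∀ i < n, ∀ j < n, s.nmem 8 i = s.nmem 8 j → i = j)
    (hm : n * 11 + 2 ≤ m)
    (hQ : ∀ s' m', (∀ t < n, s'.nmem 10 (s.nmem 8 t) = 2 ^ K + t ∧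
      s'.nmem 11 (2 ^ K + t) = s.nmem 7 (s.nmem 8 t) ∧
      s'.rmem 4 (2 ^ K + t) = s.rmem 0 (s.nmem 7 (s.nmem 8 t)) ∧
      s'.rmem 5 (2 ^ K + t) = s.rmem 2 (s.nmem 7 (s.nmem 8 t))) → Preserved posProg s s' →
      m ≤ m' + n * 11 + 2 → Q s' m') :
    Run posProg s m Q := by
  refine Run.preserving (Run.seq (Run.instr (by omega) ?_))
  set s₁ := (Instr.nconst 4 0).effect s with hs₁
  have hE₁ : Env K s₁ := hE.of_preserved (Exec.instr _ _ : Exec [] _ _ _ _).preserved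
    (by decide) (by decide)
  refine Run.forLoop (n := n) (c := 10)
    (fun j s' => s'.nreg 4 = j ∧ ∀ t < j, s'.nmem 10 (s.nmem 8 t) = 2 ^ K + t ∧
      s'.nmem 11 (2 ^ K + t) = s.nmem 7 (s.nmem 8 t) ∧
      s'.rmem 4 (2 ^ K + t) = s.rmem 0 (s.nmem 7 (s.nmem 8 t)) ∧
      s'.rmem 5 (2 ^ K + t) = s.rmem 2 (s.nmem 7 (s.nmem 8 t)))
    (by simp [hs₁, Instr.effect, State.setN, hn]) (by decide) (fun _ _ h => h.1)
    ⟨by simp [hs₁, Instr.effect, State.setN], by simp⟩ (by omega) ?_ ?_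
  · rintro j s' m' hj ⟨h4, hI⟩ hP hm'
    have hE' : Env K s' := hE₁.of_preserved hP (by decide) (by decide)
    have h8 : s'.nmem 8 = s.nmem 8 := hP.nmem 8 (by decide)
    have h7 : s'.nmem 7 = s.nmem 7 := hP.nmem 7 (by decide)
    have h0 : s'.rmem 0 = s.rmem 0 := hP.rmem 0 (by decide)
    have h2 : s'.rmem 2 = s.rmem 2 := hP.rmem 2 (by decide)
    refine Run.of_loopFree (by simp [block, posStep, Stmt.LoopFree]) ?_ ?_
    · simp [block, posStep, Stmt.steps]; omega
    have hsteps : (block posStep).steps = 10 := rfl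
    rw [hsteps]
    set s₂ := (block posStep).out s' with hs₂
    have e4 : s₂.nreg 4 = j + 1 := by
      simp [hs₂, posStep, block, Stmt.out, Instr.effect, State.setN, State.setR, State.putN,
        State.putR, hE'.one, h4]
    have e10 : s₂.nmem 10 = Function.update (s'.nmem 10) (s.nmem 8 j) (2 ^ K + j) := by
      simp [hs₂, posStep, block, Stmt.out, Instr.effect, State.setN, State.setR, State.putN,
        State.putR, hE'.leaves, h4, h8]
    have e11 : s₂.nmem 11 =
        Function.update (s'.nmem 11) (2 ^ K + j) (s.nmem 7 (s.nmem 8 j)) := by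
      simp [hs₂, posStep, block, Stmt.out, Instr.effect, State.setN, State.setR, State.putN,
        State.putR, hE'.leaves, h4, h8, h7]
    have er4 : s₂.rmem 4 =
        Function.update (s'.rmem 4) (2 ^ K + j) (s.rmem 0 (s.nmem 7 (s.nmem 8 j))) := by
      simp [hs₂, posStep, block, Stmt.out, Instr.effect, State.setN, State.setR, State.putN,
        State.putR, hE'.leaves, h4, h8, h7, h0]
    have er5 : s₂.rmem 5 =
        Function.update (s'.rmem 5) (2 ^ K + j) (s.rmem 2 (s.nmem 7 (s.nmem 8 j))) := by
      simp [hs₂, posStep, block, Stmt.out, Instr.effect, State.setN, State.setR, State.putN,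
        State.putR, hE'.leaves, h4, h8, h7, h2]
    refine ⟨⟨e4, fun t ht => ?_⟩, le_rfl⟩
    rw [e10, e11, er4, er5]
    rcases (Nat.lt_succ_iff.1 ht).eq_or_lt with rfl | htj
    · simp
    · have hne : s.nmem 8 t ≠ s.nmem 8 j := fun h =>
        htj.ne (hinj t (htj.trans hj) j hj h)
      have hne' : 2 ^ K + t ≠ 2 ^ K + j := by omega
      rw [Function.update_of_ne hne, Function.update_of_ne hne', Function.update_of_ne hne',
        Function.update_of_ne hne']
      exact hI t htj
  · intro s' m' hI hP hm' hP'
    exact hQ s' m' hI.2 hP' (by omega)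

/-- Finds the nearest eligible points for the heights in real array `2`. -/
def passProg (outA : ℕ) : Stmt :=
  .seq (sortProg 9 2 7) <| .seq (sortProg 7 0 8) <| .seq posProg <| sweepProg outA

theorem passProg_nregs (outA : ℕ) : ∀ r ∈ (passProg outA).collect Instr.nregs, 4 ≤ r := by
  intro r hr
  simp only [passProg, Stmt.collect, List.mem_append] at hr
  rcases hr with hr | hr | hr | hr
  · exact nregs_sortProg _ _ _ r hr
  · exact nregs_sortProg _ _ _ r hr
  · revert r; decide
  · exact sweepProg_nregs outA r hr

theorem passProg_narrays (outA : ℕ) : ∀ r ∈ (passProg outA).collect Instr.narrays,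
    (4 ≤ r ∧ r ≤ 8) ∨ r = 10 ∨ r = 11 ∨ r = outA := by
  intro r hr
  simp only [passProg, Stmt.collect, List.mem_append] at hr
  rcases hr with hr | hr | hr | hr
  · have := narrays_sortProg _ _ _ r hr
    omega
  · have := narrays_sortProg _ _ _ r hr
    omega
  · have : (4 ≤ r ∧ r ≤ 8) ∨ r = 10 ∨ r = 11 := by revert r; decide
    omega
  · have := sweepProg_narrays outA r hr
    omega

theorem passProg_rarrays (outA : ℕ) : ∀ r ∈ (passProg outA).collect Instr.rarrays,
    3 ≤ r ∧ r ≤ 5 := by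
  intro r hr
  simp only [passProg, Stmt.collect, List.mem_append] at hr
  rcases hr with hr | hr | hr | hr
  · have := rarrays_sortProg _ _ _ r hr
    omega
  · have := rarrays_sortProg _ _ _ r hr
    omega
  · revert r; decide
  · have := sweepProg_rarrays outA r hr
    omega

/-- The second sort, by `x`, receives the points in the order of height, so its ties are resolved by
height and the leaves are in lexicographic order. Per point, two sorts cost `200 * K + 200`, the
assignment of leaves `11` and the sweep `500 * K + 501`. -/
theorem passProg_spec {K n outA m : ℕ} {s : State} {Q : State → ℕ → Prop} (hout : 12 ≤ outA)
    (hE : Env K s) (hT : ∀ κ, TreeInv K ∅ ∅ κ 0 s) (hn : s.nreg 0 = n) (hnK : n ≤ 2 ^ K)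
    (hid : ∀ i < n, s.nmem 9 i = i) (hinj : ∀ i < n, ∀ j < n, s.rmem 2 i = s.rmem 2 j → i = j)
    (hm : n * (700 * K + 712) + 50 ≤ m)
    (hQ : ∀ s' m', (∀ κ, TreeInv K ∅ ∅ κ 0 s') →
      (∀ u < n, IsNearestCode n (s.nmem 0) (s.rmem 0) (s.rmem 2) u (s'.nmem outA u)) →
      Preserved (passProg outA) s s' → m ≤ m' + n * (700 * K + 712) + 50 → Q s' m') :
    Run (passProg outA) s m Q := by
  have hmul : ∀ a b, n * (a * K + b) = a * (n * K) + b * n := fun a b => by ring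
  rw [hmul] at hm hQ
  have hnn : ∀ {S : Stmt} {s s' : State}, (∀ r ∈ S.collect Instr.nregs, 4 ≤ r) →
      Preserved S s s' → s'.nreg 0 = s.nreg 0 := fun h hP =>
    hP.nreg 0 fun h' => absurd (h 0 h') (by norm_num)
  refine Run.preserving (Run.seq (sortProg_spec hE (hT fun _ => 0) hn hnK (by norm_num)
    (by norm_num) (by norm_num) (by rw [hmul]; omega) ?_))
  intro s₁ m₁ hT₁ hs₁ hP₁ hm₁
  rw [hmul] at hm₁
  have ha₁ : ∀ a, a ≠ 4 → a ≠ 5 → a ≠ 6 → a ≠ 7 → s₁.nmem a = s.nmem a := fun a h4 h5 h6 h7 =>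
    hP₁.nmem a fun h => by have := narrays_sortProg _ _ _ a h; omega
  have hr₁ : ∀ a, a ≠ 3 → s₁.rmem a = s.rmem a := fun a h3 =>
    hP₁.rmem a fun h => h3 (rarrays_sortProg _ _ _ a h)
  have hE₁ : Env K s₁ := hE.of_preserved hP₁ (nregs_sortProg _ _ _) fun h => by
    have := narrays_sortProg _ _ _ 3 h; omega
  have hn₁ : s₁.nreg 0 = n := (hnn (nregs_sortProg _ _ _) hP₁).trans hn
  set ord := s₁.nmem 7 with hord
  have hsort : IsSorting n (s.rmem 2) ord := by
    refine ⟨hs₁.lt, fun i j hij hj => ?_⟩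
    have := hs₁.keyLt i j hij hj
    simpa only [KeyLt, hid _ (hs₁.lt i (hij.trans hj)), hid _ (hs₁.lt j hj)] using this
  refine Run.seq (sortProg_spec hE₁ (hT₁ fun _ => 0) hn₁ hnK (by norm_num)
    (by norm_num) (by norm_num) (by rw [hmul]; omega) ?_)
  intro s₂ m₂ hT₂ hs₂ hP₂ hm₂
  rw [hmul] at hm₂
  have ha₂ : ∀ a, a ≠ 4 → a ≠ 5 → a ≠ 6 → a ≠ 8 → s₂.nmem a = s₁.nmem a := fun a h4 h5 h6 h7 =>
    hP₂.nmem a fun h => by have := narrays_sortProg _ _ _ a h; omega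
  have hr₂ : ∀ a, a ≠ 3 → s₂.rmem a = s₁.rmem a := fun a h3 =>
    hP₂.rmem a fun h => h3 (rarrays_sortProg _ _ _ a h)
  have hE₂ : Env K s₂ := hE₁.of_preserved hP₂ (nregs_sortProg _ _ _) fun h => by
    have := narrays_sortProg _ _ _ 3 h; omega
  have hn₂ : s₂.nreg 0 = n := (hnn (nregs_sortProg _ _ _) hP₂).trans hn₁
  have e7 : s₂.nmem 7 = ord := ha₂ 7 (by norm_num) (by norm_num) (by norm_num) (by norm_num)
  have e0 : s₂.rmem 0 = s.rmem 0 := (hr₂ 0 (by norm_num)).trans (hr₁ 0 (by norm_num))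
  have e2 : s₂.rmem 2 = s.rmem 2 := (hr₂ 2 (by norm_num)).trans (hr₁ 2 (by norm_num))
  rw [hr₁ 0 (by norm_num), ← hord] at hs₂
  refine Run.seq (posProg_spec hE₂ hn₂ (fun i hi j hj h => hs₂.injOn hi hj h) (by omega) ?_)
  intro s₃ m₃ hpos hP₃ hm₃
  rw [e7, e0, e2] at hpos
  set xo := s₂.nmem 8 with hxo
  have hE₃ : Env K s₃ := hE₂.of_preserved hP₃ (by decide) (by decide)
  have hn₃ : s₃.nreg 0 = n := (hP₃.nreg 0 (by decide)).trans hn₂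
  have hT₃ : ∀ κ, TreeInv K ∅ ∅ κ 0 s₃ := fun κ => (hT₂ κ).congr (hP₃.nmem 4 (by decide))
    (hP₃.nmem 5 (by decide)) (hP₃.nmem 6 (by decide)) (hP₃.rmem 3 (by decide))
  have hx : ∀ j < n, ∃ t < n, xo t = j ∧ s₃.nmem 10 j = 2 ^ K + t := fun j hj => by
    obtain ⟨t, ht, rfl⟩ := hs₂.exists_eq hj
    exact ⟨t, ht, rfl, (hpos t ht).1⟩
  have hmark : s₃.nmem 0 = s.nmem 0 := ((hP₃.nmem 0 (by decide)).trans
    (ha₂ 0 (by norm_num) (by norm_num) (by norm_num) (by norm_num))).trans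
    (ha₁ 0 (by norm_num) (by norm_num) (by norm_num) (by norm_num))
  have hD : SweepData K n (s₃.nmem 10) (fun i => s.rmem 0 (ord i)) (fun i => s.rmem 2 (ord i))
      (s₃.rmem 4) (s₃.rmem 5) := by
    refine ⟨fun j hj => ?_, fun j hj => ?_, fun j hj => ?_, fun j hj => ?_,
      fun i j hij hj => hsort.lt_of_injOn hinj hij hj, fun i j hi hj hij => ?_⟩
    · obtain ⟨t, ht, rfl, h10⟩ := hx j hj
      omega
    · obtain ⟨t, ht, rfl, h10⟩ := hx j hj
      omega
    · obtain ⟨t, ht, rfl, h10⟩ := hx j hj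
      rw [h10, (hpos t ht).2.2.1]
    · obtain ⟨t, ht, rfl, h10⟩ := hx j hj
      rw [h10, (hpos t ht).2.2.2]
    · obtain ⟨t, ht, rfl, h10⟩ := hx i hi
      obtain ⟨t', ht', rfl, h10'⟩ := hx j hj
      rw [h10, h10'] at hij
      rcases hs₂.keyLt t t' (by omega) ht' with h | ⟨h, h'⟩
      · exact Or.inl h
      · exact Or.inr ⟨h, hsort.lt_of_injOn hinj h' hj⟩
  refine sweepProg_spec (ord := ord) (mark := s.nmem 0) (rt := fun j => s.nmem 0 (ord j) = 1)
    hout ⟨hE₃, (hP₃.nmem 7 (by decide)).trans e7, rfl, rfl, hmark, rfl, rfl⟩ hT₃ hD hn₃ ?_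
    (fun _ => Iff.rfl) (fun i j hij hj h => hij.ne (hsort.injOn (hij.trans hj) hj h)) (by rw [hmul]; omega) ?_
  · intro i hi
    obtain ⟨t, ht, rfl, h10⟩ := hx i hi
    rw [h10, (hpos t ht).2.1]
  · intro s₄ m₄ hT₄ hO hP₄ hm₄ hP
    rw [hmul] at hm₄
    refine hQ s₄ m₄ hT₄ (fun u hu => ?_) hP (by omega)
    obtain ⟨j, hj, rfl⟩ := hsort.exists_eq hu
    exact (hO j hj).isNearestCode hsort hinj hj

/-! ## Encoding of the edges -/

section Codes

variable {k : ℕ} {P : RootedPointSet k}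

/-- The point whose number is `v - 1`, and `u` itself if there is none. -/
noncomputable def decodePoint (p : Fin P.size ≃ {p : Plane // p ∈ P.points}) (D : ℕ → ℕ)
    (u : {p : Plane // p ∈ P.points}) : {p : Plane // p ∈ P.points} :=
  if h : D (p.symm u) - 1 < P.size then p ⟨D (p.symm u) - 1, h⟩ else u

/-- The numbers `D` encode nearest eligible points with respect to the heights `ε * y`. -/
structure IsCode (p : Fin P.size ≃ {p : Plane // p ∈ P.points}) (ε : ℝ) (D : ℕ → ℕ) : Prop where
  pos_iff : ∀ u : Fin P.size, D u ≠ 0 ↔ HasLowerRoot (signedHeight ε) IsRoot (p u)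
  lt : ∀ u : Fin P.size, D u - 1 < P.size
  nearest : IsNearestEligible (signedHeight ε) IsRoot (decodePoint p D)

theorem decodePoint_apply {p : Fin P.size ≃ {p : Plane // p ∈ P.points}} {D : ℕ → ℕ}
    {u v : Fin P.size} (h : D u = v + 1) : decodePoint p D (p u) = p v := by
  simp [decodePoint, h]

theorem dist_eq_sqrt_sqDist {ε : ℝ} (hε : ε = 1 ∨ ε = -1) (u v : Plane) :
    dist u v = √(sqDist (xCoord u) (ε * yCoord u) (xCoord v) (ε * yCoord v)) := by
  rw [EuclideanSpace.dist_eq, Fin.sum_univ_two, Real.dist_eq, Real.dist_eq, sq_abs, sq_abs]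
  congr 1
  have : ε * ε = 1 := by rcases hε with rfl | rfl <;> norm_num
  simp only [sqDist, xCoord, yCoord]
  linear_combination (-(u 1 - v 1) ^ 2) * this

theorem IsCode.of_isNearestCode {p : Fin P.size ≃ {p : Plane // p ∈ P.points}} {ε : ℝ}
    {D mark : ℕ → ℕ} {px py : ℕ → ℝ} (hε : ε = 1 ∨ ε = -1)
    (hmark : ∀ i : Fin P.size, mark i = 1 ↔ IsRoot (p i))
    (hx : ∀ i : Fin P.size, px i = xCoord (p i))
    (hy : ∀ i : Fin P.size, py i = ε * yCoord (p i))
    (hD : ∀ u < P.size, IsNearestCode P.size mark px py u (D u)) : IsCode p ε D := by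
  have hy' : ∀ i : Fin P.size, py i = signedHeight ε (p i) := hy
  have hroot : ∀ u : Fin P.size, (∃ r < P.size, mark r = 1 ∧ py r < py u) ↔
      HasLowerRoot (signedHeight ε) IsRoot (p u) := fun u => by
    constructor
    · rintro ⟨r, hr, hm, hlt⟩
      exact ⟨p ⟨r, hr⟩, (hmark ⟨r, hr⟩).1 hm, by rwa [← hy', ← hy']⟩
    · rintro ⟨r, hr, hlt⟩
      obtain ⟨i, rfl⟩ := p.surjective r
      exact ⟨i, i.2, (hmark i).2 hr, by rwa [hy', hy']⟩
  have helig : ∀ u w : Fin P.size, EligibleAt P.size mark py u w ↔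
      Eligible (signedHeight ε) IsRoot (p u) (p w) := fun u w => by
    simp only [EligibleAt, Eligible, hy']
    refine and_congr_right fun _ => ⟨fun h r hr hlt => ?_, fun h r hr hm hlt => ?_⟩
    · obtain ⟨i, rfl⟩ := p.surjective r
      rw [← hy' i] at hlt ⊢
      exact h i i.2 ((hmark i).2 hr) hlt
    · have := h (p ⟨r, hr⟩) ((hmark ⟨r, hr⟩).1 hm)
      rw [← hy' ⟨r, hr⟩] at this
      exact this hlt
  refine ⟨fun u => ?_, fun u => ?_, fun u hu => ?_⟩
  · rw [← hroot]
    rcases hD u u.2 with ⟨h0, hno⟩ | ⟨w, -, hw, -, hr, -⟩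
    · exact ⟨fun h => absurd h0 h, fun h => absurd h hno⟩
    · exact ⟨fun _ => hr, fun _ => by omega⟩
  -- A code `0` decodes by truncated subtraction to the number `0`, which is in range because `u`
  -- witnesses that there are points.
  · rcases hD u u.2 with ⟨h0, hno⟩ | ⟨w, h, hw, -⟩
    · have := u.2
      omega
    · omega
  · obtain ⟨i, rfl⟩ := p.surjective u
    rcases hD i i.2 with ⟨h0, hno⟩ | ⟨w, hwn, hw, hel, hr, hmin⟩
    · exact absurd ((hroot i).2 hu) hno
    · rw [decodePoint_apply (v := ⟨w, hwn⟩) hw]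
      refine ⟨(helig i ⟨w, hwn⟩).1 hel, fun v hv => ?_⟩
      obtain ⟨j, rfl⟩ := p.surjective v
      have := hmin j j.2 ((helig i j).2 hv)
      rw [hx, hy, hx j, hy j, hx ⟨w, hwn⟩, hy ⟨w, hwn⟩] at this
      rw [Subtype.dist_eq, Subtype.dist_eq, dist_eq_sqrt_sqDist hε, dist_eq_sqrt_sqDist hε]
      exact Real.sqrt_le_sqrt this

theorem IsCode.height_lt {p : Fin P.size ≃ {p : Plane // p ∈ P.points}} {ε : ℝ} {D : ℕ → ℕ}
    (h : IsCode p ε D) {u v : Fin P.size} (hD : D u = v + 1) :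
    HasLowerRoot (signedHeight ε) IsRoot (p u) ∧
      signedHeight ε (p v) < signedHeight ε (p u) := by
  have h1 := (h.pos_iff u).1 (by omega)
  have := (h.nearest _ h1).1.1
  rw [decodePoint_apply hD] at this
  exact ⟨h1, this⟩

/-- The list of edges given by nearest points: an upward edge that is also a downward edge is
omitted. -/
def edgePairs (n : ℕ) (D U : ℕ → ℕ) : Set (ℕ × ℕ) :=
  {q | q.1 < n ∧ D q.1 = q.2 + 1} ∪ {q | q.1 < n ∧ U q.1 = q.2 + 1 ∧ D q.2 ≠ q.1 + 1}

/-- A downward pair starts at the upper end of its edge and an upward pair at the lower end. So an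
edge can occur twice only as a downward pair and its reversal as an upward pair, and `edgePairs`
drops the latter. -/
theorem outputsGraph_neighbourGraph {p : Fin P.size ≃ {p : Plane // p ∈ P.points}} {D U : ℕ → ℕ}
    (hD : IsCode p 1 D) (hU : IsCode p (-1) U) {s : State}
    (hs : Set.BijOn (fun j => (s.nmem 1 j, s.nmem 2 j)) (Set.Iio (s.nreg 0))
      (edgePairs P.size D U)) :
    OutputsGraph p s (neighbourGraph P (decodePoint p D) (decodePoint p U)) := by
  have hd : ∀ {u v : Fin P.size}, D u = v + 1 → yCoord (p v) < yCoord (p u) := fun h => by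
    simpa [signedHeight] using (hD.height_lt h).2
  have hu : ∀ {u v : Fin P.size}, U u = v + 1 → yCoord (p u) < yCoord (p v) := fun h => by
    simpa [signedHeight] using (hU.height_lt h).2
  have hadj : ∀ u v : Fin P.size, (D u = v + 1 ∨ U u = v + 1) →
      s(p u, p v) ∈ (neighbourGraph P (decodePoint p D) (decodePoint p U)).edgeSet := by
    intro u v h
    rw [SimpleGraph.mem_edgeSet, neighbourGraph, SimpleGraph.fromRel_adj]
    refine ⟨fun he => ?_, Or.inl ?_⟩
    · rcases h with h | h
      · exact (hd h).ne (by rw [he])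
      · exact (hu h).ne (by rw [he])
    · exact h.imp (fun h => ⟨(hD.height_lt h).1, decodePoint_apply h⟩)
        fun h => ⟨(hU.height_lt h).1, decodePoint_apply h⟩
  have hpair : ∀ q ∈ edgePairs P.size D U, ∃ u v : Fin P.size, q = (↑u, ↑v) ∧
      (D u = v + 1 ∨ U u = v + 1 ∧ D v ≠ u + 1) := by
    rintro ⟨a, b⟩ (⟨ha, h⟩ | ⟨ha, h, h'⟩)
    · have := hD.lt ⟨a, ha⟩
      simp only at ha h this
      exact ⟨⟨a, ha⟩, ⟨b, by omega⟩, rfl, Or.inl h⟩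
    · have := hU.lt ⟨a, ha⟩
      simp only at ha h this
      exact ⟨⟨a, ha⟩, ⟨b, by omega⟩, rfl, Or.inr ⟨h, h'⟩⟩
  have hmem : ∀ u v : Fin P.size, (D u = v + 1 ∨ U u = v + 1 ∧ D v ≠ u + 1) →
      ((u : ℕ), (v : ℕ)) ∈ edgePairs P.size D U := by
    rintro u v (h | h)
    · exact Or.inl ⟨u.2, h⟩
    · exact Or.inr ⟨u.2, h⟩
  have hinj : ∀ u v u' v' : Fin P.size, (D u = v + 1 ∨ U u = v + 1 ∧ D v ≠ u + 1) →
      (D u' = v' + 1 ∨ U u' = v' + 1 ∧ D v' ≠ u' + 1) → s(p u, p v) = s(p u', p v') →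
      u = u' ∧ v = v' := by
    intro u v u' v' h h' he
    rw [Sym2.eq_iff] at he
    rcases he with ⟨h1, h2⟩ | ⟨h1, h2⟩
    · exact ⟨p.injective h1, p.injective h2⟩
    · obtain rfl := p.injective h1
      obtain rfl := p.injective h2
      -- For opposite orientations, two pairs of the same kind contradict the heights, and two of
      -- different kinds contradict the omission rule.
      rcases h with h | ⟨h, hn⟩ <;> rcases h' with h' | ⟨h', hn'⟩
      · exact absurd (hd h) (hd h').not_gt
      · exact absurd h hn'
      · exact absurd h' hn
      · exact absurd (hu h) (hu h').not_gt
  constructor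
  · intro j hj
    obtain ⟨u, v, hq, h⟩ := hpair _ (hs.mapsTo hj)
    rw [Prod.mk.injEq] at hq
    exact ⟨s(p u, p v), hadj u v (h.imp_right And.left), u, v, hq.1, hq.2, rfl⟩
  · intro e he
    have hex : ∃ u v : Fin P.size, (D u = v + 1 ∨ U u = v + 1 ∧ D v ≠ u + 1) ∧
        e = s(p u, p v) := by
      have key : ∀ a b : Fin P.size, (HasLowerRoot (signedHeight 1) IsRoot (p a) ∧
          decodePoint p D (p a) = p b) ∨ (HasLowerRoot (signedHeight (-1)) IsRoot (p a) ∧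
          decodePoint p U (p a) = p b) → ∃ u v : Fin P.size,
          (D u = v + 1 ∨ U u = v + 1 ∧ D v ≠ u + 1) ∧ s(p a, p b) = s(p u, p v) := by
        rintro a b (⟨h1, h2⟩ | ⟨h1, h2⟩)
        · have h3 := (hD.pos_iff a).2 h1
          have h4 : D a = (⟨D a - 1, hD.lt a⟩ : Fin P.size) + 1 := by simp; omega
          rw [decodePoint_apply h4] at h2
          rw [← p.injective h2]
          exact ⟨a, _, Or.inl h4, rfl⟩
        · have h3 := (hU.pos_iff a).2 h1
          have h4 : U a = (⟨U a - 1, hU.lt a⟩ : Fin P.size) + 1 := by simp; omega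
          rw [decodePoint_apply h4] at h2
          rw [p.injective h2] at h4
          -- If the upward pair of `a` is omitted, the edge is listed as the downward pair of `b`.
          by_cases h5 : D b = a + 1
          · exact ⟨b, a, Or.inl h5, Sym2.eq_swap⟩
          · exact ⟨a, b, Or.inr ⟨h4, h5⟩, rfl⟩
      induction e with
      | _ x y =>
        rw [SimpleGraph.mem_edgeSet, neighbourGraph, SimpleGraph.fromRel_adj] at he
        obtain ⟨a, rfl⟩ := p.surjective x
        obtain ⟨b, rfl⟩ := p.surjective y
        rcases he.2 with h | h
        · exact key a b h
        · obtain ⟨u, v, h1, h2⟩ := key b a h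
          exact ⟨u, v, h1, Sym2.eq_swap.trans h2⟩
    obtain ⟨u, v, h, rfl⟩ := hex
    obtain ⟨j, hj, hjq⟩ := hs.surjOn (hmem u v h)
    simp only [Prod.mk.injEq] at hjq
    refine ⟨j, ⟨hj, u, v, hjq.1, hjq.2, rfl⟩, ?_⟩
    rintro j' ⟨hj', u', v', hu', hv', he'⟩
    obtain ⟨u₁, v₁, hq, h'⟩ := hpair _ (hs.mapsTo hj')
    rw [Prod.mk.injEq] at hq
    obtain rfl : u' = u₁ := Fin.ext (hu'.symm.trans hq.1)
    obtain rfl : v' = v₁ := Fin.ext (hv'.symm.trans hq.2)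
    obtain ⟨rfl, rfl⟩ := hinj u v u' v' h h' he'
    exact hs.injOn hj' hj (by simp only [hu', hv', hjq.1, hjq.2])

end Codes

/-! ## The program -/

/-- Computes a power of two that is at least the number of points. -/
def sizeProg : Stmt :=
  .seq (block [.nconst 2 1, .nconst 3 1]) <| .loop (.nlt 3 0) (.instr (.nadd 3 3 3))

theorem sizeProg_spec {n m : ℕ} {s : State} {Q : State → ℕ → Prop} (hn : s.nreg 0 = n)
    (hm : 2 * Nat.clog 2 n + 3 ≤ m)
    (hQ : ∀ s' m', s'.nreg 2 = 1 → s'.nreg 3 = 2 ^ Nat.clog 2 n → Preserved sizeProg s s' →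
      m ≤ m' + 2 * Nat.clog 2 n + 3 → Q s' m') : Run sizeProg s m Q := by
  refine Run.preserving (Run.seq (Run.of_loopFree (by simp [block, Stmt.LoopFree]) ?_ ?_))
  · simp [block, Stmt.steps]; omega
  have hsteps : (block [.nconst 2 1, .nconst 3 1]).steps = 2 := rfl
  rw [hsteps]
  refine Run.loop (fun s' m' => ∃ j ≤ Nat.clog 2 n, s'.nreg 0 = n ∧ s'.nreg 2 = 1 ∧
    s'.nreg 3 = 2 ^ j ∧ m ≤ m' + 2 * j + 2) ?_ ?_ ⟨0, Nat.zero_le _, ?_⟩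
  · rintro s' m' ⟨j, hj, h0, h2, h3, hm'⟩ hlt
    simp only [Test.Holds, h0, h3] at hlt
    have hj' : j < Nat.clog 2 n := (Nat.lt_clog_iff_pow_lt (by norm_num)).2 hlt
    refine ⟨by omega, Run.instr (by omega) ⟨j + 1, hj', ?_, ?_, ?_, by omega⟩⟩
    · simpa [Instr.effect, State.setN] using h0
    · simpa [Instr.effect, State.setN] using h2
    · simp [Instr.effect, State.setN, h3]; ring
  · rintro s' m' ⟨j, hj, h0, h2, h3, hm'⟩ hlt
    simp only [Test.Holds, h0, h3, not_lt] at hlt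
    obtain rfl : j = Nat.clog 2 n := le_antisymm hj (Nat.clog_le_of_le_pow hlt)
    exact ⟨by omega, fun hP => hQ s' _ h2 h3 hP (by omega)⟩
  · simp [block, Stmt.out, Instr.effect, State.setN, hn]
    omega

/-- Fills the tables of the parents in the tree and of the numbers themselves. -/
def tableProg : Stmt :=
  .seq (.instr (.nconst 4 0)) <| .loop (.nlt 4 3) <|
    block [.nadd 5 4 4, .nstore 3 5 4, .nadd 5 5 2, .nstore 3 5 4, .nstore 9 4 4, .nadd 4 4 2]

theorem tableProg_spec {N m : ℕ} {s : State} {Q : State → ℕ → Prop} (h2 : s.nreg 2 = 1)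
    (h3 : s.nreg 3 = N) (hm : N * 7 + 2 ≤ m)
    (hQ : ∀ s' m', (∀ v < 2 * N, s'.nmem 3 v = v / 2) → (∀ i < N, s'.nmem 9 i = i) →
      Preserved tableProg s s' → m ≤ m' + N * 7 + 2 → Q s' m') : Run tableProg s m Q := by
  refine Run.preserving (Run.seq (Run.instr (by omega) ?_))
  set s₁ := (Instr.nconst 4 0).effect s with hs₁
  refine Run.forLoop (n := N) (c := 6)
    (fun j s' => s'.nreg 4 = j ∧ (∀ v < 2 * j, s'.nmem 3 v = v / 2) ∧ ∀ i < j, s'.nmem 9 i = i)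
    (by simp [hs₁, Instr.effect, State.setN, h3]) (by decide) (fun _ _ h => h.1)
    ⟨by simp [hs₁, Instr.effect, State.setN], by simp, by simp⟩ (by omega) ?_ ?_
  · rintro j s' m' hj ⟨h4, hI3, hI9⟩ hP hm'
    have h2' : s'.nreg 2 = 1 := (hP.nreg 2 (by decide)).trans
      (by simp [hs₁, Instr.effect, State.setN, h2])
    refine Run.of_loopFree (by simp [block, Stmt.LoopFree]) ?_ ?_
    · simp [block, Stmt.steps]; omega
    refine ⟨⟨?_, fun v hv => ?_, fun i hi => ?_⟩, le_rfl⟩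
    · simp [block, Stmt.out, Instr.effect, State.setN, State.putN, h4, h2']
    · simp only [block, Stmt.out, Instr.effect, State.setN, State.putN, h4, h2',
        Function.update_apply]
      have := hI3 v
      by_cases hv1 : v = j + j + 1
      · simp [hv1]; omega
      · by_cases hv2 : v = j + j
        · simp [hv2]; omega
        · simp [hv1, hv2]; omega
    · simp only [block, Stmt.out, Instr.effect, State.setN, State.putN, h4, h2',
        Function.update_apply]
      have := hI9 i
      by_cases hij : i = j
      · simp [hij]
      · simp [hij]; omega
  · intro s' m' hI hP hm' hP'
    exact hQ s' m' hI.2.1 hI.2.2 hP' (by omega)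

/-- Multiplies the heights by `ε`. -/
def heightProg (ε : ℤ) : Stmt :=
  .seq (.instr (.nconst 4 0)) <| .loop (.nlt 4 0) <|
    block [.rload 0 1 4, .rconst 1 ε, .rmul 0 1 0, .rstore 2 4 0, .nadd 4 4 2]

theorem heightProg_nregs (ε : ℤ) : (heightProg ε).collect Instr.nregs = [4, 4] := rfl

theorem heightProg_narrays (ε : ℤ) : (heightProg ε).collect Instr.narrays = [] := rfl

theorem heightProg_rarrays (ε : ℤ) : (heightProg ε).collect Instr.rarrays = [2] := rfl

theorem heightProg_spec {n m : ℕ} {ε : ℤ} {s : State} {Q : State → ℕ → Prop} (hn : s.nreg 0 = n)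
    (h2 : s.nreg 2 = 1) (hm : n * 6 + 2 ≤ m)
    (hQ : ∀ s' m', (∀ i < n, s'.rmem 2 i = ε * s.rmem 1 i) →
      Preserved (heightProg ε) s s' → m ≤ m' + n * 6 + 2 → Q s' m') :
    Run (heightProg ε) s m Q := by
  refine Run.preserving (Run.seq (Run.instr (by omega) ?_))
  set s₁ := (Instr.nconst 4 0).effect s with hs₁
  refine Run.forLoop (n := n) (c := 5)
    (fun j s' => s'.nreg 4 = j ∧ ∀ i < j, s'.rmem 2 i = ε * s.rmem 1 i)
    (by simp [hs₁, Instr.effect, State.setN, hn]) (by simp [block, Stmt.collect, Instr.nregs])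
    (fun _ _ h => h.1)
    ⟨by simp [hs₁, Instr.effect, State.setN], by simp⟩ (by omega) ?_ ?_
  · rintro j s' m' hj ⟨h4, hI⟩ hP hm'
    have h2' : s'.nreg 2 = 1 := (hP.nreg 2 (by simp [block, Stmt.collect, Instr.nregs])).trans
      (by simp [hs₁, Instr.effect, State.setN, h2])
    have h1' : s'.rmem 1 = s.rmem 1 := hP.rmem 1 (by simp [block, Stmt.collect, Instr.rarrays])
    refine Run.of_loopFree (by simp [block, Stmt.LoopFree]) ?_ ?_
    · simp [block, Stmt.steps]; omega
    refine ⟨⟨?_, fun i hi => ?_⟩, le_rfl⟩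
    · simp [block, Stmt.out, Instr.effect, State.setN, State.setR, State.putR, h4, h2']
    · have := hI i
      by_cases hij : i = j
      · simp [block, Stmt.out, Instr.effect, State.setN, State.setR, State.putR, h4, h1', hij]
      · simp [block, Stmt.out, Instr.effect, State.setN, State.setR, State.putR, h4, hij]
        exact this (by omega)
  · intro s' m' hI hP hm' hP'
    exact hQ s' m' hI.2 hP' (by omega)

/-! ### Listing every edge exactly once -/

/-- The output list, of the length in register `5`, enumerates `S`. -/
def Emitted (s : State) (S : Set (ℕ × ℕ)) : Prop :=
  Set.BijOn (fun j => (s.nmem 1 j, s.nmem 2 j)) (Set.Iio (s.nreg 5)) S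

/-- Appends to the output list. -/
def emitProg : Stmt := block [.nsub 6 6 2, .nstore 1 5 4, .nstore 2 5 6, .nadd 5 5 2]

theorem emitProg_spec {a b m : ℕ} {S : Set (ℕ × ℕ)} {s : State} {Q : State → ℕ → Prop}
    (h2 : s.nreg 2 = 1) (h4 : s.nreg 4 = a) (h6 : s.nreg 6 = b + 1) (hS : Emitted s S)
    (hab : (a, b) ∉ S) (hm : 4 ≤ m)
    (hQ : ∀ s', Emitted s' (insert (a, b) S) → Preserved emitProg s s' → Q s' (m - 4)) :
    Run emitProg s m Q := by
  have hlf : emitProg.LoopFree := by simp [emitProg, block, Stmt.LoopFree]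
  refine Run.of_loopFree hlf hm (hQ _ ?_ (Preserved.of_loopFree hlf s))
  have e1 : (emitProg.out s).nmem 1 = Function.update (s.nmem 1) (s.nreg 5) a := by
    simp [emitProg, block, Stmt.out, Instr.effect, State.setN, State.putN, h4]
  have e2 : (emitProg.out s).nmem 2 = Function.update (s.nmem 2) (s.nreg 5) b := by
    simp [emitProg, block, Stmt.out, Instr.effect, State.setN, State.putN, h2, h6]
  have e5 : (emitProg.out s).nreg 5 = s.nreg 5 + 1 := by
    simp [emitProg, block, Stmt.out, Instr.effect, State.setN, State.putN, h2]
  have hIio : Set.Iio (s.nreg 5 + 1) = insert (s.nreg 5) (Set.Iio (s.nreg 5)) := by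
    ext x
    simp only [Set.mem_Iio, Set.mem_insert_iff]
    omega
  unfold Emitted
  rw [e1, e2, e5, hIio]
  have hval : (fun j => (Function.update (s.nmem 1) (s.nreg 5) a j,
      Function.update (s.nmem 2) (s.nreg 5) b j)) (s.nreg 5) = (a, b) := by simp
  rw [← hval]
  refine Set.BijOn.insert (hS.congr fun j hj => ?_) (by simpa using hab)
  have hj' : j ≠ s.nreg 5 := (Set.mem_Iio.1 hj).ne
  simp [hj']

/-- Appends the downward edge of a point. -/
def downStep : Stmt :=
  .seq (.instr (.nload 6 12 4)) <| .seq (.ite (.neq 6 1) .skip emitProg) <| .instr (.nadd 4 4 2)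

/-- Appends the upward edge of a point, unless it is also a downward edge. -/
def upStep : Stmt :=
  .seq (block [.nload 6 13 4, .nsub 7 6 2, .nload 7 12 7, .nadd 8 4 2]) <|
  .seq (.ite (.neq 6 1) .skip (.ite (.neq 7 8) .skip emitProg)) <| .instr (.nadd 4 4 2)

/-- Lists all edges. -/
def edgeProg : Stmt :=
  .seq (block [.nconst 4 0, .nconst 5 0]) <| .seq (.loop (.nlt 4 0) downStep) <|
  .seq (.instr (.nconst 4 0)) <| .seq (.loop (.nlt 4 0) upStep) <| .instr (.nmove 0 5)

/-- The registers and arrays that the listing of the edges reads. -/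
structure EdgeMem (n : ℕ) (D U : ℕ → ℕ) (s : State) : Prop where
  size : s.nreg 0 = n
  zero : s.nreg 1 = 0
  one : s.nreg 2 = 1
  down : s.nmem 12 = D
  up : s.nmem 13 = U

theorem EdgeMem.of_preserved {n : ℕ} {D U : ℕ → ℕ} {S : Stmt} {s s' : State}
    (h : EdgeMem n D U s) (hP : Preserved S s s') (h1 : ∀ r ∈ S.collect Instr.nregs, 4 ≤ r)
    (h2 : ∀ r ∈ S.collect Instr.narrays, r ≤ 2) : EdgeMem n D U s' :=
  ⟨(hP.nreg 0 fun h => by simpa using h1 _ h).trans h.size,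
    (hP.nreg 1 fun h => by simpa using h1 _ h).trans h.zero,
    (hP.nreg 2 fun h => by simpa using h1 _ h).trans h.one,
    (hP.nmem 12 fun h => by simpa using h2 _ h).trans h.down,
    (hP.nmem 13 fun h => by simpa using h2 _ h).trans h.up⟩

theorem downStep_spec {n i m : ℕ} {D U : ℕ → ℕ} {S : Set (ℕ × ℕ)} {s : State}
    {Q : State → ℕ → Prop} (hs : EdgeMem n D U s) (h4 : s.nreg 4 = i) (hS : Emitted s S)
    (hi : ∀ b, (i, b) ∉ S) (hm : 10 ≤ m)
    (hQ : ∀ s' m', s'.nreg 4 = i + 1 → Emitted s' (S ∪ {q | q.1 = i ∧ D i = q.2 + 1}) →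
      m ≤ m' + 10 → Q s' m') : Run downStep s m Q := by
  refine Run.seq (Run.instr (by omega) ?_)
  set s₁ := (Instr.nload 6 12 4).effect s with hs₁
  have hP₁ : Preserved (.instr (.nload 6 12 4)) s s₁ :=
    (Exec.instr _ _ : Exec [] _ _ _ _).preserved
  have hE₁ : EdgeMem n D U s₁ := hs.of_preserved hP₁ (by decide) (by decide)
  have e6 : s₁.nreg 6 = D i := by simp [hs₁, Instr.effect, State.setN, hs.down, h4]
  have e4 : s₁.nreg 4 = i := by simp [hs₁, Instr.effect, State.setN, h4]
  have hS₁ : Emitted s₁ S := by simpa [Emitted, hs₁, Instr.effect, State.setN] using hS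
  have hfin : ∀ s₂ m₂, s₂.nreg 2 = 1 → s₂.nreg 4 = i →
      Emitted s₂ (S ∪ {q | q.1 = i ∧ D i = q.2 + 1}) → m ≤ m₂ + 9 → 1 ≤ m₂ →
      Run (.instr (.nadd 4 4 2)) s₂ m₂ Q := fun s₂ m₂ h2 h4 hS₂ hm₂ hm₂' => by
    refine Run.instr hm₂' (hQ _ _ ?_ ?_ (by omega))
    · simp [Instr.effect, State.setN, h2, h4]
    · simpa [Emitted, Instr.effect, State.setN] using hS₂
  refine Run.seq (Run.ite (by omega) (fun h => ?_) fun h => ?_)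
  · simp only [Test.Holds, e6, hE₁.zero] at h
    refine Run.skip (by omega) (hfin _ _ hE₁.one e4 ?_ (by omega) (by omega))
    simpa [h] using hS₁
  · simp only [Test.Holds, e6, hE₁.zero] at h
    obtain ⟨b, hb⟩ := Nat.exists_eq_succ_of_ne_zero h
    refine emitProg_spec hE₁.one e4 (e6.trans hb) hS₁ (hi b) (by omega) fun s₂ hS₂ hP₂ =>
      hfin _ _ ((hP₂.nreg 2 (by decide)).trans hE₁.one) ((hP₂.nreg 4 (by decide)).trans e4) ?_
        (by omega) (by omega)
    have : S ∪ {q | q.1 = i ∧ D i = q.2 + 1} = insert (i, b) S := by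
      ext ⟨x, y⟩
      simp only [Set.mem_union, Set.mem_ofPred_eq, Set.mem_insert_iff, Prod.mk.injEq]
      rw [hb, or_comm]
      exact or_congr_left (and_congr_right fun _ => by omega)
    rwa [this]

/-- For `U i = 0`, truncated subtraction makes the program look up `D 0`; this value is ignored,
because `U i` is tested first. -/
theorem upStep_spec {n i m : ℕ} {D U : ℕ → ℕ} {S : Set (ℕ × ℕ)} {s : State}
    {Q : State → ℕ → Prop} (hs : EdgeMem n D U s) (h4 : s.nreg 4 = i) (hS : Emitted s S)
    (hi : ∀ b, U i = b + 1 → (i, b) ∉ S) (hm : 20 ≤ m)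
    (hQ : ∀ s' m', s'.nreg 4 = i + 1 →
      Emitted s' (S ∪ {q | q.1 = i ∧ U i = q.2 + 1 ∧ D q.2 ≠ i + 1}) →
      m ≤ m' + 20 → Q s' m') : Run upStep s m Q := by
  have hlf : (block [.nload 6 13 4, .nsub 7 6 2, .nload 7 12 7, .nadd 8 4 2]).LoopFree := by
    simp [block, Stmt.LoopFree]
  refine Run.seq (Run.of_loopFree hlf ?_ ?_)
  · simp [block, Stmt.steps]; omega
  have hsteps : (block [.nload 6 13 4, .nsub 7 6 2, .nload 7 12 7, .nadd 8 4 2]).steps = 4 := rfl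
  rw [hsteps]
  have hP₁ := Preserved.of_loopFree hlf s
  set s₁ := (block [.nload 6 13 4, .nsub 7 6 2, .nload 7 12 7, .nadd 8 4 2]).out s with hs₁
  have hE₁ : EdgeMem n D U s₁ := hs.of_preserved hP₁ (by decide) (by decide)
  have e6 : s₁.nreg 6 = U i := by
    simp [hs₁, block, Stmt.out, Instr.effect, State.setN, hs.up, h4]
  have e7 : s₁.nreg 7 = D (U i - 1) := by
    simp [hs₁, block, Stmt.out, Instr.effect, State.setN, hs.up, hs.down, hs.one, h4]
  have e8 : s₁.nreg 8 = i + 1 := by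
    simp [hs₁, block, Stmt.out, Instr.effect, State.setN, hs.one, h4]
  have e4 : s₁.nreg 4 = i := by simp [hs₁, block, Stmt.out, Instr.effect, State.setN, h4]
  have hS₁ : Emitted s₁ S := by
    simpa [Emitted, hs₁, block, Stmt.out, Instr.effect, State.setN] using hS
  have hfin : ∀ s₂ m₂, s₂.nreg 2 = 1 → s₂.nreg 4 = i →
      Emitted s₂ (S ∪ {q | q.1 = i ∧ U i = q.2 + 1 ∧ D q.2 ≠ i + 1}) → m ≤ m₂ + 15 → 1 ≤ m₂ →
      Run (.instr (.nadd 4 4 2)) s₂ m₂ Q := fun s₂ m₂ h2 h4 hS₂ hm₂ hm₂' => by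
    refine Run.instr hm₂' (hQ _ _ ?_ ?_ (by omega))
    · simp [Instr.effect, State.setN, h2, h4]
    · simpa [Emitted, Instr.effect, State.setN] using hS₂
  refine Run.seq (Run.ite (by omega) (fun h => ?_) fun h => ?_)
  · simp only [Test.Holds, e6, hE₁.zero] at h
    refine Run.skip (by omega) (hfin _ _ hE₁.one e4 ?_ (by omega) (by omega))
    simpa [h] using hS₁
  · simp only [Test.Holds, e6, hE₁.zero] at h
    obtain ⟨b, hb⟩ := Nat.exists_eq_succ_of_ne_zero h
    rw [hb, Nat.succ_sub_one] at e7
    refine Run.ite (by omega) (fun h' => ?_) fun h' => ?_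
    · simp only [Test.Holds, e7, e8] at h'
      refine Run.skip (by omega) (hfin _ _ hE₁.one e4 ?_ (by omega) (by omega))
      have : {q : ℕ × ℕ | q.1 = i ∧ U i = q.2 + 1 ∧ D q.2 ≠ i + 1} = ∅ := by
        ext ⟨x, y⟩
        simp only [Set.mem_ofPred_eq, Set.mem_empty_iff_false, iff_false]
        rintro ⟨-, h1, h2⟩
        obtain rfl : y = b := by omega
        exact h2 h'
      rwa [this, Set.union_empty]
    · simp only [Test.Holds, e7, e8] at h'
      refine emitProg_spec hE₁.one e4 (e6.trans hb) hS₁ (hi b hb) (by omega) fun s₂ hS₂ hP₂ =>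
        hfin _ _ ((hP₂.nreg 2 (by decide)).trans hE₁.one) ((hP₂.nreg 4 (by decide)).trans e4) ?_
          (by omega) (by omega)
      have : S ∪ {q | q.1 = i ∧ U i = q.2 + 1 ∧ D q.2 ≠ i + 1} = insert (i, b) S := by
        ext ⟨x, y⟩
        simp only [Set.mem_union, Set.mem_ofPred_eq, Set.mem_insert_iff, Prod.mk.injEq]
        rw [or_comm]
        refine or_congr_left (and_congr_right fun _ => ⟨fun h => by omega, ?_⟩)
        rintro rfl
        exact ⟨hb, h'⟩
      rwa [this]

/-- The hypothesis `hDU` keeps the upward pair of a point from coinciding with its downward pair,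
which would put it into the list twice. Reversed duplicates are removed by `upStep`. -/
theorem edgeProg_spec {n m : ℕ} {D U : ℕ → ℕ} {s : State} {Q : State → ℕ → Prop}
    (hs : EdgeMem n D U s) (hDU : ∀ i < n, U i ≠ 0 → D i ≠ U i) (hm : n * 32 + 10 ≤ m)
    (hQ : ∀ s' m', Set.BijOn (fun j => (s'.nmem 1 j, s'.nmem 2 j)) (Set.Iio (s'.nreg 0))
      (edgePairs n D U) → Q s' m') : Run edgeProg s m Q := by
  have hlf : (block [.nconst 4 0, .nconst 5 0]).LoopFree := by simp [block, Stmt.LoopFree]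
  refine Run.seq (Run.of_loopFree hlf ?_ ?_)
  · simp [block, Stmt.steps]; omega
  have hsteps : (block [.nconst 4 0, .nconst 5 0]).steps = 2 := rfl
  rw [hsteps]
  have hP₁ := Preserved.of_loopFree hlf s
  set s₁ := (block [.nconst 4 0, .nconst 5 0]).out s with hs₁
  have hE₁ : EdgeMem n D U s₁ := hs.of_preserved hP₁ (by decide) (by decide)
  refine Run.seq (Run.forLoop (n := n) (c := 10) (fun j s' => s'.nreg 4 = j ∧
    Emitted s' {q | q.1 < j ∧ D q.1 = q.2 + 1}) hE₁.size (by decide) (fun _ _ h => h.1)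
    ⟨by simp [hs₁, block, Stmt.out, Instr.effect, State.setN], ?_⟩ (by omega) ?_ ?_)
  · simp [Emitted, hs₁, block, Stmt.out, Instr.effect, State.setN]
  · rintro j s' m' hj ⟨h4, hI⟩ hP hm'
    refine downStep_spec (hE₁.of_preserved hP (by decide) (by decide)) h4 hI
      (fun b h => lt_irrefl _ h.1) hm' fun s'' m'' h4' hI' hm'' => ⟨⟨h4', ?_⟩, by omega⟩
    convert hI' using 1
    ext ⟨x, y⟩
    simp only [Set.mem_union, Set.mem_ofPred_eq]
    constructor
    · rintro ⟨h1, h2⟩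
      rcases (Nat.lt_succ_iff.1 h1).eq_or_lt with rfl | h1
      · exact Or.inr ⟨rfl, h2⟩
      · exact Or.inl ⟨h1, h2⟩
    · rintro (⟨h1, h2⟩ | ⟨rfl, h2⟩)
      · exact ⟨h1.trans (Nat.lt_succ_self j), h2⟩
      · exact ⟨Nat.lt_succ_self x, h2⟩
  rintro s₂ m₂ ⟨-, hI₂⟩ hP₂ hm₂
  have hE₂ := hE₁.of_preserved hP₂ (by decide) (by decide)
  refine Run.seq (Run.instr (by omega) ?_)
  set s₃ := (Instr.nconst 4 0).effect s₂ with hs₃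
  have hP₃ : Preserved (.instr (.nconst 4 0)) s₂ s₃ :=
    (Exec.instr _ _ : Exec [] _ _ _ _).preserved
  have hE₃ : EdgeMem n D U s₃ := hE₂.of_preserved hP₃ (by decide) (by decide)
  refine Run.seq (Run.forLoop (n := n) (c := 20) (fun j s' => s'.nreg 4 = j ∧
    Emitted s' ({q | q.1 < n ∧ D q.1 = q.2 + 1} ∪
      {q | q.1 < j ∧ U q.1 = q.2 + 1 ∧ D q.2 ≠ q.1 + 1})) hE₃.size (by decide) (fun _ _ h => h.1)
    ⟨by simp [hs₃, Instr.effect, State.setN], ?_⟩ (by omega) ?_ ?_)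
  · simpa [Emitted, hs₃, Instr.effect, State.setN] using hI₂
  · rintro j s' m' hj ⟨h4, hI⟩ hP hm'
    refine upStep_spec (hE₃.of_preserved hP (by decide) (by decide)) h4 hI ?_ hm'
      fun s'' m'' h4' hI' hm'' => ⟨⟨h4', ?_⟩, by omega⟩
    · rintro b hb (⟨-, h⟩ | ⟨h, -⟩)
      · exact hDU j hj (by omega) (h.trans hb.symm)
      · exact lt_irrefl _ h
    convert hI' using 1
    rw [Set.union_assoc]
    congr 1
    ext ⟨x, y⟩
    simp only [Set.mem_union, Set.mem_ofPred_eq]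
    constructor
    · rintro ⟨h1, h2⟩
      rcases (Nat.lt_succ_iff.1 h1).eq_or_lt with rfl | h1
      · exact Or.inr ⟨rfl, h2⟩
      · exact Or.inl ⟨h1, h2⟩
    · rintro (⟨h1, h2⟩ | ⟨rfl, h2⟩)
      · exact ⟨h1.trans (Nat.lt_succ_self j), h2⟩
      · exact ⟨Nat.lt_succ_self x, h2⟩
  rintro s₄ m₄ ⟨-, hI₄⟩ hP₄ hm₄
  refine Run.instr (by omega) (hQ _ _ ?_)
  simpa [Emitted, Instr.effect, State.setN, edgePairs] using hI₄

/-! ### Assembly and running time -/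

/-- Lists the edges from each point to its nearest eligible points below and above. -/
def mainProg : Stmt :=
  .seq sizeProg <| .seq tableProg <| .seq (heightProg 1) <| .seq (passProg 12) <|
  .seq (heightProg (-1)) <| .seq (passProg 13) edgeProg

theorem TreeInv.of_mem_eq_zero {K : ℕ} {s : State} (h4 : ∀ v, s.nmem 4 v = 0)
    (h5 : ∀ v, s.nmem 5 v = 0) (h6 : ∀ v, s.nmem 6 v = 0) (h3 : ∀ v, s.rmem 3 v = 0) (κ : ℕ → ℝ) :
    TreeInv K ∅ ∅ κ 0 s :=
  ⟨by simp, by simp, fun l _ _ => ⟨by simp [h4], by simp [h5], by simp [h6], by simp⟩,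
    fun v _ _ _ => ⟨by simp [h4], by simp [h5], by simp [h6], by simp [h6, h3]⟩⟩

/-- A common nonzero value would name a point both strictly below and strictly above `u`. -/
theorem IsNearestCode.ne {n : ℕ} {mark : ℕ → ℕ} {px py px' py' y : ℕ → ℝ} {u v w : ℕ}
    (hpy : ∀ i < n, py i = ((1 : ℤ) : ℝ) * y i) (hpy' : ∀ i < n, py' i = ((-1 : ℤ) : ℝ) * y i)
    (hu : u < n) (h : IsNearestCode n mark px py u v) (h' : IsNearestCode n mark px' py' u w)
    (hw : w ≠ 0) : v ≠ w := by
  rintro rfl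
  rcases h with ⟨h, -⟩ | ⟨a, ha, rfl, ⟨hlt, -⟩, -⟩
  · exact hw h
  · rcases h' with ⟨h, -⟩ | ⟨b, hb, hab, ⟨hlt', -⟩, -⟩
    · exact hw h
    · obtain rfl : a = b := by omega
      rw [hpy _ ha, hpy _ hu] at hlt
      rw [hpy' _ ha, hpy' _ hu] at hlt'
      norm_num at hlt hlt'
      linarith

/-- The upper half reuses the same pass with negated heights. The first pass returns the tree empty,
and the second leaves the result in array `12` alone, so the two passes do not interfere. -/
theorem mainProg_spec {n K m : ℕ} {s : State} (hK : Nat.clog 2 n = K) (h0 : s.nreg 0 = n)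
    (h1 : s.nreg 1 = 0) (hT : ∀ κ, TreeInv K ∅ ∅ κ 0 s)
    (hinj : ∀ i < n, ∀ j < n, s.rmem 1 i = s.rmem 1 j → i = j)
    (hm : n * (1400 * K + 1500) + 7 * 2 ^ K + 2 * K + 150 ≤ m) :
    Run mainProg s m fun s' _ => ∃ D U py py',
      (∀ i < n, py i = ((1 : ℤ) : ℝ) * s.rmem 1 i) ∧
      (∀ i < n, py' i = ((-1 : ℤ) : ℝ) * s.rmem 1 i) ∧
      (∀ u < n, IsNearestCode n (s.nmem 0) (s.rmem 0) py u (D u)) ∧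
      (∀ u < n, IsNearestCode n (s.nmem 0) (s.rmem 0) py' u (U u)) ∧
      Set.BijOn (fun j => (s'.nmem 1 j, s'.nmem 2 j)) (Set.Iio (s'.nreg 0)) (edgePairs n D U) := by
  have hmul : ∀ a b, n * (a * K + b) = a * (n * K) + b * n := fun a b => by ring
  have hnK : n ≤ 2 ^ K := hK ▸ Nat.le_pow_clog (by norm_num) n
  rw [hmul] at hm
  refine Run.seq (sizeProg_spec h0 (by omega) ?_)
  intro s₁ m₁ h2₁ h3₁ hP₁ hm₁
  rw [hK] at h3₁ hm₁
  refine Run.seq (tableProg_spec h2₁ h3₁ (by omega) ?_)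
  intro s₂ m₂ hpar hid hP₂ hm₂
  have hE₂ : Env K s₂ := ⟨(hP₂.nreg 1 (by decide)).trans ((hP₁.nreg 1 (by decide)).trans h1),
    (hP₂.nreg 2 (by decide)).trans h2₁, (hP₂.nreg 3 (by decide)).trans h3₁, hpar⟩
  have h0₂ : s₂.nreg 0 = n := (hP₂.nreg 0 (by decide)).trans ((hP₁.nreg 0 (by decide)).trans h0)
  have ha₂ : ∀ a, a ≠ 3 → a ≠ 9 → s₂.nmem a = s.nmem a := fun a h3 h9 =>
    (hP₂.nmem a (by
      simp [tableProg, block, Stmt.collect, Instr.narrays, h3, h9])).trans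
      (hP₁.nmem a (by simp [sizeProg, block, Stmt.collect, Instr.narrays]))
  have hr₂ : s₂.rmem = s.rmem := funext fun a =>
    (hP₂.rmem a (by simp [tableProg, block, Stmt.collect, Instr.rarrays])).trans
      (hP₁.rmem a (by simp [sizeProg, block, Stmt.collect, Instr.rarrays]))
  have hT₂ : ∀ κ, TreeInv K ∅ ∅ κ 0 s₂ := fun κ => (hT κ).congr
    (ha₂ 4 (by norm_num) (by norm_num)) (ha₂ 5 (by norm_num) (by norm_num))
    (ha₂ 6 (by norm_num) (by norm_num)) (by rw [hr₂])
  have hheight : ∀ {ε : ℤ} {s s' : State}, Preserved (heightProg ε) s s' →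
      s'.nreg 0 = s.nreg 0 ∧ s'.nmem = s.nmem ∧ (∀ a, a ≠ 2 → s'.rmem a = s.rmem a) ∧
      (Env K s → Env K s') ∧ ((∀ κ, TreeInv K ∅ ∅ κ 0 s) → ∀ κ, TreeInv K ∅ ∅ κ 0 s') := by
    intro ε s s' hP
    have hmem : s'.nmem = s.nmem := funext fun a => hP.nmem a (by simp [heightProg_narrays])
    exact ⟨hP.nreg 0 (by simp [heightProg_nregs]), hmem,
      fun a ha => hP.rmem a (by simp [heightProg_rarrays, ha]),
      fun hE => hE.of_preserved hP (by simp [heightProg_nregs]) (by simp [heightProg_narrays]),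
      fun hT κ => (hT κ).congr (by rw [hmem]) (by rw [hmem]) (by rw [hmem])
        (hP.rmem 3 (by simp [heightProg_rarrays]))⟩
  have hpass : ∀ {a : ℕ} {s s' : State}, 12 ≤ a → Preserved (passProg a) s s' →
      s'.nreg 0 = s.nreg 0 ∧ (∀ b, b = 0 ∨ b = 9 ∨ 12 ≤ b → b ≠ a → s'.nmem b = s.nmem b) ∧
      (∀ b, b < 3 → s'.rmem b = s.rmem b) ∧ (Env K s → Env K s') := by
    intro a s s' ha hP
    exact ⟨hP.nreg 0 fun h => by have := passProg_nregs a 0 h; omega,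
      fun b hb hba => hP.nmem b fun h => by have := passProg_narrays a b h; omega,
      fun b hb => hP.rmem b fun h => by have := passProg_rarrays a b h; omega,
      fun hE => hE.of_preserved hP (passProg_nregs a) fun h => by
        have := passProg_narrays a 3 h; omega⟩
  refine Run.seq (heightProg_spec h0₂ hE₂.one (by omega) ?_)
  intro s₃ m₃ hy₃ hP₃ hm₃
  obtain ⟨h0₃, ha₃, hr₃, hE₃, hT₃⟩ := hheight hP₃
  rw [hr₂] at hy₃ hr₃
  rw [h0₂] at h0₃
  have hmark₃ : s₃.nmem 0 = s.nmem 0 := by rw [ha₃]; exact ha₂ 0 (by norm_num) (by norm_num)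
  have hinj₃ : ∀ i < n, ∀ j < n, s₃.rmem 2 i = s₃.rmem 2 j → i = j := fun i hi j hj h => by
    rw [hy₃ i hi, hy₃ j hj] at h
    exact hinj i hi j hj (by simpa using h)
  refine Run.seq (passProg_spec le_rfl (hE₃ hE₂) (hT₃ hT₂) h0₃ hnK
    (fun i hi => by rw [ha₃]; exact hid i (by omega)) hinj₃ (by rw [hmul]; omega) ?_)
  intro s₄ m₄ hT₄ hD hP₄ hm₄
  rw [hmul] at hm₄
  obtain ⟨h0₄, ha₄, hr₄, hE₄⟩ := hpass le_rfl hP₄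
  rw [h0₃] at h0₄
  have hE₄' := hE₄ (hE₃ hE₂)
  refine Run.seq (heightProg_spec h0₄ hE₄'.one (by omega) ?_)
  intro s₅ m₅ hy₅ hP₅ hm₅
  obtain ⟨h0₅, ha₅, hr₅, hE₅, hT₅⟩ := hheight hP₅
  rw [h0₄] at h0₅
  rw [hr₄ 1 (by norm_num), hr₃ 1 (by norm_num)] at hy₅
  have hinj₅ : ∀ i < n, ∀ j < n, s₅.rmem 2 i = s₅.rmem 2 j → i = j := fun i hi j hj h => by
    rw [hy₅ i hi, hy₅ j hj] at h
    exact hinj i hi j hj (by simpa using h)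
  have hmark₅ : s₅.nmem 0 = s.nmem 0 := by
    rw [ha₅, ha₄ 0 (Or.inl rfl) (by norm_num), hmark₃]
  have hx₅ : s₅.rmem 0 = s.rmem 0 := by
    rw [hr₅ 0 (by norm_num), hr₄ 0 (by norm_num), hr₃ 0 (by norm_num)]
  refine Run.seq (passProg_spec (by norm_num) (hE₅ hE₄') (hT₅ hT₄) h0₅ hnK
    (fun i hi => by
      rw [ha₅, ha₄ 9 (Or.inr (Or.inl rfl)) (by norm_num), ha₃]
      exact hid i (by omega)) hinj₅ (by rw [hmul]; omega) ?_)
  intro s₆ m₆ hT₆ hU hP₆ hm₆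
  rw [hmul] at hm₆
  obtain ⟨h0₆, ha₆, -, hE₆⟩ := hpass (by norm_num) hP₆
  have hE₆' := hE₆ (hE₅ hE₄')
  have hdn : s₆.nmem 12 = s₄.nmem 12 := by
    rw [ha₆ 12 (Or.inr (Or.inr le_rfl)) (by norm_num), ha₅]
  rw [hmark₃, hr₃ 0 (by norm_num)] at hD
  rw [hmark₅, hx₅] at hU
  refine edgeProg_spec ⟨h0₆.trans h0₅, hE₆'.zero, hE₆'.one, hdn, rfl⟩
    (fun i hi h => (hD i hi).ne hy₃ hy₅ hi (hU i hi) h) (by omega) fun s₇ m₇ h₇ => ?_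
  exact ⟨_, _, _, _, hy₃, hy₅, hD, hU, h₇⟩

/-- Minimality of `K` gives `2 ^ (K - 1) < n`, so `2 ^ K` is less than `2 * n`, and `K - 1 ≤ 2 * log
n` because `log 2 > 1 / 2`. From `n ≥ 3 > e` comes `log n ≥ 1`, which lets every term be absorbed by
`n * log n ^ 2`. -/
theorem budget_le {n K : ℕ} (hn : 3 ≤ n) (hK : Nat.clog 2 n = K) :
    ((n * (1400 * K + 1500) + 7 * 2 ^ K + 2 * K + 150 : ℕ) : ℝ) ≤
      6000 * ((n : ℝ) * Real.log n ^ 2) := by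
  have hn' : (3 : ℝ) ≤ n := by exact_mod_cast hn
  have hlog : 1 ≤ Real.log n := by
    rw [Real.le_log_iff_exp_le (by linarith)]
    linarith [Real.exp_one_lt_d9]
  have hlogn : Real.log n ≤ n := Real.log_le_self (by linarith)
  have hpos : 0 < K := by
    rw [← hK]
    exact Nat.clog_pos (by norm_num) (by omega)
  have hpow : 2 ^ (K - 1) < n := by
    rw [← hK]
    exact Nat.pow_pred_clog_lt_self (by norm_num) (by omega)
  obtain ⟨e, rfl⟩ : ∃ e, K = e + 1 := ⟨K - 1, by omega⟩
  rw [Nat.add_sub_cancel] at hpow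
  have hpow' : (2 : ℝ) ^ e ≤ n := by exact_mod_cast hpow.le
  have he : (e : ℝ) ≤ 2 * Real.log n := by
    have h1 : (e : ℝ) * Real.log 2 ≤ Real.log n := by
      rw [← Real.log_pow]
      exact Real.log_le_log (by positivity) hpow'
    have h2 : (0 : ℝ) ≤ e := Nat.cast_nonneg e
    nlinarith [Real.log_two_gt_d9]
  have hL : Real.log n ≤ Real.log n ^ 2 := by nlinarith
  have h1 : (n : ℝ) * Real.log n ≤ n * Real.log n ^ 2 :=
    mul_le_mul_of_nonneg_left hL (by linarith)
  have h2 : (n : ℝ) ≤ n * Real.log n := by nlinarith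
  have h3 : (n : ℝ) * e ≤ 2 * (n * Real.log n) := by nlinarith
  push_cast
  rw [pow_succ]
  nlinarith

end RealRAM

theorem theorem2 :
    ∃ (A : RealRAM.Program) (C : ℝ),
      ∀ (k : ℕ) (P : RootedPointSet k), 1 < k → k < P.size →
        Set.InjOn yCoord (P.points : Set Plane) →
        ∀ p : Fin P.size ≃ {p : Plane // p ∈ P.points},
          ∃ (t : ℕ) (s : RealRAM.State) (G : GeomGraph P),
            A.HaltsIn (inputState P p) t s ∧
            (t : ℝ) ≤ C * ((P.size : ℝ) * Real.log (P.size : ℝ) ^ 2) ∧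
            OutputsGraph p s G ∧
            IsRootedYMonotone G ∧
            ∃ Gopt : GeomGraph P, IsRootedYMonotoneMinimum Gopt ∧ cost G ≤ 2 * cost Gopt := by
  refine ⟨⟨[], RealRAM.mainProg⟩, 6000, fun k P hk hkn hP p => ?_⟩
  set s := inputState P p with hs
  have hx : ∀ i : Fin P.size, s.rmem 0 i = xCoord (p i) := fun i => by simp [hs, inputState]
  have hy : ∀ i : Fin P.size, s.rmem 1 i = yCoord (p i) := fun i => by simp [hs, inputState]
  have hmark : ∀ i : Fin P.size, s.nmem 0 i = 1 ↔ IsRoot (p i) := fun i => by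
    simp [hs, inputState, IsRoot]
  have hzero : ∀ a, a ≠ 0 → ∀ v, s.nmem a v = 0 := fun a ha v => by simp [hs, inputState, ha]
  have hinj : ∀ i < P.size, ∀ j < P.size, s.rmem 1 i = s.rmem 1 j → i = j := fun i hi j hj h => by
    rw [hy ⟨i, hi⟩, hy ⟨j, hj⟩] at h
    simpa using p.injective (Subtype.ext (hP (p ⟨i, hi⟩).2 (p ⟨j, hj⟩).2 h))
  obtain ⟨t, s', m', hexec, ht, D, U, py, py', hpy, hpy', hD, hU, hout⟩ :=
    RealRAM.mainProg_spec (n := P.size) (s := s) rfl (by simp [hs, inputState])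
      (by simp [hs, inputState]) (RealRAM.TreeInv.of_mem_eq_zero (hzero 4 (by norm_num))
        (hzero 5 (by norm_num)) (hzero 6 (by norm_num)) fun v => by simp [hs, inputState]) hinj le_rfl
  have hcD : RealRAM.IsCode p 1 D := .of_isNearestCode (Or.inl rfl) hmark hx
    (fun i => by rw [hpy i i.2, hy]; norm_num) hD
  have hcU : RealRAM.IsCode p (-1) U := .of_isNearestCode (Or.inr rfl) hmark hx
    (fun i => by rw [hpy' i i.2, hy]; norm_num) hU
  refine ⟨t, s', _, hexec, ?_, RealRAM.outputsGraph_neighbourGraph hcD hcU hout,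
    neighbourGraph_isRootedYMonotone hP hcD.nearest hcU.nearest,
    exists_minimum_cost_le hP hcD.nearest hcU.nearest⟩
  -- The assumption `1 < k < P.size` yields at least three points.
  refine le_trans ?_ (RealRAM.budget_le (by omega) rfl)
  exact_mod_cast (Nat.le_add_right t m').trans ht
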